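/- Let $n\ge 1$, let $E_{n+1}$ be the last coordinate unit vector of $\mathbb{R}^{n+1}$, and let $F:\mathbb{S}^n\to(0,\infty)$ be a $C^2$ function with $\nabla^2F+F\sigma>0$, where $\sigma$ is the round metric of $\mathbb{S}^n$ and $\nabla$, $\nabla^2$ are its gradient and Hessian. Put $\Phi(z)=\nabla F(z)+F(z)z$ for $z\in\mathbb{S}^n$. Let $\omega_0\in\left(-F(E_{n+1}),F(-E_{n+1})\right)$, and let $E^F_{n+1}=\Phi(E_{n+1})/F(E_{n+1})$ if $\omega_0<0$, $E^F_{n+1}=-\Phi(-E_{n+1})/F(-E_{n+1})$ if $\omega_0>0$, and $E^F_{n+1}$ any unit vector if $\omega_0=0$. Let $\Sigma\subset\{x\in\mathbb{R}^{n+1}:\langle x,E_{n+1}\rangle\ge 0\}$ be a compact embedded $C^2$ hypersurface whose (possibly empty) boundary $\partial\Sigma$ lies on $\{\langle x,E_{n+1}\rangle=0\}$, and let $\nu$ be a continuous unit normal field on $\Sigma$ (for instance the outward one, if $\Sigma$ and the hyperplane enclose a domain). Assume that $\Sigma$ is anisotropic $\omega_0$-capillary, that is, $\langle\Phi(\nu),-E_{n+1}\rangle=\omega_0$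 on $\partial\Sigma$. Let $\kappa^F_1,\dots,\kappa^F_n$ be the anisotropic principal curvatures of $\Sigma$, i.e. the eigenvalues of $d(\Phi\circ\nu):T_p\Sigma\to T_p\Sigma$, let $H^F_r=\binom{n}{r}^{-1}\sum_{i_1<\dots<i_r}\kappa^F_{i_1}\cdots\kappa^F_{i_r}$ for $1\le r\le n$, and let $H^F_0=1$. Let $dA$ be the $n$-dimensional area measure of $\Sigma$. Then for every $r\in\{1,\dots,n\}$ the integrand below is integrable on $\Sigma$ and $$\int_\Sigma \Big[H^F_{r-1}\big(F(\nu)+\omega_0\langle\nu,E^F_{n+1}\rangle\big)-H^F_r\langle x,\nu\rangle\Big]\,dA=0 .$$ In particular, $$\int_\Sigma \Big[F(\nu)+\omega_0\langle\nu,E^F_{n+1}\rangle-H^F_1\langle x,\nu\rangle\Big]\,dA=0 .$$ -/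

import Mathlib

open scoped Manifold ContDiff RealInnerProductSpace MeasureTheory

noncomputable section

namespace AnisotropicCapillary

/-- The Euclidean space `ℝ^{n+1}`. -/
abbrev Space (n : ℕ) := EuclideanSpace ℝ (Fin (n + 1))

/-- The unit sphere `𝕊^n ⊂ ℝ^{n+1}`. -/
abbrev Sph (n : ℕ) := Metric.sphere (0 : Space n) 1

/-- The dimension fact that gives `𝕊^n` its smooth structure in Mathlib. -/
instance factFinrankSpace (n : ℕ) : Fact (Module.finrank ℝ (Space n) = n + 1) :=
  ⟨by simp⟩

/-- The last coordinate unit vector `E_{n+1}`, as a point of `𝕊^n`. -/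
def lastVec (n : ℕ) : Sph n :=
  ⟨EuclideanSpace.single (Fin.last n) (1 : ℝ), by simp⟩

/-! ### Calculus on the sphere, and the anisotropy -/

section Anisotropy

variable {n : ℕ}

/-- The extension of `F : 𝕊^n → ℝ` to `ℝ^{n+1} ∖ {0}` that is constant along rays,
`x ↦ F (x / |x|)` (with value `0` at the origin). -/
def radialExt (F : Sph n → ℝ) (x : Space n) : ℝ :=
  open Classical in
  if h : x = 0 then 0 else F ⟨‖x‖⁻¹ • x, by simp [norm_smul, h]⟩

/-- The gradient `∇F` on the round sphere, as a vector of `ℝ^{n+1}` tangent to `𝕊^n` at `z`.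
As the extension is constant along rays, its Euclidean gradient at `z` is the spherical one. -/
def sphGrad (F : Sph n → ℝ) (z : Sph n) : Space n :=
  gradient (radialExt F) (z : Space n)

/-- The Hessian `∇²F(u, v)` on the round sphere at `z`, for `u`, `v` orthogonal to `z`.
As the radial derivative of the extension vanishes, the spherical Hessian is the restriction to
`z^⊥` of the Euclidean second derivative of the extension at `z`. -/
def sphHess (F : Sph n → ℝ) (z : Sph n) (u v : Space n) : ℝ :=
  fderiv ℝ (fderiv ℝ (radialExt F)) (z : Space n) u v

/-- The assumptions on the anisotropy: `F` is a positive `C²` function on `𝕊^n` with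
`A_F = ∇²F + F σ > 0`, where `σ` is the round metric. -/
structure IsAnisotropy (F : Sph n → ℝ) : Prop where
  contMDiff : ContMDiff (𝓡 n) 𝓘(ℝ, ℝ) 2 F
  pos : ∀ z, 0 < F z
  elliptic : ∀ (z : Sph n) (u : Space n), ⟪(z : Space n), u⟫ = 0 → u ≠ 0 →
    0 < sphHess F z u u + F z * ⟪u, u⟫

/-- The Cahn–Hoffman map `Φ(z) = ∇F(z) + F(z) z`. -/
def cahnHoffman (F : Sph n → ℝ) (z : Sph n) : Space n :=
  sphGrad F z + F z • (z : Space n)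

/-- `V` is an admissible choice of the constant vector `E^F_{n+1}`: it is
`Φ(E_{n+1}) / F(E_{n+1})` if `ω₀ < 0`, it is `-Φ(-E_{n+1}) / F(-E_{n+1})` if `ω₀ > 0`,
and it is any unit vector if `ω₀ = 0`. -/
structure IsCapillaryVector (F : Sph n → ℝ) (ω₀ : ℝ) (V : Space n) : Prop where
  of_neg : ω₀ < 0 → V = (F (lastVec n))⁻¹ • cahnHoffman F (lastVec n)
  of_pos : 0 < ω₀ → V = -((F (-lastVec n))⁻¹ • cahnHoffman F (-lastVec n))
  of_zero : ω₀ = 0 → ‖V‖ = 1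

end Anisotropy

/-! ### Hypersurfaces with boundary -/

section Hypersurface

variable {n : ℕ}

/-- Near `p ∈ S`, the set `S` is an embedded `C²` hypersurface without boundary: it is a regular
level set of a `C²` function. -/
def IsInteriorPoint (S : Set (Space n)) (p : Space n) : Prop :=
  p ∈ S ∧ ∃ (U : Set (Space n)) (f : Space n → ℝ), IsOpen U ∧ p ∈ U ∧
    ContDiffOn ℝ 2 f U ∧ fderiv ℝ f p ≠ 0 ∧
    S ∩ U = {x | x ∈ U ∧ f x = 0}

/-- Near `p ∈ S`, the set `S` is an embedded `C²` hypersurface with boundary, and `p` is on its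
boundary: `S` is the part `{g ≥ 0}` of the hypersurface `{f = 0}`, where `f` and `g` are `C²`
functions that vanish at `p` and have independent differentials there. -/
def IsBoundaryPoint (S : Set (Space n)) (p : Space n) : Prop :=
  p ∈ S ∧ ∃ (U : Set (Space n)) (f g : Space n → ℝ), IsOpen U ∧ p ∈ U ∧
    ContDiffOn ℝ 2 f U ∧ ContDiffOn ℝ 2 g U ∧ f p = 0 ∧ g p = 0 ∧
    LinearIndependent ℝ ![fderiv ℝ f p, fderiv ℝ g p] ∧
    S ∩ U = {x | x ∈ U ∧ f x = 0 ∧ 0 ≤ g x}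

/-- The boundary `∂S` of the hypersurface `S`. -/
def bdry (S : Set (Space n)) : Set (Space n) := {p | IsBoundaryPoint S p}

/-- `S` is a compact embedded `C²` hypersurface, possibly with boundary, of `ℝ^{n+1}`. -/
structure IsCompactHypersurface (S : Set (Space n)) : Prop where
  isCompact : IsCompact S
  locally_regular : ∀ p ∈ S, IsInteriorPoint S p ∨ IsBoundaryPoint S p

/-- `ν` is a continuous unit normal field on `S`. (Over `ℝ`, Mathlib's `tangentConeAt` allows
scalars of both signs, so for a hypersurface with boundary it is the full tangent space `T_p S`,
also at boundary points.) -/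
structure IsUnitNormal (S : Set (Space n)) (ν : Space n → Sph n) : Prop where
  continuousOn : ContinuousOn ν S
  normal : ∀ p ∈ S, ∀ v ∈ tangentConeAt ℝ S p, ⟪(ν p : Space n), v⟫ = 0

/-- `S`, with unit normal field `ν`, is a compact embedded `C²` anisotropic `ω₀`-capillary
hypersurface in the closed half-space `{x_{n+1} ≥ 0}`: its boundary lies on the hyperplane
`{x_{n+1} = 0}`, and `⟨Φ(ν), -E_{n+1}⟩ = ω₀` along the boundary. -/
structure IsCapillaryHypersurface (F : Sph n → ℝ) (ω₀ : ℝ) (S : Set (Space n))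
    (ν : Space n → Sph n) : Prop where
  hypersurface : IsCompactHypersurface S
  subset_halfSpace : ∀ p ∈ S, 0 ≤ p (Fin.last n)
  bdry_subset : ∀ p ∈ bdry S, p (Fin.last n) = 0
  unitNormal : IsUnitNormal S ν
  capillary : ∀ p ∈ bdry S, ⟪cahnHoffman F (ν p), -(lastVec n : Space n)⟫ = ω₀

/-! ### Anisotropic curvatures -/

/-- The anisotropic normal `ν_F = Φ(ν)`. -/
def anisoNormal (F : Sph n → ℝ) (ν : Space n → Sph n) (x : Space n) : Space n :=
  cahnHoffman F (ν x)

/-- The tangent space `T_p S = ν(p)^⊥`. -/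
abbrev tangent (ν : Space n → Sph n) (p : Space n) : Submodule ℝ (Space n) :=
  (Submodule.span ℝ {(ν p : Space n)})ᗮ

/-- The anisotropic Weingarten map `dν_F : T_p S → T_p S`. The derivative of `ν_F` within `S` is
determined by `ν_F` on `T_p S`, and it maps `T_p S` to itself; the orthogonal projection onto
`T_p S` only serves to record this in the type. -/
def weingarten (F : Sph n → ℝ) (S : Set (Space n)) (ν : Space n → Sph n) (p : Space n) :
    tangent ν p →ₗ[ℝ] tangent ν p :=
  ((tangent ν p).orthogonalProjectionOnto.comp
    ((fderivWithin ℝ (anisoNormal F ν) S p).comp (tangent ν p).subtypeL)).toLinearMap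

/-- The anisotropic principal curvatures `κ^F_1, …, κ^F_n` at `p`: the eigenvalues of the
anisotropic Weingarten map, with multiplicity. -/
def principalCurvatures (F : Sph n → ℝ) (S : Set (Space n)) (ν : Space n → Sph n)
    (p : Space n) : Multiset ℝ :=
  (weingarten F S ν p).charpoly.roots

/-- The normalized `r`-th anisotropic mean curvature `H^F_r = σ_r(κ^F) / binom n r`;
in particular `H^F_0 = 1`. -/
def meanCurvature (F : Sph n → ℝ) (S : Set (Space n)) (ν : Space n → Sph n) (r : ℕ)
    (p : Space n) : ℝ :=
  (principalCurvatures F S ν p).esymm r / (n.choose r : ℝ)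

end Hypersurface

end AnisotropicCapillary

end

/-! Fix a real `s` and put Z = s x + Φ(ν) + ω₀ V on the hypersurface. Along the boundary x lies in
the hyperplane {x_{n+1} = 0}. So does Z, because ⟨Φ(ν), E⟩ = -ω₀ there and ω₀⟨V, E⟩ = ω₀
(`IsCapillaryHypersurface.last_eq_zero`). Hence x, Z and the n - 1 boundary derivatives of Z are n +
1 vectors in an n-dimensional space, the (n-1)-form det(x, Z, dZ, …, dZ) vanishes on the boundary,
and its exterior derivative integrates to zero over the hypersurface.

On the tangent space dZ = s + dν_F, and Z has normal component s⟨x,ν⟩ + F(ν) + ω₀⟨ν,V⟩. With P(s) =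
∏ (s + κ_i), the exterior derivative is therefore, up to a constant factor, the area form times
(s⟨x,ν⟩ + F(ν) + ω₀⟨ν,V⟩) P'(s) - n⟨x,ν⟩ P(s) (`fluxDensity_one_zero`). Its integral vanishes for
every `s`, so each coefficient integrates to zero. The coefficient of s^(n-r) is r·binom(n,r) times
the r-th integrand (`coeff_minkowskiPoly`). Writing P in this way needs n real curvatures: the
Weingarten map is a positive operator composed with a symmetric one (`splits_charpoly_comp`).

Z is only C¹, so Stokes' formula cannot be obtained by differentiating dZ. It comes from the
determinant being a null Lagrangian (`integral_det_fderiv_halfSpace`): for small ε the map id + εW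
permutes a large half-ball, so its Jacobian, a polynomial in ε, integrates to a constant. Applying
this to W(t, y) = u(t) Z(y) + τ v(t) A(y) and taking the term linear in τ gives the required Stokes
formula (`integral_detDeriv_halfSpace`), with A a cut-off of x.

The formula is applied in half-space charts (`exists_surfaceChart`), carried to the surface measure
by the area formula (`integral_image_eq_integral_normDet`), and summed over a partition of unity,
whose differentials add up to zero (`integral_eval_minkowskiPoly`). -/

noncomputable section

namespace AnisotropicCapillary

/-! ### Polynomials determined by their values -/

section Interpolation

open Polynomial

/-- On polynomials of degree at most `d`, a coefficient is a fixed linear combination of the values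
at points of a given infinite set. -/
lemma exists_coeff_eq_sum_eval {T : Set ℝ} (hT : T.Infinite) (d k : ℕ) :
    ∃ (t : Fin (d + 1) → ℝ) (c : Fin (d + 1) → ℝ), (∀ i, t i ∈ T) ∧
      ∀ p : ℝ[X], p.natDegree ≤ d → p.coeff k = ∑ i, c i * p.eval (t i) := by
  obtain ⟨s, hsT, hs⟩ := hT.exists_subset_card_eq (d + 1)
  let e : Fin (d + 1) ≃ s := (Fintype.equivFinOfCardEq (by simpa using hs)).symm
  let v : Fin (d + 1) → ℝ := fun i => e i
  have hv : Set.InjOn v (Finset.univ : Finset (Fin (d + 1))) := fun i _ j _ h =>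
    e.injective (Subtype.ext h)
  refine ⟨v, fun i => (Lagrange.basis Finset.univ v i).coeff k, fun i => hsT (e i).2, ?_⟩
  intro p hp
  have hdeg : p.degree < (Finset.univ : Finset (Fin (d + 1))).card := by
    refine lt_of_le_of_lt degree_le_natDegree ?_
    rw [Finset.card_univ, Fintype.card_fin]
    exact_mod_cast Nat.lt_succ_of_le hp
  conv_lhs => rw [Lagrange.eq_interpolate hv hdeg, Lagrange.interpolate_apply]
  simp [finsetSum_coeff, coeff_C_mul, mul_comm]

variable {α : Type*} [MeasurableSpace α] {μ : MeasureTheory.Measure α} {p : α → ℝ[X]} {d : ℕ}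

/-- The interpolation weights do not depend on the point `a`, so finitely many parameter values
suffice and no uniformity in the parameter is needed. -/
lemma integrable_coeff_of_integrable_eval (hd : ∀ a, (p a).natDegree ≤ d) {T : Set ℝ}
    (hT : T.Infinite) (h : ∀ τ ∈ T, MeasureTheory.Integrable (fun a => (p a).eval τ) μ) (k : ℕ) :
    MeasureTheory.Integrable (fun a => (p a).coeff k) μ := by
  obtain ⟨t, c, ht, hc⟩ := exists_coeff_eq_sum_eval hT d k
  simp_rw [fun a => hc (p a) (hd a)]
  exact MeasureTheory.integrable_finsetSum _ fun i _ => (h _ (ht i)).const_mul _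

lemma integral_coeff_eq_zero_of_eval (hd : ∀ a, (p a).natDegree ≤ d) {T : Set ℝ}
    (hT : T.Infinite) (h : ∀ τ ∈ T, MeasureTheory.Integrable (fun a => (p a).eval τ) μ)
    (h0 : ∀ τ ∈ T, ∫ a, (p a).eval τ ∂μ = 0) (k : ℕ) :
    ∫ a, (p a).coeff k ∂μ = 0 := by
  obtain ⟨t, c, ht, hc⟩ := exists_coeff_eq_sum_eval hT d k
  simp_rw [fun a => hc (p a) (hd a)]
  rw [MeasureTheory.integral_finsetSum _ fun i _ => (h _ (ht i)).const_mul _]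
  exact Finset.sum_eq_zero fun i _ => by
    rw [MeasureTheory.integral_const_mul, h0 _ (ht i), mul_zero]

end Interpolation

/-! ### The derivative of the determinant -/

section DetDeriv

variable {E : Type*} [NormedAddCommGroup E] [NormedSpace ℝ E]

lemma det_comp (M N : E →L[ℝ] E) : (M ∘L N).det = M.det * N.det :=
  LinearMap.det_comp _ _

lemma det_conj {F : Type*} [NormedAddCommGroup F] [NormedSpace ℝ F]
    (e : F ≃L[ℝ] E) (M : F →L[ℝ] F) :
    ((e : F →L[ℝ] E) ∘L M ∘L (e.symm : E →L[ℝ] F)).det = M.det :=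
  LinearMap.det_conj M.toLinearMap e.toLinearEquiv

variable [FiniteDimensional ℝ E]

lemma det_eq_det_toMatrix (M : E →L[ℝ] E) :
    M.det = (LinearMap.toMatrix (Module.finBasis ℝ E) (Module.finBasis ℝ E) M.toLinearMap).det :=
  (LinearMap.det_toMatrix (Module.finBasis ℝ E) M.toLinearMap).symm

lemma contDiff_det {m : WithTop ℕ∞} : ContDiff ℝ m (fun M : E →L[ℝ] E => M.det) := by
  simp_rw [det_eq_det_toMatrix, Matrix.det_apply]
  refine ContDiff.sum fun σ _ => ContDiff.const_smul _ (contDiff_prod fun i _ => ?_)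
  let c : (E →L[ℝ] E) →ₗ[ℝ] ℝ := (Module.finBasis ℝ E).coord (σ i) ∘ₗ
    (ContinuousLinearMap.apply ℝ E (Module.finBasis ℝ E i)).toLinearMap
  have : (fun M : E →L[ℝ] E => LinearMap.toMatrix (Module.finBasis ℝ E) (Module.finBasis ℝ E)
      M.toLinearMap (σ i) i) = LinearMap.toContinuousLinearMap c := by
    ext M; simp [LinearMap.toMatrix_apply, c]
  rw [this]
  exact ContinuousLinearMap.contDiff _

/-- The derivative of the determinant at `M`, in the direction `N`. -/
def detDeriv (M : E →L[ℝ] E) : (E →L[ℝ] E) →L[ℝ] ℝ :=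
  fderiv ℝ (fun M : E →L[ℝ] E => M.det) M

lemma hasDerivAt_det_line (M N : E →L[ℝ] E) :
    HasDerivAt (fun τ : ℝ => (M + τ • N).det) (detDeriv M N) 0 := by
  have h1 : HasFDerivAt (fun M : E →L[ℝ] E => M.det) (detDeriv M) (M + (0 : ℝ) • N) := by
    simpa using! ((contDiff_det (m := 1)).differentiable (by simp) M).hasFDerivAt
  have h2 : HasDerivAt (fun τ : ℝ => M + τ • N) N 0 := by
    simpa using ((hasDerivAt_id (0 : ℝ)).smul_const N).const_add M
  exact h1.comp_hasDerivAt 0 h2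

/-- All later derivatives of determinants are found this way: evaluate the determinant on the line
exactly, then differentiate in one variable. -/
lemma detDeriv_eq {M N : E →L[ℝ] E} {f : ℝ → ℝ} {c : ℝ}
    (hf : ∀ τ, (M + τ • N).det = f τ) (hc : HasDerivAt f c 0) : detDeriv M N = c :=
  (hasDerivAt_det_line M N).unique (by simpa [funext hf] using! hc)

lemma continuous_detDeriv :
    Continuous fun x : (E →L[ℝ] E) × (E →L[ℝ] E) => detDeriv x.1 x.2 :=
  (((contDiff_det (m := 1)).continuous_fderiv (by simp)).comp continuous_fst).clm_apply
    continuous_snd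

lemma detDeriv_comp_right (M N G : E →L[ℝ] E) :
    detDeriv (M ∘L G) (N ∘L G) = G.det * detDeriv M N := by
  refine detDeriv_eq (f := fun τ => G.det * (M + τ • N).det) (fun τ => ?_)
    ((hasDerivAt_det_line M N).const_mul _)
  rw [mul_comm, ← det_comp]
  congr 1

lemma detDeriv_conj {F : Type*} [NormedAddCommGroup F] [NormedSpace ℝ F] [FiniteDimensional ℝ F]
    (e : F ≃L[ℝ] E) (M N : F →L[ℝ] F) :
    detDeriv ((e : F →L[ℝ] E) ∘L M ∘L (e.symm : E →L[ℝ] F))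
      ((e : F →L[ℝ] E) ∘L N ∘L (e.symm : E →L[ℝ] F)) = detDeriv M N := by
  refine detDeriv_eq (f := fun τ => (M + τ • N).det) (fun τ => ?_) (hasDerivAt_det_line M N)
  rw [← det_conj e]
  congr 1
  ext x
  simp

/-- The determinant along a line, as a polynomial. -/
def detLine (M N : E →L[ℝ] E) : Polynomial ℝ :=
  Matrix.det ((Polynomial.X : Polynomial ℝ) •
    (LinearMap.toMatrix (Module.finBasis ℝ E) (Module.finBasis ℝ E) N.toLinearMap).map Polynomial.C
    + (LinearMap.toMatrix (Module.finBasis ℝ E) (Module.finBasis ℝ E) M.toLinearMap).map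
      Polynomial.C)

lemma natDegree_detLine_le (M N : E →L[ℝ] E) : (detLine M N).natDegree ≤ Module.finrank ℝ E := by
  simpa [detLine] using Polynomial.natDegree_det_X_add_C_le
    (LinearMap.toMatrix (Module.finBasis ℝ E) (Module.finBasis ℝ E) N.toLinearMap)
    (LinearMap.toMatrix (Module.finBasis ℝ E) (Module.finBasis ℝ E) M.toLinearMap)

lemma eval_detLine (M N : E →L[ℝ] E) (τ : ℝ) : (detLine M N).eval τ = (M + τ • N).det := by
  rw [det_eq_det_toMatrix, detLine, ← Polynomial.coe_evalRingHom, RingHom.map_det]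
  congr 1
  ext i j
  simp [add_comm, mul_comm τ]

lemma coeff_one_detLine (M N : E →L[ℝ] E) : (detLine M N).coeff 1 = detDeriv M N := by
  symm
  refine detDeriv_eq (f := fun τ => (detLine M N).eval τ) (fun τ => (eval_detLine M N τ).symm) ?_
  have h := (detLine M N).hasDerivAt 0
  rwa [← Polynomial.coeff_zero_eq_eval_zero, Polynomial.coeff_derivative, zero_add, Nat.cast_zero,
    zero_add, mul_one] at h

end DetDeriv

/-! ### The determinant is a null Lagrangian, on a half-space -/

section NullLagrangian

open MeasureTheory Metric Set

variable {E : Type*} [NormedAddCommGroup E] [NormedSpace ℝ E] [FiniteDimensional ℝ E]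
  [MeasurableSpace E] [BorelSpace E] (μ : Measure E) [μ.IsAddHaarMeasure]

/-- A map that differs from the identity by a small compactly supported field which preserves the
hyperplane `{ℓ = 0}` maps each large half-ball onto itself; so its Jacobian integrates to the
volume. -/
lemma exists_integral_det_id_add_smul (hd : 0 < Module.finrank ℝ E) {ℓ : E →L[ℝ] ℝ} {v : E}
    (hv : ℓ v = 1) {W : E → E} (hW : ContDiff ℝ 1 W) (hc : HasCompactSupport W)
    (hb : ∀ y, ℓ y = 0 → ℓ (W y) = 0) {r : ℝ} (hr : tsupport W ⊆ closedBall 0 r) :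
    ∃ ε₀ : ℝ, 0 < ε₀ ∧ ∀ ε : ℝ, 0 < ε → ε < ε₀ →
      ∫ y in closedBall 0 r ∩ {y | 0 < ℓ y},
        (ContinuousLinearMap.id ℝ E + ε • fderiv ℝ W y).det ∂μ
        = μ.real (closedBall 0 r ∩ {y | 0 < ℓ y}) := by
  have : Nontrivial E := Module.finrank_pos_iff.1 hd
  obtain ⟨C, hC⟩ := hW.lipschitzWith_of_hasCompactSupport hc (by simp)
  have hpos : ∀ᶠ M in nhds (ContinuousLinearMap.id ℝ E), 0 < M.det := by
    refine (contDiff_det (m := 0)).continuous.continuousAt.eventually (lt_mem_nhds ?_)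
    simp [ContinuousLinearMap.det]
  obtain ⟨δ, hδ, hδpos⟩ := Metric.eventually_nhds_iff.1 hpos
  -- One constant dominates both the Lipschitz constant `C` of `W` and the constant C‖ℓ‖‖v‖ that
  -- bounds ℓ(W y) by |ℓ y|; the final 1 keeps it positive.
  set k : ℝ := C * (1 + ‖ℓ‖ * ‖v‖) + 1 with hk
  have hk1 : 1 ≤ k := by
    have : 0 ≤ C * (1 + ‖ℓ‖ * ‖v‖) := by positivity
    linarith
  refine ⟨min (1 / k) (δ / k), by positivity, fun ε hε hεlt => ?_⟩
  have hεk : ε * k < 1 := (lt_div_iff₀ (by positivity)).1 (hεlt.trans_le (min_le_left _ _))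
  have hεδ : ε * k < δ := (lt_div_iff₀ (by positivity)).1 (hεlt.trans_le (min_le_right _ _))
  have hCk : (C : ℝ) ≤ k := by
    have := mul_nonneg C.coe_nonneg (mul_nonneg (norm_nonneg ℓ) (norm_nonneg v))
    simp only [hk]; nlinarith
  have hεC : ε * C < 1 := by nlinarith
  set g : E → E := fun y => y + ε • W y with hg
  have hgd : ∀ y, HasFDerivAt g (ContinuousLinearMap.id ℝ E + ε • fderiv ℝ W y) y := fun y =>
    (hasFDerivAt_id y).add (((hW.differentiable (by simp)) y).hasFDerivAt.const_smul ε)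
  have hdist : ∀ a b, ‖W a - W b‖ ≤ C * ‖a - b‖ := fun a b => by
    simpa [dist_eq_norm] using hC.dist_le_mul a b
  have happ : ApproximatesLinearOn g
      ((ContinuousLinearEquiv.refl ℝ E : E ≃L[ℝ] E) : E →L[ℝ] E) univ
      (⟨ε, hε.le⟩ * C : NNReal) := by
    refine ApproximatesLinearOn.approximatesLinearOn_iff_lipschitzOnWith.2 (LipschitzOnWith.of_dist_le_mul ?_)
    intro a _ b _
    have h1 : (g - ⇑((ContinuousLinearEquiv.refl ℝ E : E ≃L[ℝ] E) : E →L[ℝ] E)) = fun y => ε • W y := by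
      ext y; simp [hg]
    rw [h1, dist_eq_norm, ← smul_sub, norm_smul, Real.norm_of_nonneg hε.le, dist_eq_norm]
    calc ε * ‖W a - W b‖ ≤ ε * (C * ‖a - b‖) := by gcongr; exact hdist a b
      _ = _ := by rw [← mul_assoc]; rfl
  have hclt : (⟨ε, hε.le⟩ * C : NNReal) <
      ‖((ContinuousLinearEquiv.refl ℝ E).symm : E →L[ℝ] E)‖₊⁻¹ := by
    have : ‖((ContinuousLinearEquiv.refl ℝ E).symm : E →L[ℝ] E)‖₊ = 1 := by
      ext; simp
    rw [this, inv_one]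
    exact_mod_cast hεC
  have hinj : Function.Injective g :=
    injOn_univ.1 (happ.injOn (Or.inr hclt))
  have hsurj : Function.Surjective g := happ.surjective (Or.inr hclt)
  have hout : ∀ y, y ∉ closedBall (0 : E) r → g y = y := fun y hy => by
    simp [hg, image_eq_zero_of_notMem_tsupport fun h => hy (hr h)]
  -- Compare y with its projection y - ℓ(y) v to the hyperplane, where ℓ ∘ W vanishes. As ε k < 1,
  -- the perturbation cannot change the sign of ℓ.
  have hlin : ∀ y, |ε * ℓ (W y)| ≤ ε * k * |ℓ y| := by
    intro y
    have h0 : ℓ (y - ℓ y • v) = 0 := by simp [hv]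
    have h1 : ℓ (W y) = ℓ (W y - W (y - ℓ y • v)) := by simp [hb _ h0]
    rw [abs_mul, abs_of_pos hε, mul_assoc]
    gcongr
    calc |ℓ (W y)| ≤ ‖ℓ‖ * (C * ‖ℓ y • v‖) := by
          rw [h1]
          refine (ℓ.le_opNorm _).trans ?_
          gcongr
          simpa using hdist y (y - ℓ y • v)
      _ = (C * (‖ℓ‖ * ‖v‖)) * |ℓ y| := by rw [norm_smul, Real.norm_eq_abs]; ring
      _ ≤ k * |ℓ y| := by
          gcongr
          have := C.coe_nonneg
          simp only [hk]; linarith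
  have hhalf : ∀ y, 0 < ℓ (g y) ↔ 0 < ℓ y := by
    intro y
    have h1 : ℓ (g y) = ℓ y + ε * ℓ (W y) := by simp [hg]
    rw [h1]
    have h2 := abs_le.1 (hlin y)
    constructor
    · intro h
      by_contra hle
      rw [abs_of_nonpos (not_lt.1 hle)] at h2
      nlinarith
    · intro h
      rw [abs_of_pos h] at h2
      nlinarith
  -- A bijection that fixes every point outside the ball maps the ball onto itself.
  have himage : g '' (closedBall 0 r ∩ {y | 0 < ℓ y}) = closedBall 0 r ∩ {y | 0 < ℓ y} := by
    ext z
    constructor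
    · rintro ⟨y, ⟨hy, hy'⟩, rfl⟩
      refine ⟨?_, (hhalf y).2 hy'⟩
      by_contra hz
      exact hz (by rwa [hinj (hout _ hz)])
    · rintro ⟨hz, hz'⟩
      obtain ⟨y, rfl⟩ := hsurj z
      refine ⟨y, ⟨?_, (hhalf y).1 hz'⟩, rfl⟩
      by_contra hy
      exact hy (by rwa [hout _ hy] at hz)
  have hmeas : MeasurableSet (closedBall (0 : E) r ∩ {y | 0 < ℓ y}) :=
    measurableSet_closedBall.inter (measurableSet_lt measurable_const ℓ.continuous.measurable)
  have hcv := integral_image_eq_integral_abs_det_fderiv_smul μ hmeas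
    (fun y _ => (hgd y).hasFDerivWithinAt) hinj.injOn (fun _ => (1 : ℝ))
  rw [himage] at hcv
  simp only [smul_eq_mul, mul_one, integral_const, measureReal_restrict_apply_univ] at hcv
  rw [hcv]
  refine integral_congr_ae (Filter.Eventually.of_forall fun y => (abs_of_pos ?_).symm)
  refine hδpos ?_
  rw [dist_eq_norm, add_sub_cancel_left, norm_smul, Real.norm_of_nonneg hε.le]
  calc ε * ‖fderiv ℝ W y‖ ≤ ε * k := by
        gcongr
        exact (norm_fderiv_le_of_lipschitz ℝ hC).trans hCk
    _ < δ := hεδ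

/-- The determinant is a null Lagrangian: for a compactly supported `C¹` field which preserves the
hyperplane `{ℓ = 0}`, its Jacobian has integral zero over the half-space `{ℓ > 0}`. -/
theorem integral_det_fderiv_halfSpace (hd : 0 < Module.finrank ℝ E) {ℓ : E →L[ℝ] ℝ} {v : E}
    (hv : ℓ v = 1) {W : E → E} (hW : ContDiff ℝ 1 W) (hc : HasCompactSupport W)
    (hb : ∀ y, ℓ y = 0 → ℓ (W y) = 0) :
    ∫ y in {y | 0 < ℓ y}, (fderiv ℝ W y).det ∂μ = 0 := by
  obtain ⟨r, hr⟩ := hc.isCompact.isBounded.subset_closedBall 0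
  obtain ⟨ε₀, hε₀, h⟩ := exists_integral_det_id_add_smul μ hd hv hW hc hb hr
  set B : Set E := closedBall 0 r ∩ {y | 0 < ℓ y} with hB
  have hmH : MeasurableSet {y : E | 0 < ℓ y} :=
    measurableSet_lt measurable_const ℓ.continuous.measurable
  have hBfin : μ B ≠ ⊤ :=
    ((measure_mono inter_subset_left).trans_lt measure_closedBall_lt_top).ne
  have hcont : ∀ c : ℝ, Continuous fun y => (fderiv ℝ W y + c • ContinuousLinearMap.id ℝ E).det :=
    fun c => (contDiff_det (m := 0)).continuous.comp
      ((hW.continuous_fderiv (by simp)).add continuous_const)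
  have hint : ∀ c : ℝ, IntegrableOn
      (fun y => (fderiv ℝ W y + c • ContinuousLinearMap.id ℝ E).det) B μ := fun c =>
    ((hcont c).continuousOn.integrableOn_compact (isCompact_closedBall (0 : E) r)).mono_set
      inter_subset_left
  set d := Module.finrank ℝ E with hdd
  -- With τ = 1/ε, det(DW + τ) = τ^d det(1 + εDW), so this polynomial integrates to zero over the
  -- half-ball for all large τ. Its constant term is det DW because d > 0.
  let p : E → Polynomial ℝ := fun y =>
    detLine (fderiv ℝ W y) (ContinuousLinearMap.id ℝ E) - Polynomial.X ^ d
  have hp : ∀ y τ, (p y).eval τ = (fderiv ℝ W y + τ • ContinuousLinearMap.id ℝ E).det - τ ^ d :=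
    fun y τ => by simp [p, eval_detLine]
  have key := integral_coeff_eq_zero_of_eval (μ := μ.restrict B) (p := p) (d := d)
    (T := Ioi (1 / ε₀)) (fun y => (Polynomial.natDegree_sub_le _ _).trans
      (max_le (natDegree_detLine_le _ _) (by simp))) (Ioi_infinite _)
    (fun τ _ => by
      simp_rw [hp]
      exact (hint τ).sub (integrableOn_const hBfin)) (fun τ hτ => by
      have hτ0 : 0 < τ := lt_trans (by positivity) hτ
      simp_rw [hp]
      have hh := h τ⁻¹ (by positivity) (by
        have := mem_Ioi.1 hτ
        rw [inv_lt_comm₀ hτ0 hε₀]; simpa using this)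
      have heq : ∀ y, (fderiv ℝ W y + τ • ContinuousLinearMap.id ℝ E).det
          = τ ^ d * (ContinuousLinearMap.id ℝ E + τ⁻¹ • fderiv ℝ W y).det := by
        intro y
        have := LinearMap.det_smul τ
          (ContinuousLinearMap.id ℝ E + τ⁻¹ • fderiv ℝ W y).toLinearMap
        rw [ContinuousLinearMap.det, ContinuousLinearMap.det, ← this]
        congr 1
        ext x
        simp [smul_smul, hτ0.ne', add_comm]
      rw [integral_sub (hint τ) (integrableOn_const hBfin)]
      simp_rw [heq]
      rw [integral_const_mul, hh]
      simp [mul_comm]) 0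
  have hcoeff : ∀ y, (p y).coeff 0 = (fderiv ℝ W y).det := fun y => by
    rw [Polynomial.coeff_zero_eq_eval_zero, hp]
    simp [hd.ne']
  simp_rw [hcoeff] at key
  refine Eq.trans ?_ key
  rw [hB]
  refine setIntegral_eq_of_subset_of_forall_sdiff_eq_zero hmH inter_subset_right ?_
  rintro y ⟨hy1, hy2⟩
  have : fderiv ℝ W y = 0 := by
    refine image_eq_zero_of_notMem_tsupport fun hy => hy2 ⟨hr (tsupport_fderiv_subset ℝ hy), hy1⟩
  rw [this]
  simpa [ContinuousLinearMap.det] using hd.ne'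

end NullLagrangian

/-! ### Stokes' formula for the cone over a map -/

section Cone

open MeasureTheory Metric Set

variable {V F : Type*} [NormedAddCommGroup V] [NormedSpace ℝ V]
  [NormedAddCommGroup F] [NormedSpace ℝ F]

/-- The linear map `(s, u) ↦ s a + L u`: the matrix `L` with the column `a` put in front. -/
def col (a : F) (L : V →L[ℝ] F) : ℝ × V →L[ℝ] F :=
  (ContinuousLinearMap.toSpanSingleton ℝ a).coprod L

@[simp] lemma col_apply (a : F) (L : V →L[ℝ] F) (x : ℝ × V) : col a L x = x.1 • a + L x.2 := by
  simp [col]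

lemma continuous_col : Continuous fun x : F × (V →L[ℝ] F) => col x.1 x.2 := by
  have : (fun x : F × (V →L[ℝ] F) => col x.1 x.2) = fun x =>
      (ContinuousLinearMap.fst ℝ ℝ V).smulRight x.1 + x.2 ∘L ContinuousLinearMap.snd ℝ ℝ V := by
    ext x <;> simp
  rw [this]
  exact (((ContinuousLinearMap.smulRightL ℝ (ℝ × V) F (ContinuousLinearMap.fst ℝ ℝ V)).continuous).comp
    continuous_fst).add (continuous_snd.clm_comp continuous_const)

/-- A cut-off profile `v`, and a function `u` which is the identity near the support of `v`. -/
lemma exists_cone_profiles : ∃ u v : ℝ → ℝ, ContDiff ℝ 1 u ∧ ContDiff ℝ 1 v ∧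
    HasCompactSupport u ∧ HasCompactSupport v ∧
    (∀ s, s ∈ tsupport v → 0 < s ∧ u s = s ∧ deriv u s = 1) ∧
    ∀ m : ℕ, 0 < ∫ s, s ^ m * v s := by
  -- The support of `v` is [1, 3], which lies in the interior of the interval [1/2, 7/2] where `w`
  -- equals 1; hence u(s) = s w(s) is the identity near it.
  let w : ContDiffBump (2 : ℝ) := ⟨3 / 2, 7 / 4, by norm_num, by norm_num⟩
  let v : ContDiffBump (2 : ℝ) := ⟨1 / 2, 1, by norm_num, by norm_num⟩
  have hv : ∀ s, s ∈ tsupport v → 0 < s := fun s hs => by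
    rw [v.tsupport_eq] at hs
    have := abs_le.1 (by simpa [Real.dist_eq] using hs : |s - 2| ≤ 1)
    linarith
  refine ⟨fun s => s * w s, v, contDiff_id.mul w.contDiff, v.contDiff, w.hasCompactSupport.mul_left,
    v.hasCompactSupport, fun s hs => ⟨hv s hs, ?_⟩, fun m => ?_⟩
  · rw [v.tsupport_eq] at hs
    have hs' : s ∈ ball (2 : ℝ) (3 / 2) := lt_of_le_of_lt (mem_closedBall.1 hs) (by norm_num [v])
    have heq : (fun s => s * w s) =ᶠ[nhds s] id := by
      filter_upwards [isOpen_ball.mem_nhds hs'] with t ht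
      simp [w.one_of_mem_closedBall (ball_subset_closedBall ht)]
    exact ⟨heq.eq_of_nhds, by rw [heq.deriv_eq, deriv_id]⟩
  · refine Continuous.integral_pos_of_hasCompactSupport_nonneg_nonzero (x := 2)
      ((continuous_pow m).mul v.continuous) v.hasCompactSupport.mul_left (fun s => ?_) ?_
    · by_cases hs : s ∈ tsupport v
      · have := hv s hs
        have := v.nonneg (x := s)
        simp only [Pi.zero_apply]
        positivity
      · simp [image_eq_zero_of_notMem_tsupport hs]
    · have : v 2 = 1 := v.one_of_mem_closedBall (mem_closedBall_self v.rIn_pos.le)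
      simp [this]

lemma integral_pow_mul_deriv {v : ℝ → ℝ} (hv : ContDiff ℝ 1 v) (hc : HasCompactSupport v) (m : ℕ) :
    ∫ s, s ^ (m + 1) * deriv v s = -((m + 1 : ℝ) * ∫ s, s ^ m * v s) := by
  have h := integral_mul_deriv_eq_deriv_mul_of_integrable (u := fun s : ℝ => s ^ (m + 1)) (v := v)
    (u' := fun s => (m + 1 : ℝ) * s ^ m) (v' := deriv v)
    (fun s _ => by simpa using hasDerivAt_pow (m + 1) s)
    (fun s _ => ((hv.differentiable (by simp)) s).hasDerivAt)
    (((continuous_pow _).mul (hv.continuous_deriv (by simp))).integrable_of_hasCompactSupport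
      (hc.deriv).mul_left)
    (((continuous_const.mul (continuous_pow _)).mul hv.continuous).integrable_of_hasCompactSupport
      hc.mul_left)
    (((continuous_pow _).mul hv.continuous).integrable_of_hasCompactSupport hc.mul_left)
  rw [h, ← integral_const_mul]
  simp_rw [mul_assoc]

variable [FiniteDimensional ℝ V]

/-- Both arguments factor through id × s, of determinant s^(m+1). In the term with `N` the
factorization costs a division by s, which leaves s^m. -/
lemma detDeriv_cone (e : F ≃L[ℝ] ℝ × V) (z a : F) (L N : V →L[ℝ] F) (m : ℕ)
    (hm : Module.finrank ℝ V = m + 1) {s v v' : ℝ} (hs : s ≠ 0) :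
    detDeriv ((e : F →L[ℝ] ℝ × V) ∘L col z (s • L)) ((e : F →L[ℝ] ℝ × V) ∘L col (v' • a) (v • N))
      = s ^ (m + 1) * v' * detDeriv ((e : F →L[ℝ] ℝ × V) ∘L col z L)
          ((e : F →L[ℝ] ℝ × V) ∘L col a 0)
        + s ^ m * v * detDeriv ((e : F →L[ℝ] ℝ × V) ∘L col z L)
          ((e : F →L[ℝ] ℝ × V) ∘L col 0 N) := by
  let G : ℝ × V →L[ℝ] ℝ × V :=
    (ContinuousLinearMap.id ℝ ℝ).prodMap (s • ContinuousLinearMap.id ℝ V)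
  have hG : G.det = s ^ (m + 1) := by
    have : G.toLinearMap = LinearMap.prodMap LinearMap.id (s • LinearMap.id) := rfl
    rw [ContinuousLinearMap.det, this, LinearMap.det_prodMap, LinearMap.det_id, one_mul,
      LinearMap.det_smul, hm, LinearMap.det_id, mul_one]
  have h1 : (e : F →L[ℝ] ℝ × V) ∘L col z (s • L) = ((e : F →L[ℝ] ℝ × V) ∘L col z L) ∘L G := by
    ext x <;> simp [G]
  have h2 : (e : F →L[ℝ] ℝ × V) ∘L col (v' • a) (v • N)
      = (v' • ((e : F →L[ℝ] ℝ × V) ∘L col a (0 : V →L[ℝ] F))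
        + (v / s) • ((e : F →L[ℝ] ℝ × V) ∘L col 0 N)) ∘L G := by
    ext x <;> simp [G, smul_smul, div_mul_cancel₀ _ hs]
  rw [h1, h2, detDeriv_comp_right, hG, map_add, map_smul, map_smul]
  simp only [smul_eq_mul]
  field_simp
  ring

variable [MeasurableSpace V] [BorelSpace V]

/-- Stokes' formula for the form `det (A, Z, dZ, …, dZ)` on a half-space, where the boundary
hyperplane is mapped to a hyperplane by `A` and by `Z`. It is obtained from the cone map
`(s, y) ↦ s Z(y)` and the fact that the determinant is a null Lagrangian. -/
theorem integral_detDeriv_halfSpace (μ : Measure V) [μ.IsAddHaarMeasure] {ℓ : V →L[ℝ] ℝ} {v₀ : V}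
    (hv₀ : ℓ v₀ = 1) (e : F ≃L[ℝ] ℝ × V) {Z A : V → F} (hZ : ContDiff ℝ 1 Z)
    (hA : ContDiff ℝ 1 A) (hZc : HasCompactSupport Z) (hAc : HasCompactSupport A)
    (hZb : ∀ y, ℓ y = 0 → ℓ (e (Z y)).2 = 0) (hAb : ∀ y, ℓ y = 0 → ℓ (e (A y)).2 = 0) :
    ∫ y in {y | 0 < ℓ y},
      (detDeriv ((e : F →L[ℝ] ℝ × V) ∘L col (Z y) (fderiv ℝ Z y))
          ((e : F →L[ℝ] ℝ × V) ∘L col 0 (fderiv ℝ A y))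
        - Module.finrank ℝ V * detDeriv ((e : F →L[ℝ] ℝ × V) ∘L col (Z y) (fderiv ℝ Z y))
          ((e : F →L[ℝ] ℝ × V) ∘L col (A y) 0)) ∂μ = 0 := by
  have : Nontrivial V := ⟨⟨v₀, 0, fun h => by simp [h] at hv₀⟩⟩
  obtain ⟨m, hm⟩ : ∃ m, Module.finrank ℝ V = m + 1 :=
    Nat.exists_eq_succ_of_ne_zero Module.finrank_pos.ne'
  obtain ⟨u, v, hu, hv, huc, hvc, huv, hint⟩ := exists_cone_profiles
  let f : F →L[ℝ] ℝ × V := (e : F →L[ℝ] ℝ × V)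
  -- This is the cone over `Z`, cut off in the radial variable and perturbed in the direction of
  -- `A`. It preserves the hyperplane for every τ, so the null Lagrangian identity holds identically
  -- in τ.
  let W : ℝ → ℝ × V → ℝ × V := fun τ p => f (u p.1 • Z p.2 + τ • v p.1 • A p.2)
  let M : ℝ × V → ℝ × V →L[ℝ] ℝ × V := fun p =>
    f ∘L col (deriv u p.1 • Z p.2) (u p.1 • fderiv ℝ Z p.2)
  let N : ℝ × V → ℝ × V →L[ℝ] ℝ × V := fun p =>
    f ∘L col (deriv v p.1 • A p.2) (v p.1 • fderiv ℝ A p.2)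
  have hWd : ∀ τ p, HasFDerivAt (W τ) (M p + τ • N p) p := by
    intro τ p
    have hu' : HasFDerivAt (fun p : ℝ × V => u p.1) (deriv u p.1 • ContinuousLinearMap.fst ℝ ℝ V) p :=
      ((hu.differentiable (by simp)) p.1).hasDerivAt.comp_hasFDerivAt p hasFDerivAt_fst
    have hv' : HasFDerivAt (fun p : ℝ × V => v p.1) (deriv v p.1 • ContinuousLinearMap.fst ℝ ℝ V) p :=
      ((hv.differentiable (by simp)) p.1).hasDerivAt.comp_hasFDerivAt p hasFDerivAt_fst
    have hZ' : HasFDerivAt (fun p : ℝ × V => Z p.2) (fderiv ℝ Z p.2 ∘L ContinuousLinearMap.snd ℝ ℝ V) p :=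
      ((hZ.differentiable (by simp)) p.2).hasFDerivAt.comp p hasFDerivAt_snd
    have hA' : HasFDerivAt (fun p : ℝ × V => A p.2) (fderiv ℝ A p.2 ∘L ContinuousLinearMap.snd ℝ ℝ V) p :=
      ((hA.differentiable (by simp)) p.2).hasFDerivAt.comp p hasFDerivAt_snd
    refine (f.hasFDerivAt.comp p ((hu'.smul hZ').add ((hv'.smul hA').const_smul τ))).congr_fderiv ?_
    ext x <;> simp [M, N, f]
  have hWs : ∀ τ, ContDiff ℝ 1 (W τ) := fun τ => f.contDiff.comp
    (((hu.comp contDiff_fst).smul (hZ.comp contDiff_snd)).add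
      (((hv.comp contDiff_fst).smul (hA.comp contDiff_snd)).const_smul τ))
  have hWc : ∀ τ, HasCompactSupport (W τ) := by
    intro τ
    refine HasCompactSupport.intro ((huc.isCompact.union hvc.isCompact).prod
      (hZc.isCompact.union hAc.isCompact)) fun p hp => ?_
    simp only [mem_prod, mem_union, not_and_or, not_or] at hp
    rcases hp with ⟨h1, h2⟩ | ⟨h1, h2⟩ <;>
    simp [W, image_eq_zero_of_notMem_tsupport h1, image_eq_zero_of_notMem_tsupport h2]
  have hfr : 0 < Module.finrank ℝ (ℝ × V) := Module.finrank_pos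
  set H : Set (ℝ × V) := {p | 0 < (ℓ ∘L ContinuousLinearMap.snd ℝ ℝ V) p} with hH
  have hmaster : ∀ τ : ℝ, ∫ p in H, (M p + τ • N p).det ∂((volume : Measure ℝ).prod μ) = 0 := by
    intro τ
    have h := integral_det_fderiv_halfSpace ((volume : Measure ℝ).prod μ) hfr
      (ℓ := ℓ ∘L ContinuousLinearMap.snd ℝ ℝ V) (v := (0, v₀)) (by simpa using hv₀) (hWs τ) (hWc τ)
      (fun p hp => by
        have hp' : ℓ p.2 = 0 := hp
        simp [W, f, hZb _ hp', hAb _ hp'])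
    simpa only [(hWd τ _).fderiv] using h
  have hI : ∀ τ : ℝ, Integrable (fun p => (M p + τ • N p).det) ((volume : Measure ℝ).prod μ) := by
    intro τ
    have h1 : (fun p => (M p + τ • N p).det) = fun p => (fderiv ℝ (W τ) p).det := by
      ext p; rw [(hWd τ p).fderiv]
    rw [h1]
    exact ((contDiff_det (m := 0)).continuous.comp
      ((hWs τ).continuous_fderiv (by simp))).integrable_of_hasCompactSupport
      (((hWc τ).fderiv ℝ).comp_left (g := fun M : ℝ × V →L[ℝ] ℝ × V => M.det)
        (by simp [ContinuousLinearMap.det]))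
  have key := integral_coeff_eq_zero_of_eval (μ := ((volume : Measure ℝ).prod μ).restrict H)
    (p := fun p => detLine (M p) (N p)) (d := Module.finrank ℝ (ℝ × V)) (T := univ)
    (fun p => natDegree_detLine_le _ _) infinite_univ
    (fun τ _ => by simp_rw [eval_detLine]; exact (hI τ).integrableOn)
    (fun τ _ => by simp_rw [eval_detLine]; exact hmaster τ) 1
  let α : V → ℝ := fun y => detDeriv (f ∘L col (Z y) (fderiv ℝ Z y)) (f ∘L col (A y) 0)
  let β : V → ℝ := fun y => detDeriv (f ∘L col (Z y) (fderiv ℝ Z y)) (f ∘L col 0 (fderiv ℝ A y))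
  have hMc : Continuous fun y => f ∘L col (Z y) (fderiv ℝ Z y) :=
    continuous_const.clm_comp (continuous_col.comp
      (hZ.continuous.prodMk (hZ.continuous_fderiv (by simp))))
  have hαc : Continuous α := continuous_detDeriv.comp (hMc.prodMk (continuous_const.clm_comp
    (continuous_col.comp (hA.continuous.prodMk continuous_const))))
  have hβc : Continuous β := continuous_detDeriv.comp (hMc.prodMk (continuous_const.clm_comp
    (continuous_col.comp (continuous_const.prodMk (hA.continuous_fderiv (by simp))))))
  have h00 : (f ∘L col (0 : F) (0 : V →L[ℝ] F)) = 0 := by ext x <;> simp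
  have hαi : Integrable α μ := hαc.integrable_of_hasCompactSupport
    (HasCompactSupport.intro hAc.isCompact fun y hy => by
      simp [α, image_eq_zero_of_notMem_tsupport hy, h00])
  have hβi : Integrable β μ := hβc.integrable_of_hasCompactSupport
    (HasCompactSupport.intro (hAc.fderiv ℝ).isCompact fun y hy => by
      simp [β, image_eq_zero_of_notMem_tsupport hy, h00])
  have hpt : ∀ p, (detLine (M p) (N p)).coeff 1
      = p.1 ^ (m + 1) * deriv v p.1 * α p.2 + p.1 ^ m * v p.1 * β p.2 := by
    intro p
    rw [coeff_one_detLine]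
    by_cases hp : p.1 ∈ tsupport v
    · obtain ⟨h0, h1, h2⟩ := huv _ hp
      have := detDeriv_cone e (Z p.2) (A p.2) (fderiv ℝ Z p.2) (fderiv ℝ A p.2) m hm
        (v := v p.1) (v' := deriv v p.1) h0.ne'
      simp only [M, N, h1, h2, one_smul]
      exact this
    · have h1 : v p.1 = 0 := image_eq_zero_of_notMem_tsupport hp
      have h2 : deriv v p.1 = 0 :=
        image_eq_zero_of_notMem_tsupport fun h => hp (tsupport_deriv_subset h)
      simp [N, h1, h2, h00]
  simp_rw [hpt] at key
  have hf1 : Integrable fun s : ℝ => s ^ (m + 1) * deriv v s :=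
    ((continuous_pow _).mul (hv.continuous_deriv (by simp))).integrable_of_hasCompactSupport
      hvc.deriv.mul_left
  have hf2 : Integrable fun s : ℝ => s ^ m * v s :=
    ((continuous_pow _).mul hv.continuous).integrable_of_hasCompactSupport hvc.mul_left
  have hHp : H = univ ×ˢ {y | 0 < ℓ y} := by ext p; simp [hH]
  rw [integral_add (hf1.mul_prod hαi).integrableOn (hf2.mul_prod hβi).integrableOn, hHp,
    setIntegral_prod_mul (fun s : ℝ => s ^ (m + 1) * deriv v s) α,
    setIntegral_prod_mul (fun s : ℝ => s ^ m * v s) β, setIntegral_univ, setIntegral_univ,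
    integral_pow_mul_deriv hv hvc] at key
  -- Integration by parts in the radial variable makes both terms multiples of the same positive
  -- integral, which can be cancelled.
  have hfin : (∫ s, s ^ m * v s) *
      ((∫ y in {y | 0 < ℓ y}, β y ∂μ) - (m + 1) * ∫ y in {y | 0 < ℓ y}, α y ∂μ) = 0 := by
    refine Eq.trans ?_ key; ring
  have hfin' := (mul_eq_zero.1 hfin).resolve_left (hint m).ne'
  rw [hm]
  push_cast
  refine Eq.trans ?_ hfin'
  rw [← integral_const_mul, ← integral_sub hβi.integrableOn (hαi.integrableOn.const_mul _)]

end Cone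

/-! ### The area formula for embedded `C¹` parametrizations -/

section LocalComparison

open MeasureTheory Set Filter Topology
open scoped ENNReal NNReal

/-- Countably many of the neighbourhoods cover; making them disjoint reduces the claim to countable
additivity. -/
lemma measure_le_of_locally_le {X : Type*} [TopologicalSpace X] [SecondCountableTopology X]
    [MeasurableSpace X] [OpensMeasurableSpace X] {m₁ m₂ : Measure X}
    (h : ∀ x, ∃ U ∈ 𝓝 x, ∀ t ⊆ U, MeasurableSet t → m₁ t ≤ m₂ t) : m₁ ≤ m₂ := by
  choose U hU hle using h
  obtain ⟨s, hs, hcov⟩ := TopologicalSpace.countable_cover_nhds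
    (fun x => interior_mem_nhds.2 (hU x))
  rcases isEmpty_or_nonempty X with hX | hX
  · exact Measure.le_iff.2 fun t _ => by simp [Set.eq_empty_of_isEmpty t]
  have hne : s.Nonempty := by
    rcases s.eq_empty_or_nonempty with rfl | hne
    · simp at hcov
      exact absurd hcov.symm (by simp)
    · exact hne
  obtain ⟨f, rfl⟩ := hs.exists_eq_range hne
  let O : ℕ → Set X := fun i => interior (U (f i))
  have hO : ⋃ i, O i = univ := by simpa [O] using hcov
  have hOm : ∀ i, MeasurableSet (disjointed O i) :=
    MeasurableSet.disjointed fun i => isOpen_interior.measurableSet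
  refine Measure.le_iff.2 fun t ht => ?_
  have hsplit : t = ⋃ i, t ∩ disjointed O i := by
    rw [← inter_iUnion, iUnion_disjointed, hO, inter_univ]
  have hdisj : Pairwise (Function.onFun Disjoint fun i => t ∩ disjointed O i) := fun i j hij =>
    (disjoint_disjointed O hij).mono inter_subset_right inter_subset_right
  rw [hsplit, measure_iUnion hdisj fun i => ht.inter (hOm i),
    measure_iUnion hdisj fun i => ht.inter (hOm i)]
  refine ENNReal.tsum_le_tsum fun i => hle (f i) _ ?_ (ht.inter (hOm i))
  exact inter_subset_right.trans ((disjointed_subset O i).trans interior_subset)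

lemma measure_le_of_forall_one_lt {X : Type*} [MeasurableSpace X] {m₁ m₂ : Measure X} (k : ℕ)
    (h : ∀ θ : ℝ≥0, 1 < θ → m₁ ≤ ((θ : ℝ≥0∞) ^ k) • m₂) : m₁ ≤ m₂ := by
  refine Measure.le_iff.2 fun t _ => ?_
  have hlim : Tendsto (fun θ : ℝ≥0 => ((θ ^ k : ℝ≥0) : ℝ≥0∞) * m₂ t) (𝓝[>] 1)
      (𝓝 (((1 ^ k : ℝ≥0) : ℝ≥0∞) * m₂ t)) := by
    refine ENNReal.Tendsto.mul_const ?_ (Or.inl (by simp))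
    exact ENNReal.tendsto_coe.2 (((continuous_pow k).tendsto 1).mono_left nhdsWithin_le_nhds)
  rw [one_pow, ENNReal.coe_one, one_mul] at hlim
  refine ge_of_tendsto hlim ?_
  filter_upwards [self_mem_nhdsWithin] with θ hθ
  simpa using Measure.le_iff'.1 (h θ hθ) t

/-- The distance bound makes φ constant on the fibres of ψ within `t`, so φ ∘ ψ⁻¹ is well defined
and C-Lipschitz on the image of ψ. -/
lemma euclideanHausdorffMeasure_image_le_of_dist_le {X Y Z : Type*} [MetricSpace Y]
    [MeasurableSpace Y] [BorelSpace Y] [MetricSpace Z] [MeasurableSpace Z] [BorelSpace Z]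
    {φ : X → Y} {ψ : X → Z} {t : Set X} {C : ℝ≥0}
    (h : ∀ a ∈ t, ∀ b ∈ t, dist (φ a) (φ b) ≤ C * dist (ψ a) (ψ b)) (d : ℕ) :
    μHE[d] (φ '' t) ≤ (C : ℝ≥0∞) ^ d * μHE[d] (ψ '' t) := by
  rcases t.eq_empty_or_nonempty with rfl | ⟨x, hx⟩
  · simp
  have : Nonempty X := ⟨x⟩
  let g : Z → Y := fun z => φ (Function.invFunOn ψ t z)
  have hg : LipschitzOnWith C g (ψ '' t) := by
    refine LipschitzOnWith.of_dist_le_mul fun z hz w hw => ?_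
    have := h _ (Function.invFunOn_mem hz) _ (Function.invFunOn_mem hw)
    rwa [Function.invFunOn_eq hz, Function.invFunOn_eq hw] at this
  have himg : φ '' t ⊆ g '' (ψ '' t) := by
    rintro _ ⟨a, ha, rfl⟩
    have hz : ∃ b ∈ t, ψ b = ψ a := ⟨a, ha, rfl⟩
    refine ⟨ψ a, ⟨a, ha, rfl⟩, ?_⟩
    have := h _ (Function.invFunOn_mem hz) _ ha
    rw [Function.invFunOn_eq hz, dist_self, mul_zero] at this
    exact dist_le_zero.1 this
  have h1 := hg.hausdorffMeasure_image_le (d := d) (Nat.cast_nonneg d)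
  rw [ENNReal.rpow_natCast] at h1
  simp only [Measure.euclideanHausdorffMeasure_def, Measure.smul_apply, ENNReal.smul_def,
    smul_eq_mul]
  rw [mul_left_comm]
  gcongr
  exact (measure_mono himg).trans h1

end LocalComparison

/-! ### Comparison of a parametrization with its derivative, and the area density -/

section AreaFormula

open MeasureTheory Set Filter Topology
open scoped ENNReal NNReal

variable {V F : Type*} [NormedAddCommGroup V] [InnerProductSpace ℝ V] [FiniteDimensional ℝ V]
  [NormedAddCommGroup F] [InnerProductSpace ℝ F]

lemma exists_nhds_dist_le_of_hasStrictFDerivAt {φ : V → F} {L : V →L[ℝ] F} {y₀ : V}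
    (hφ : HasStrictFDerivAt φ L y₀) (hL : Function.Injective L) {θ : ℝ≥0} (hθ : 1 < θ) :
    ∃ O ∈ 𝓝 y₀, ∀ a ∈ O, ∀ b ∈ O, dist (φ a) (φ b) ≤ θ * dist (L a) (L b) ∧
      dist (L a) (L b) ≤ θ * dist (φ a) (φ b) := by
  obtain ⟨K, hK, hanti⟩ := L.toLinearMap.exists_antilipschitzWith (LinearMap.ker_eq_bot.2 hL)
  have hθ' : (1 : ℝ) < θ := by exact_mod_cast hθ
  have hK' : (0 : ℝ) < K := by exact_mod_cast hK
  -- This makes 1 - cK equal to 1/θ, and then 1 + cK = 2 - 1/θ ≤ θ; these are the factors in the two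
  -- inequalities.
  let c : ℝ≥0 := ⟨(θ - 1) / (θ * K), by have := sub_pos.2 hθ'; positivity⟩
  have hc : 0 < c := by
    have := sub_pos.2 hθ'
    exact NNReal.coe_pos.1 (show (0 : ℝ) < (θ - 1) / (θ * K) by positivity)
  have hcK : (c : ℝ) * K * θ = θ - 1 := by
    change ((θ : ℝ) - 1) / (θ * K) * K * θ = θ - 1
    have : (θ : ℝ) ≠ 0 := by linarith
    field_simp
  obtain ⟨O, hO, happ⟩ := hφ.approximates_deriv_on_nhds (Or.inr hc)
  refine ⟨O, hO, fun a ha b hb => ?_⟩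
  have h1 : ‖φ a - φ b - L (a - b)‖ ≤ c * ‖a - b‖ := happ a ha b hb
  have h2 : ‖a - b‖ ≤ K * ‖L (a - b)‖ := by
    have := hanti.le_mul_dist a b
    rw [dist_eq_norm, dist_eq_norm] at this
    simpa using this
  have h3 : ‖φ a - φ b - L (a - b)‖ ≤ c * K * ‖L (a - b)‖ := by
    refine h1.trans ?_
    rw [mul_assoc]
    gcongr
  have h4 : ‖φ a - φ b‖ ≤ ‖φ a - φ b - L (a - b)‖ + ‖L (a - b)‖ := by
    simpa using norm_add_le (φ a - φ b - L (a - b)) (L (a - b))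
  have h5 : ‖L (a - b)‖ ≤ ‖φ a - φ b - L (a - b)‖ + ‖φ a - φ b‖ := by
    have := norm_sub_le (φ a - φ b) (φ a - φ b - L (a - b))
    rw [sub_sub_cancel] at this
    linarith
  rw [dist_eq_norm, dist_eq_norm, ← map_sub]
  have hL0 := norm_nonneg (L (a - b))
  have hcK0 : 0 ≤ (c : ℝ) * K := by positivity
  constructor
  · nlinarith
  · nlinarith

/-- An injective `C¹` parametrization `φ` by a measurable set `D`, with injective derivative `φ'`. -/
structure IsParametrization [MeasurableSpace V] (φ : V → F) (φ' : V → V →L[ℝ] F) (D : Set V) :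
    Prop where
  measurableSet : MeasurableSet D
  hasStrictFDerivAt : ∀ y ∈ D, HasStrictFDerivAt φ (φ' y) y
  injective : ∀ y ∈ D, Function.Injective (φ' y)
  injOn : InjOn φ D
  continuousOn_normDet : ContinuousOn (fun y => (φ' y).toLinearMap.normDet) D

variable [MeasurableSpace V] [BorelSpace V] [MeasurableSpace F] [BorelSpace F]
  {φ : V → F} {φ' : V → V →L[ℝ] F} {D : Set V}

/-- Of the d + 1 factors θ, d come from comparing φ with its derivative at `y₀` in Hausdorff
measure, and one from the continuity of the density. -/
lemma exists_nhds_measure_image_comparison {d : ℕ} (hd : Module.finrank ℝ V = d)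
    (h : IsParametrization φ φ' D)
    {y₀ : V} (hy₀ : y₀ ∈ D) {θ : ℝ≥0} (hθ : 1 < θ) :
    ∃ O ∈ 𝓝[D] y₀, ∀ t ⊆ O, t ⊆ D → MeasurableSet t →
      μHE[d] (φ '' t) ≤ (θ : ℝ≥0∞) ^ (d + 1) *
        ∫⁻ y in t, ENNReal.ofReal (φ' y).toLinearMap.normDet ∧
      ∫⁻ y in t, ENNReal.ofReal (φ' y).toLinearMap.normDet ≤
        (θ : ℝ≥0∞) ^ (d + 1) * μHE[d] (φ '' t) := by
  set N₀ := (φ' y₀).toLinearMap.normDet with hN₀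
  have hN₀pos : 0 < N₀ := lt_of_le_of_ne (LinearMap.normDet_nonneg _) fun h0 => by
    exact LinearMap.normDet_eq_zero_iff_ker_ne_bot.1 h0.symm (LinearMap.ker_eq_bot.2 (h.injective _ hy₀))
  have hθ' : (1 : ℝ) < θ := by exact_mod_cast hθ
  obtain ⟨O₁, hO₁, h₁⟩ := exists_nhds_dist_le_of_hasStrictFDerivAt (h.hasStrictFDerivAt _ hy₀) (h.injective _ hy₀) hθ
  have hO₂ : {y | (φ' y).toLinearMap.normDet < θ * N₀ ∧ N₀ < θ * (φ' y).toLinearMap.normDet}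
      ∈ 𝓝[D] y₀ := by
    have hJ := h.continuousOn_normDet y₀ hy₀
    refine (hJ.eventually (gt_mem_nhds (by nlinarith : N₀ < θ * N₀))).and ?_
    exact (hJ.const_mul (θ : ℝ)).eventually (lt_mem_nhds (by simp only [← hN₀]; nlinarith))
  refine ⟨_, inter_mem (mem_nhdsWithin_of_mem_nhds hO₁) hO₂, fun t htO htD htm => ?_⟩
  have hlin : μHE[d] (φ' y₀ '' t) = ENNReal.ofReal N₀ * volume t := by
    subst hd
    rw [← InnerProductSpace.euclideanHausdorffMeasure_eq_volume]
    exact LinearMap.euclideanHausdorffMeasure_image (φ' y₀).toLinearMap t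
  have hA := euclideanHausdorffMeasure_image_le_of_dist_le
    (fun a ha b hb => (h₁ a (htO ha).1 b (htO hb).1).1) d
  have hB := euclideanHausdorffMeasure_image_le_of_dist_le
    (fun a ha b hb => (h₁ a (htO ha).1 b (htO hb).1).2) d
  rw [hlin] at hA hB
  have hθE : ENNReal.ofReal (θ : ℝ) = (θ : ℝ≥0∞) := ENNReal.ofReal_coe_nnreal
  have hconst : ENNReal.ofReal N₀ * volume t = ∫⁻ _ in t, ENNReal.ofReal N₀ := by simp
  constructor
  · refine hA.trans ?_
    rw [hconst, pow_succ, mul_assoc]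
    gcongr
    rw [← lintegral_const_mul' _ _ ENNReal.coe_ne_top]
    refine setLIntegral_mono' htm fun y hy => ?_
    rw [← hθE, ← ENNReal.ofReal_mul (by positivity)]
    exact ENNReal.ofReal_le_ofReal (htO hy).2.2.le
  · calc ∫⁻ y in t, ENNReal.ofReal (φ' y).toLinearMap.normDet
        ≤ ∫⁻ _ in t, (θ : ℝ≥0∞) * ENNReal.ofReal N₀ := by
          refine setLIntegral_mono' htm fun y hy => ?_
          rw [← hθE, ← ENNReal.ofReal_mul (by positivity)]
          exact ENNReal.ofReal_le_ofReal (htO hy).2.1.le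
      _ = θ * (ENNReal.ofReal N₀ * volume t) := by simp [mul_assoc]
      _ ≤ θ * ((θ : ℝ≥0∞) ^ d * μHE[d] (φ '' t)) := by gcongr
      _ = _ := by rw [pow_succ]; ring

lemma IsParametrization.measurableEmbedding (h : IsParametrization φ φ' D) :
    MeasurableEmbedding (D.domRestrict φ) :=
  ContinuousOn.measurableEmbedding h.measurableSet
    (fun y hy => (h.hasStrictFDerivAt y hy).continuousAt.continuousWithinAt) h.injOn

/-- The area formula: the surface measure of an embedded `C¹` parametrized piece. -/
theorem comap_euclideanHausdorffMeasure_eq_withDensity {d : ℕ} (hd : Module.finrank ℝ V = d)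
    (hp : IsParametrization φ φ' D) :
    Measure.comap (D.domRestrict φ) μHE[d] = Measure.comap ((↑) : D → V)
      (volume.withDensity fun y => ENNReal.ofReal (φ' y).toLinearMap.normDet) := by
  have hemb := hp.measurableEmbedding
  have hsub : MeasurableEmbedding ((↑) : D → V) := MeasurableEmbedding.subtype_coe hp.measurableSet
  have himg : ∀ t : Set D, D.domRestrict φ '' t = φ '' ((↑) '' t) := fun t => by
    rw [image_image]; rfl
  have h₂ : ∀ t : Set D, MeasurableSet t → Measure.comap ((↑) : D → V)
      (volume.withDensity fun y => ENNReal.ofReal (φ' y).toLinearMap.normDet) t =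
      ∫⁻ y in ((↑) '' t : Set V), ENNReal.ofReal (φ' y).toLinearMap.normDet := fun t ht => by
    rw [hsub.comap_apply, withDensity_apply _ (hsub.measurableSet_image.2 ht)]
  have hloc : ∀ (θ : ℝ≥0), 1 < θ → ∀ x : D, ∃ U ∈ 𝓝 x, ∀ t ⊆ U, MeasurableSet t →
      μHE[d] (φ '' ((↑) '' t)) ≤ (θ : ℝ≥0∞) ^ (d + 1) *
        ∫⁻ y in ((↑) '' t : Set V), ENNReal.ofReal (φ' y).toLinearMap.normDet ∧
      ∫⁻ y in ((↑) '' t : Set V), ENNReal.ofReal (φ' y).toLinearMap.normDet ≤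
        (θ : ℝ≥0∞) ^ (d + 1) * μHE[d] (φ '' ((↑) '' t)) := by
    intro θ hθ x
    obtain ⟨O, hO, h⟩ := exists_nhds_measure_image_comparison hd hp x.2 hθ
    refine ⟨(↑) ⁻¹' O, by
      rwa [← preimage_coe_mem_nhds_subtype] at hO, fun t ht htm => ?_⟩
    exact h _ (image_subset_iff.2 ht) (by simp) (hsub.measurableSet_image.2 htm)
  refine le_antisymm ?_ ?_
  · refine measure_le_of_forall_one_lt (d + 1) fun θ hθ => measure_le_of_locally_le fun x => ?_
    obtain ⟨U, hU, h⟩ := hloc θ hθ x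
    refine ⟨U, hU, fun t ht htm => ?_⟩
    rw [hemb.comap_apply, himg, Measure.smul_apply, h₂ t htm]
    exact (h t ht htm).1
  · refine measure_le_of_forall_one_lt (d + 1) fun θ hθ => measure_le_of_locally_le fun x => ?_
    obtain ⟨U, hU, h⟩ := hloc θ hθ x
    refine ⟨U, hU, fun t ht htm => ?_⟩
    rw [Measure.smul_apply, hemb.comap_apply, himg, h₂ t htm]
    exact (h t ht htm).2

lemma restrict_image_eq_map {d : ℕ} (hd : Module.finrank ℝ V = d)
    (hp : IsParametrization φ φ' D) :
    (μHE[d] : Measure F).restrict (φ '' D) = Measure.map (D.domRestrict φ)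
      (Measure.comap ((↑) : D → V)
      (volume.withDensity fun y => ENNReal.ofReal (φ' y).toLinearMap.normDet)) := by
  have hemb := hp.measurableEmbedding
  rw [← comap_euclideanHausdorffMeasure_eq_withDensity hd hp, hemb.map_comap,
    range_domRestrict]

theorem integrableOn_image_iff_normDet {d : ℕ} (hd : Module.finrank ℝ V = d)
    (hp : IsParametrization φ φ' D) (g : F → ℝ) :
    IntegrableOn g (φ '' D) μHE[d] ↔
      IntegrableOn (fun y => (φ' y).toLinearMap.normDet * g (φ y)) D := by
  have hemb := hp.measurableEmbedding
  rw [IntegrableOn, restrict_image_eq_map hd hp, hemb.integrable_map_iff]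
  simp only [Set.domRestrict_eq, ← Function.comp_assoc, ENNReal.ofReal]
  rw [← (MeasurableEmbedding.subtype_coe hp.measurableSet).integrable_map_iff, map_comap_subtype_coe hp.measurableSet,
    restrict_withDensity hp.measurableSet, integrable_withDensity_iff_integrable_coe_smul₀]
  · simp_rw [IntegrableOn, Real.coe_toNNReal _ (LinearMap.normDet_nonneg _), Function.comp_apply,
      smul_eq_mul]
  · exact (hp.continuousOn_normDet.aemeasurable hp.measurableSet).real_toNNReal

theorem integral_image_eq_integral_normDet {d : ℕ} (hd : Module.finrank ℝ V = d)
    (hp : IsParametrization φ φ' D) (g : F → ℝ) :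
    ∫ x in φ '' D, g x ∂μHE[d] = ∫ y in D, (φ' y).toLinearMap.normDet * g (φ y) := by
  have hemb := hp.measurableEmbedding
  rw [restrict_image_eq_map hd hp, hemb.integral_map]
  simp only [Set.domRestrict_apply, ← Function.comp_apply (f := g), ENNReal.ofReal]
  rw [← (MeasurableEmbedding.subtype_coe hp.measurableSet).integral_map, map_comap_subtype_coe hp.measurableSet,
    setIntegral_withDensity_eq_setIntegral_smul₀ (hp.continuousOn_normDet.aemeasurable hp.measurableSet).real_toNNReal _ hp.measurableSet]
  refine integral_congr_ae (Eventually.of_forall fun y => ?_)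
  simp only [NNReal.smul_def, Real.coe_toNNReal _ (LinearMap.normDet_nonneg _), smul_eq_mul,
    Function.comp_apply]

end AreaFormula

/-! ### The area density as the determinant of the frame (ν, ∂φ) -/

section ColDet

variable {n : ℕ}

/-- The splitting of the first coordinate. -/
def splitFirst (n : ℕ) : Space n ≃L[ℝ] ℝ × EuclideanSpace ℝ (Fin n) :=
  LinearEquiv.toContinuousLinearEquiv
    { toFun := fun x => (x 0, WithLp.toLp 2 fun i => x i.succ)
      invFun := fun p => WithLp.toLp 2 (Fin.cons p.1 fun i => p.2 i)
      map_add' := fun x y => by ext <;> simp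
      map_smul' := fun c x => by ext <;> simp
      left_inv := fun x => by
        ext i
        refine Fin.cases ?_ (fun i => ?_) i <;> simp
      right_inv := fun p => by ext <;> simp }

lemma splitFirst_apply (x : Space n) :
    splitFirst n x = (x 0, WithLp.toLp 2 fun i => x i.succ) := rfl

/-- The Gram matrix of (ν, L e₁, …, L e_n) is block diagonal with blocks 1 and the Gram matrix of
`L`, so the two squared densities agree. -/
lemma abs_det_col_splitFirst {ν : Space n} {L : EuclideanSpace ℝ (Fin n) →L[ℝ] Space n}
    (hν : ‖ν‖ = 1) (h : ∀ u, ⟪ν, L u⟫ = 0) :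
    |(col ν L ∘L (splitFirst n : Space n →L[ℝ] ℝ × EuclideanSpace ℝ (Fin n))).det|
      = L.toLinearMap.normDet := by
  set K := col ν L ∘L (splitFirst n : Space n →L[ℝ] ℝ × EuclideanSpace ℝ (Fin n)) with hK
  have h0 : K (EuclideanSpace.basisFun (Fin (n + 1)) ℝ 0) = ν := by
    have : (WithLp.toLp 2 fun i : Fin n => (0 : ℝ)) = 0 := rfl
    simp [hK, splitFirst_apply, this]
  have hs : ∀ i : Fin n, K (EuclideanSpace.basisFun (Fin (n + 1)) ℝ i.succ)
      = L (EuclideanSpace.basisFun (Fin n) ℝ i) := by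
    intro i
    simp only [hK, ContinuousLinearMap.comp_apply, ContinuousLinearEquiv.coe_coe, splitFirst_apply,
      col_apply, EuclideanSpace.basisFun_apply]
    rw [PiLp.single_apply, if_neg (Fin.succ_ne_zero i).symm, zero_smul, zero_add]
    congr 1
    ext j
    simp
  have hdet : K.toLinearMap.normDet ^ 2 = L.toLinearMap.normDet ^ 2 := by
    have h1 := LinearMap.normDet_sq_eq_det_gram K.toLinearMap
      (EuclideanSpace.basisFun (Fin (n + 1)) ℝ)
    have h2 := LinearMap.normDet_sq_eq_det_gram L.toLinearMap (EuclideanSpace.basisFun (Fin n) ℝ)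
    simp only [RCLike.ofReal_real_eq_id, id, ContinuousLinearMap.coe_coe] at h1 h2
    rw [h1, h2, Matrix.det_succ_row_zero, Fin.sum_univ_succ, Finset.sum_eq_zero]
    · have hsub : (Matrix.gram ℝ fun i => K (EuclideanSpace.basisFun (Fin (n + 1)) ℝ i)).submatrix
          Fin.succ (Fin.succAbove 0)
          = Matrix.gram ℝ fun i => L (EuclideanSpace.basisFun (Fin n) ℝ i) := by
        ext i j
        rw [Matrix.submatrix_apply, Matrix.gram_apply, Matrix.gram_apply, Fin.succAbove_zero, hs,
          hs]
      rw [hsub, Matrix.gram_apply, h0, real_inner_self_eq_norm_sq, hν]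
      simp
    · intro j _
      rw [Matrix.gram_apply, h0, hs, h]
      simp
  have h3 : K.toLinearMap.normDet = |K.det| := LinearMap.normDet_eq_abs_det _
  rw [← h3]
  exact (pow_left_inj₀ (LinearMap.normDet_nonneg _) (LinearMap.normDet_nonneg _) two_ne_zero).1 hdet

/-- Any `e` differs from `splitFirst` by a fixed automorphism, whose determinant supplies the
constant. -/
lemma exists_abs_det_col_eq (e : Space n ≃L[ℝ] ℝ × EuclideanSpace ℝ (Fin n)) :
    ∃ c : ℝ, 0 < c ∧ ∀ (ν : Space n) (L : EuclideanSpace ℝ (Fin n) →L[ℝ] Space n),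
      ‖ν‖ = 1 → (∀ u, ⟪ν, L u⟫ = 0) →
      |((e : Space n →L[ℝ] _) ∘L col ν L).det| = c * L.toLinearMap.normDet := by
  let P : Space n ≃L[ℝ] Space n := (e.trans (splitFirst n).symm)
  refine ⟨|(P : Space n →L[ℝ] Space n).det|, abs_pos.2 ?_, fun ν L hν h => ?_⟩
  · exact (LinearEquiv.isUnit_det' P.toLinearEquiv).ne_zero
  · rw [← abs_det_col_splitFirst hν h, ← abs_mul, ← det_comp, ← det_conj (splitFirst n)]
    congr 2

end ColDet

/-! ### Charts of hypersurfaces with boundary -/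

section LinearCharts

/-- The kernels have equal dimension; extend an isomorphism κ between them by x ↦ f(x) w + κ(x -
f(x) v). -/
lemma exists_linearEquiv_of_dual {X Y : Type*} [AddCommGroup X] [Module ℝ X] [FiniteDimensional ℝ X]
    [AddCommGroup Y] [Module ℝ Y] [FiniteDimensional ℝ Y]
    (hXY : Module.finrank ℝ X = Module.finrank ℝ Y) (f : X →ₗ[ℝ] ℝ) {v : X} (hv : f v = 1)
    (g : Y →ₗ[ℝ] ℝ) {w : Y} (hw : g w = 1) :
    ∃ e : X ≃ₗ[ℝ] Y, e v = w ∧ ∀ x, g (e x) = f x := by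
  have hf : Function.Surjective f := fun c => ⟨c • v, by simp [hv]⟩
  have hg : Function.Surjective g := fun c => ⟨c • w, by simp [hw]⟩
  have hker : Module.finrank ℝ f.ker = Module.finrank ℝ g.ker := by
    have h1 := f.finrank_range_add_finrank_ker
    have h2 := g.finrank_range_add_finrank_ker
    rw [LinearMap.range_eq_top.2 hf] at h1
    rw [LinearMap.range_eq_top.2 hg] at h2
    omega
  let κ : f.ker ≃ₗ[ℝ] g.ker := LinearEquiv.ofFinrankEq _ _ hker
  let π : X →ₗ[ℝ] f.ker := LinearMap.codRestrict f.ker (LinearMap.id - f.smulRight v) (fun x => by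
    simp [hv])
  let T : X →ₗ[ℝ] Y := f.smulRight w + g.ker.subtype ∘ₗ κ.toLinearMap ∘ₗ π
  have hgT : ∀ x, g (T x) = f x := fun x => by
    have : g (κ (π x) : Y) = 0 := (κ (π x)).2
    simp [T, hw, this]
  have hπ : ∀ x, ((π x : f.ker) : X) = x - f x • v := fun x => rfl
  have hT : Function.Injective T := by
    rw [← LinearMap.ker_eq_bot, LinearMap.ker_eq_bot']
    intro x hx
    have h1 : f x = 0 := by rw [← hgT, hx, map_zero]
    have h2 : π x = 0 := by
      have : (κ (π x) : Y) = 0 := by simpa [T, h1] using hx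
      simpa using this
    have := hπ x
    rw [h2, h1] at this
    simpa using this.symm
  refine ⟨LinearEquiv.ofInjectiveOfFinrankEq T hT hXY, ?_, hgT⟩
  have hπv : π v = 0 := Subtype.ext (by simp [hπ, hv])
  change T v = w
  simp [T, hv, hπv]

variable {F : Type*} [NormedAddCommGroup F] [NormedSpace ℝ F]

/-- Otherwise `b` vanishes on the kernel of `a` and is a multiple of `a`. -/
lemma exists_apply_eq_zero_and_eq_one {a b : F →L[ℝ] ℝ} (h : LinearIndependent ℝ ![a, b]) :
    ∃ v, a v = 0 ∧ b v = 1 := by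
  by_contra! hcon
  have hker : (⨅ _ : Unit, (a.toLinearMap).ker) ≤ (b.toLinearMap).ker := by
    rw [ciInf_const]
    intro v hv
    by_contra hbv
    exact hcon ((b v)⁻¹ • v) (by simp [show a v = 0 from hv])
      (by simpa using inv_mul_cancel₀ hbv)
  have hmem := mem_span_of_iInf_ker_le_ker (L := fun _ : Unit => a.toLinearMap) hker
  rw [Set.range_const, Submodule.mem_span_singleton] at hmem
  obtain ⟨c, hc⟩ := hmem
  have hc' : c • a + (-1 : ℝ) • b = 0 := by
    ext v
    have := LinearMap.congr_fun hc v
    simp at this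
    simp [this]
  have := LinearIndependent.pair_iff.1 h _ _ hc'
  norm_num at this

lemma exists_linear_chart {n : ℕ} {a b : Space n →L[ℝ] ℝ} (h : LinearIndependent ℝ ![a, b]) :
    ∃ (K : Space n ≃L[ℝ] ℝ × EuclideanSpace ℝ (Fin n)) (ℓ : EuclideanSpace ℝ (Fin n) →L[ℝ] ℝ)
      (v₀ : EuclideanSpace ℝ (Fin n)), ℓ v₀ = 1 ∧ (∀ x, (K x).1 = a x) ∧ ∀ x, ℓ (K x).2 = b x := by
  obtain ⟨v, hav, hbv⟩ := exists_apply_eq_zero_and_eq_one h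
  obtain ⟨w, hbw, haw⟩ := exists_apply_eq_zero_and_eq_one
    (show LinearIndependent ℝ ![b, a] from LinearIndependent.pair_symm_iff.1 h)
  obtain ⟨K, hKw, hK⟩ := exists_linearEquiv_of_dual (X := Space n)
    (Y := ℝ × EuclideanSpace ℝ (Fin n)) (by simp [add_comm]) a.toLinearMap haw
    (LinearMap.fst ℝ ℝ (EuclideanSpace ℝ (Fin n))) (w := (1, 0)) rfl
  let ℓ : EuclideanSpace ℝ (Fin n) →L[ℝ] ℝ := LinearMap.toContinuousLinearMap
    (b.toLinearMap ∘ₗ K.symm.toLinearMap ∘ₗ LinearMap.inr ℝ ℝ _)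
  have hℓ : ∀ x, ℓ (K x).2 = b x := by
    intro x
    have h1 : ((0, (K x).2) : ℝ × EuclideanSpace ℝ (Fin n)) = K (x - a x • w) := by
      rw [map_sub, map_smul, hKw]
      have : (K x).1 = a x := hK x
      ext <;> simp [this]
    change b (K.symm (0, (K x).2)) = b x
    rw [h1, LinearEquiv.symm_apply_apply]
    simp [hbw]
  exact ⟨K.toContinuousLinearEquiv, ℓ, (K v).2, by rw [hℓ, hbv], hK, hℓ⟩

end LinearCharts

/-! ### Straightening a hypersurface with boundary -/

section Charts

open Set Topology

variable {n : ℕ}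

/-- A chart of a hypersurface with boundary: on the open set `U`, the hypersurface is parametrized
by `N ∩ {ℓ ≥ 0}`, and it is contained in the regular level set `{f = 0}`. -/
structure SurfaceChart (S : Set (Space n)) where
  U : Set (Space n)
  N : Set (EuclideanSpace ℝ (Fin n))
  φ : EuclideanSpace ℝ (Fin n) → Space n
  ℓ : EuclideanSpace ℝ (Fin n) →L[ℝ] ℝ
  v₀ : EuclideanSpace ℝ (Fin n)
  f : Space n → ℝ
  ℓ_v₀ : ℓ v₀ = 1
  isOpen_U : IsOpen U
  isOpen_N : IsOpen N
  convex_N : Convex ℝ N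
  contDiffOn_f : ContDiffOn ℝ 2 f U
  fderiv_f_ne_zero : ∀ x ∈ U, fderiv ℝ f x ≠ 0
  contDiffOn_φ : ContDiffOn ℝ 1 φ N
  injOn_φ : InjOn φ N
  mapsTo_φ : MapsTo φ N U
  f_φ : ∀ y ∈ N, f (φ y) = 0
  injective_fderiv_φ : ∀ y ∈ N, Function.Injective (fderiv ℝ φ y)
  inter_eq : S ∩ U = φ '' (N ∩ {y | 0 ≤ ℓ y})
  isBoundaryPoint : ∀ y ∈ N, ℓ y = 0 → IsBoundaryPoint S (φ y)
  isCompact_preimage : ∀ K ⊆ U, IsCompact K → IsCompact (N ∩ φ ⁻¹' K)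

/-- Puts interior and boundary points in the same form. At an interior point `g` is an affine
function with g(p) = 1, and the neighbourhood is shrunk to {g > 0}, so the condition g ≥ 0 is void
and no boundary arises. -/
lemma exists_defining_functions (hn : 1 ≤ n) {S : Set (Space n)} {p : Space n}
    (hp : IsInteriorPoint S p ∨ IsBoundaryPoint S p) :
    ∃ (U : Set (Space n)) (f g : Space n → ℝ), IsOpen U ∧ p ∈ U ∧
      ContDiffOn ℝ 2 f U ∧ ContDiffOn ℝ 2 g U ∧
      LinearIndependent ℝ ![fderiv ℝ f p, fderiv ℝ g p] ∧
      S ∩ U = {x | x ∈ U ∧ f x = 0 ∧ 0 ≤ g x} ∧ p ∈ S ∧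
      ∀ x ∈ U, f x = 0 → g x = 0 → LinearIndependent ℝ ![fderiv ℝ f x, fderiv ℝ g x] →
        IsBoundaryPoint S x := by
  rcases hp with ⟨hpS, U, f, hU, hpU, hf, hfp, hSU⟩ | ⟨hpS, U, f, g, hU, hpU, hf, hg, hfp, hgp, hli, hSU⟩
  · have hdim : 1 < Module.finrank ℝ (Space n →L[ℝ] ℝ) := by
      rw [← (LinearMap.toContinuousLinearMap (𝕜 := ℝ) (E := Space n) (F' := ℝ)).finrank_eq]
      have : Module.finrank ℝ (Space n →ₗ[ℝ] ℝ) = Module.finrank ℝ (Space n) :=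
        Subspace.dual_finrank_eq
      rw [this, finrank_euclideanSpace_fin]
      omega
    obtain ⟨b, hb⟩ := exists_linearIndependent_pair_of_one_lt_finrank hdim hfp
    have hgd : ∀ x, HasFDerivAt (fun x => b (x - p) + 1) b x := fun x =>
      ((b.hasFDerivAt.comp x ((hasFDerivAt_id x).sub_const p)).add_const 1)
    have hgc : ContDiff ℝ 2 fun x => b (x - p) + 1 :=
      (b.contDiff.comp (contDiff_id.sub contDiff_const)).add contDiff_const
    refine ⟨U ∩ {x | 0 < b (x - p) + 1}, f, fun x => b (x - p) + 1,
      hU.inter (isOpen_lt continuous_const hgc.continuous), ⟨hpU, by simp⟩, hf.mono inter_subset_left,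
      hgc.contDiffOn, by rwa [(hgd p).fderiv], ?_, hpS, fun x hx _ hgx => ?_⟩
    · rw [← inter_assoc, hSU]
      ext x
      simp only [mem_inter_iff, mem_ofPred_eq]
      exact ⟨fun ⟨⟨h1, h2⟩, h3⟩ => ⟨⟨h1, h3⟩, h2, h3.le⟩, fun ⟨⟨h1, h3⟩, h2, _⟩ => ⟨⟨h1, h2⟩, h3⟩⟩
    · exact absurd hgx hx.2.ne'
  · refine ⟨U, f, g, hU, hpU, hf, hg, hli, hSU, hpS, fun x hx hfx hgx hlix => ⟨?_, U, f, g, hU, hx,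
      hf, hg, hfx, hgx, hlix, hSU⟩⟩
    have : x ∈ S ∩ U := by rw [hSU]; exact ⟨hx, hfx, hgx.ge⟩
    exact this.1

/-- The inverse function theorem applied to a map that has `f` as its first coordinate and `g` as ℓ
of its second; the chart is the inverse restricted to the slice {0} × ℝⁿ. -/
theorem exists_surfaceChart (hn : 1 ≤ n) {S : Set (Space n)} {p : Space n}
    (hp : IsInteriorPoint S p ∨ IsBoundaryPoint S p) : ∃ c : SurfaceChart S, p ∈ c.U := by
  obtain ⟨U, f, g, hU, hpU, hf, hg, hli, hSU, hpS, hbd⟩ := exists_defining_functions hn hp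
  obtain ⟨K, ℓ, v₀, hv₀, hK₁, hK₂⟩ := exists_linear_chart hli
  have hfd : ∀ x ∈ U, HasFDerivAt f (fderiv ℝ f x) x := fun x hx =>
    ((hf.contDiffAt (hU.mem_nhds hx)).differentiableAt (by simp)).hasFDerivAt
  have hgd : ∀ x ∈ U, HasFDerivAt g (fderiv ℝ g x) x := fun x hx =>
    ((hg.contDiffAt (hU.mem_nhds hx)).differentiableAt (by simp)).hasFDerivAt
  set a := fderiv ℝ f p with ha
  set b := fderiv ℝ g p with hb
  -- The linear model `K` of (a, b) is corrected by terms whose derivative vanishes at `p`, so the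
  -- derivative there is `K` itself.
  let Ψ : Space n → ℝ × EuclideanSpace ℝ (Fin n) := fun x => K x + (f x - a x, (g x - b x) • v₀)
  have hΨ₁ : ∀ x, (Ψ x).1 = f x := fun x => by simp [Ψ, hK₁]
  have hΨ₂ : ∀ x, ℓ (Ψ x).2 = g x := fun x => by simp [Ψ, hK₂, hv₀]
  let Ψ' : Space n → Space n →L[ℝ] ℝ × EuclideanSpace ℝ (Fin n) := fun x =>
    (K : Space n →L[ℝ] _) + (fderiv ℝ f x - a).prod ((fderiv ℝ g x - b).smulRight v₀)
  have hΨd : ∀ x ∈ U, HasFDerivAt Ψ (Ψ' x) x := fun x hx =>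
    K.hasFDerivAt.add (((hfd x hx).sub a.hasFDerivAt).prodMk
      (((hgd x hx).sub b.hasFDerivAt).smul_const v₀))
  have hΨp : HasFDerivAt Ψ (K : Space n →L[ℝ] ℝ × EuclideanSpace ℝ (Fin n)) p := by
    refine (hΨd p hpU).congr_fderiv ?_
    ext x <;> simp [Ψ', ha, hb]
  have hΨc : ContDiffOn ℝ 2 Ψ U :=
    K.contDiff.contDiffOn.add ((hf.sub a.contDiff.contDiffOn).prodMk
      ((hg.sub b.contDiff.contDiffOn).smul contDiffOn_const))
  have hΨcp : ContDiffAt ℝ 2 Ψ p := hΨc.contDiffAt (hU.mem_nhds hpU)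
  let Θ := hΨcp.toOpenPartialHomeomorph Ψ hΨp (by simp)
  have hΘ : ∀ x, Θ x = Ψ x := fun x => rfl
  have hpsrc : p ∈ Θ.source := hΨcp.mem_toOpenPartialHomeomorph_source hΨp (by simp)
  have hptgt : Ψ p ∈ Θ.target := Θ.map_source hpsrc
  have hsymm : Θ.symm (Ψ p) = p := Θ.left_inv hpsrc
  have hsc : ContDiffAt ℝ 1 Θ.symm (Ψ p) :=
    (Θ.contDiffAt_symm hptgt (by rw [hsymm]; exact hΨp) (by rw [hsymm]; exact hΨcp)).of_le
      (by norm_num)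
  have hnear : ∀ᶠ z in 𝓝 (Ψ p), z ∈ Θ.target ∧ ContDiffAt ℝ 1 Θ.symm z ∧ Θ.symm z ∈ U := by
    have h1 : ∀ᶠ z in 𝓝 (Ψ p), z ∈ Θ.target := Θ.open_target.mem_nhds hptgt
    refine h1.and ((hsc.eventually (by simp)).and ?_)
    exact hsc.continuousAt.eventually (by rw [hsymm]; exact hU.mem_nhds hpU)
  obtain ⟨ε, hε, hball⟩ := Metric.eventually_nhds_iff_ball.1 hnear
  set B := Metric.ball (Ψ p) ε with hB
  have hΨΘ : ∀ z ∈ B, Ψ (Θ.symm z) = z := fun z hz => Θ.right_inv (hball z hz).1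
  have hcomp : ∀ z ∈ B, ∀ u, Ψ' (Θ.symm z) (fderiv ℝ Θ.symm z u) = u := by
    intro z hz u
    have h1 : HasFDerivAt (Ψ ∘ Θ.symm) (Ψ' (Θ.symm z) ∘L fderiv ℝ Θ.symm z) z :=
      (hΨd _ (hball z hz).2.2).comp z
        (((hball z hz).2.1.differentiableAt (by simp)).hasFDerivAt)
    have h2 : HasFDerivAt (Ψ ∘ Θ.symm) (ContinuousLinearMap.id ℝ _) z := by
      refine (hasFDerivAt_id z).congr_of_eventuallyEq ?_
      filter_upwards [Metric.isOpen_ball.mem_nhds hz] with w hw using hΨΘ w hw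
    exact congr($(h1.unique h2) u)
  have hf1 : ∀ z ∈ B, ∀ u, fderiv ℝ f (Θ.symm z) u = (Ψ' (Θ.symm z) u).1 := fun z _ u => by
    simp [Ψ', hK₁]
  have hg1 : ∀ z ∈ B, ∀ u, fderiv ℝ g (Θ.symm z) u = ℓ (Ψ' (Θ.symm z) u).2 := fun z _ u => by
    simp [Ψ', hK₂, hv₀]
  let ι : EuclideanSpace ℝ (Fin n) →L[ℝ] ℝ × EuclideanSpace ℝ (Fin n) :=
    ContinuousLinearMap.inr ℝ ℝ _
  -- A slice of a ball is convex; this later makes the sign of the normal and the orientation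
  -- constant on the chart.
  let N : Set (EuclideanSpace ℝ (Fin n)) := ι ⁻¹' B
  let φ : EuclideanSpace ℝ (Fin n) → Space n := fun y => Θ.symm (ι y)
  have hφU : ∀ y ∈ N, φ y ∈ Θ.source ∩ Ψ ⁻¹' B := fun y hy =>
    ⟨Θ.map_target (hball _ hy).1, by rw [mem_preimage, hΨΘ _ hy]; exact hy⟩
  have hUB : ∀ x ∈ Θ.source ∩ Ψ ⁻¹' B, Θ.symm (Ψ x) = x := fun x hx => Θ.left_inv hx.1
  have hUU : ∀ x ∈ Θ.source ∩ Ψ ⁻¹' B, x ∈ U := fun x hx => by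
    rw [← hUB x hx]; exact (hball _ hx.2).2.2
  have hφf : ∀ y ∈ N, f (φ y) = 0 := fun y hy => by
    rw [← hΨ₁, hΨΘ _ hy]; rfl
  have hφg : ∀ y ∈ N, g (φ y) = ℓ y := fun y hy => by
    rw [← hΨ₂, hΨΘ _ hy]; rfl
  have hback : ∀ x ∈ Θ.source ∩ Ψ ⁻¹' B, f x = 0 → (Ψ x).2 ∈ N ∧ φ (Ψ x).2 = x := by
    intro x hx hfx
    have : ι (Ψ x).2 = Ψ x := Prod.ext (by rw [hΨ₁, hfx]; rfl) rfl
    exact ⟨by rw [mem_preimage, this]; exact hx.2, by simp only [φ]; rw [this]; exact hUB x hx⟩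
  refine ⟨{ U := Θ.source ∩ Ψ ⁻¹' B, N := N, φ := φ, ℓ := ℓ, v₀ := v₀, f := f, ℓ_v₀ := hv₀
            isOpen_U := Θ.isOpen_inter_preimage Metric.isOpen_ball
            isOpen_N := Metric.isOpen_ball.preimage ι.continuous
            convex_N := (convex_ball _ _).linear_preimage ι.toLinearMap
            contDiffOn_f := hf.mono hUU
            fderiv_f_ne_zero := ?_
            contDiffOn_φ := ?_
            injOn_φ := ?_
            mapsTo_φ := hφU
            f_φ := hφf
            injective_fderiv_φ := ?_
            inter_eq := ?_
            isBoundaryPoint := ?_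
            isCompact_preimage := ?_ }, ⟨hpsrc, Metric.mem_ball_self hε⟩⟩
  · intro x hx h0
    have h1 := hf1 _ hx.2 (fderiv ℝ Θ.symm (Ψ x) (1, 0))
    rw [hcomp _ hx.2, hUB x hx, h0] at h1
    simp at h1
  · intro y hy
    exact ((hball _ hy).2.1.comp y ι.contDiff.contDiffAt).contDiffWithinAt
  · intro y hy y' hy' h
    have := congrArg Ψ h
    simp only [φ] at this
    rw [hΨΘ _ hy, hΨΘ _ hy'] at this
    exact congrArg Prod.snd this
  · intro y hy
    have hd : HasFDerivAt φ (fderiv ℝ Θ.symm (ι y) ∘L ι) y :=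
      ((hball _ hy).2.1.differentiableAt (by simp)).hasFDerivAt.comp y ι.hasFDerivAt
    rw [hd.fderiv]
    intro u w huw
    have := congrArg (Ψ' (Θ.symm (ι y))) huw
    simp only [ContinuousLinearMap.comp_apply] at this
    rw [hcomp _ hy, hcomp _ hy] at this
    exact congrArg Prod.snd this
  · ext x
    constructor
    · rintro ⟨hxS, hx⟩
      have hxU : x ∈ S ∩ U := ⟨hxS, hUU x hx⟩
      rw [hSU] at hxU
      obtain ⟨hN, hφx⟩ := hback x hx hxU.2.1
      exact ⟨_, ⟨hN, by rw [mem_ofPred_eq, hΨ₂]; exact hxU.2.2⟩, hφx⟩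
    · rintro ⟨y, ⟨hy, hℓy⟩, rfl⟩
      have : φ y ∈ S ∩ U := by
        rw [hSU]
        exact ⟨hUU _ (hφU y hy), hφf y hy, by rw [hφg y hy]; exact hℓy⟩
      exact ⟨this.1, hφU y hy⟩
  · intro y hy hℓy
    refine hbd _ (hUU _ (hφU y hy)) (hφf y hy) (by rw [hφg y hy, hℓy]) ?_
    refine LinearIndependent.pair_iff.2 fun s t hst => ?_
    have h1 := congr($hst (fderiv ℝ Θ.symm (ι y) (1, 0)))
    have h2 := congr($hst (fderiv ℝ Θ.symm (ι y) (0, v₀)))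
    simp only [add_apply, smul_apply, φ] at h1 h2
    rw [hf1 _ hy, hg1 _ hy, hcomp _ hy] at h1 h2
    simp [hv₀] at h1 h2
    exact ⟨h1, h2⟩
  · intro C hC hCc
    -- The preimage of `C` is the projection of a closed slice of the compact set Ψ(C).
    have h1 : IsCompact (Prod.snd '' (Ψ '' C ∩ {z | z.1 = 0})) :=
      ((hCc.image_of_continuousOn (hΨc.continuousOn.mono fun x hx => hUU x (hC hx))).inter_right
        (isClosed_eq continuous_fst continuous_const)).image continuous_snd
    convert h1 using 1
    ext y
    constructor
    · rintro ⟨hy, hyC⟩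
      exact ⟨ι y, ⟨⟨φ y, hyC, hΨΘ _ hy⟩, rfl⟩, rfl⟩
    · rintro ⟨_, ⟨⟨x, hx, rfl⟩, hx0⟩, rfl⟩
      obtain ⟨hN, hφx⟩ := hback x (hC hx) (by rw [← hΨ₁]; exact hx0)
      exact ⟨hN, by rw [mem_preimage, hφx]; exact hx⟩

end Charts

/-! ### The Cahn–Hoffman map -/

section CahnHoffman

open Set Topology

lemma fderiv_fderiv_comm {E : Type*} [NormedAddCommGroup E] [NormedSpace ℝ E] {f : E → ℝ} {x : E} (hf : ContDiffAt ℝ 2 f x) (v w : E) :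
    fderiv ℝ (fderiv ℝ f) x v w = fderiv ℝ (fderiv ℝ f) x w v :=
  (hf.isSymmSndFDerivAt (by simp)).eq v w

section Gradient

variable {E : Type*} [NormedAddCommGroup E] [InnerProductSpace ℝ E] [CompleteSpace E]

lemma inner_gradient_eq_fderiv (f : E → ℝ) (x v : E) : ⟪gradient f x, v⟫ = fderiv ℝ f x v := by
  simp [gradient]

lemma contDiffAt_gradient {f : E → ℝ} {x : E} (hf : ContDiffAt ℝ 2 f x) :
    ContDiffAt ℝ 1 (gradient f) x :=
  (InnerProductSpace.toDual ℝ E).symm.toContinuousLinearEquiv.contDiff.contDiffAt.comp x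
    (hf.fderiv_right (by norm_num))

lemma inner_fderiv_gradient {f : E → ℝ} {x : E} (hf : ContDiffAt ℝ 2 f x) (v w : E) :
    ⟪fderiv ℝ (gradient f) x v, w⟫ = fderiv ℝ (fderiv ℝ f) x v w := by
  have h1 : HasFDerivAt (fun y => ⟪gradient f y, w⟫)
      (((innerSL ℝ).flip w) ∘L fderiv ℝ (gradient f) x) x :=
    ((innerSL ℝ).flip w).hasFDerivAt.comp x
      ((contDiffAt_gradient hf).differentiableAt (by simp)).hasFDerivAt
  have h2 : HasFDerivAt (fun y => fderiv ℝ f y w)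
      ((ContinuousLinearMap.apply ℝ ℝ w) ∘L fderiv ℝ (fderiv ℝ f) x) x :=
    (ContinuousLinearMap.apply ℝ ℝ w).hasFDerivAt.comp x
      ((hf.fderiv_right (m := 1) (by norm_num)).differentiableAt (by simp)).hasFDerivAt
  simp only [inner_gradient_eq_fderiv] at h1
  have h3 := congr($(h1.unique h2) v)
  rw [real_inner_comm]
  simpa [real_inner_comm] using! h3

end Gradient

variable {n : ℕ} {F : Sph n → ℝ}

lemma radialExt_coe (F : Sph n → ℝ) (z : Sph n) : radialExt F z = F z := by
  have hz : ‖(z : Space n)‖ = 1 := by simp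
  have h0 : (z : Space n) ≠ 0 := fun h => by simp [h] at hz
  rw [radialExt, dif_neg h0]
  congr 1
  ext
  simp

lemma radialExt_smul (F : Sph n → ℝ) (x : Space n) {c : ℝ} (hc : 0 < c) :
    radialExt F (c • x) = radialExt F x := by
  by_cases hx : x = 0
  · simp [hx]
  · rw [radialExt, radialExt, dif_neg hx, dif_neg (by simp [hx, hc.ne'])]
    congr 1
    ext1
    simp only [norm_smul, Real.norm_of_nonneg hc.le, mul_inv, smul_smul]
    congr 1
    field_simp

/-- Smoothness of `F` on the sphere is used through a globally defined map to the sphere. The map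
x/|x| is first modified away from `z`, so that it has no singularity at the origin. -/
lemma contDiffAt_radialExt (hF : IsAnisotropy F) {z : Space n} (hz : z ≠ 0) :
    ContDiffAt ℝ 2 (radialExt F) z := by
  have hz' : 0 < ‖z‖ := norm_pos_iff.2 hz
  let b : ContDiffBump z := ⟨‖z‖ / 4, ‖z‖ / 2, by positivity, by linarith⟩
  -- Equal to the identity near `z` and never zero, since its distance from `z` is less than ‖z‖/2.
  let g : Space n → Space n := fun x => z + b x • (x - z)
  have hg : ∀ x, g x ≠ 0 := by
    intro x hx
    have h1 : ‖b x • (x - z)‖ = ‖z‖ := by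
      have : b x • (x - z) = -z := by
        have : z + b x • (x - z) = 0 := hx
        exact eq_neg_of_add_eq_zero_right this
      rw [this, norm_neg]
    by_cases hxb : x ∈ Metric.ball z b.rOut
    · have h2 : ‖x - z‖ < ‖z‖ / 2 := by simpa [dist_eq_norm, b] using hxb
      rw [norm_smul, Real.norm_of_nonneg b.nonneg] at h1
      have := b.le_one (x := x)
      have := b.nonneg (x := x)
      nlinarith [norm_nonneg (x - z)]
    · rw [b.zero_of_le_dist (by simpa using hxb)] at h1
      simp at h1
      exact hz (norm_eq_zero.1 h1.symm)
  have hgc : ContDiff ℝ 2 g := contDiff_const.add (b.contDiff.smul (contDiff_id.sub contDiff_const))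
  let q : Space n → Space n := fun x => ‖g x‖⁻¹ • g x
  have hqc : ContDiff ℝ 2 q :=
    ((hgc.norm ℝ hg).inv fun x => norm_ne_zero_iff.2 (hg x)).smul hgc
  have hq : ∀ x, q x ∈ Metric.sphere (0 : Space n) 1 := fun x => by
    simp [q, norm_smul, norm_ne_zero_iff.2 (hg x)]
  have hcomp : ContDiff ℝ 2 (F ∘ Set.codRestrict q _ hq) :=
    (hF.contMDiff.comp (hqc.contMDiff.codRestrict_sphere hq)).contDiff
  refine hcomp.contDiffAt.congr_of_eventuallyEq ?_
  filter_upwards [Metric.ball_mem_nhds z (b.rIn_pos)] with x hx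
  have hgx : g x = x := by
    simp [g, b.one_of_mem_closedBall (Metric.ball_subset_closedBall hx)]
  have hx0 : x ≠ 0 := by rw [← hgx]; exact hg x
  rw [radialExt, dif_neg hx0]
  simp only [Function.comp_apply]
  congr 1
  ext1
  simp [q, hgx]

lemma fderiv_radialExt_self (hF : IsAnisotropy F) {x : Space n} (hx : x ≠ 0) :
    fderiv ℝ (radialExt F) x x = 0 := by
  have h1 : HasDerivAt (fun c : ℝ => radialExt F (c • x)) (fderiv ℝ (radialExt F) x x) 1 := by
    have h2 : HasFDerivAt (radialExt F) (fderiv ℝ (radialExt F) x) ((1 : ℝ) • x) := by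
      rw [one_smul]
      exact ((contDiffAt_radialExt hF hx).differentiableAt (by simp)).hasFDerivAt
    simpa using! h2.comp_hasDerivAt 1 ((hasDerivAt_id (1 : ℝ)).smul_const x)
  have h3 : HasDerivAt (fun c : ℝ => radialExt F (c • x)) 0 1 := by
    refine (hasDerivAt_const (1 : ℝ) (radialExt F x)).congr_of_eventuallyEq ?_
    filter_upwards [lt_mem_nhds (zero_lt_one (α := ℝ))] with c hc using radialExt_smul F x hc
  exact h1.unique h3

/-- The extension of the Cahn–Hoffman map to a neighbourhood of the sphere. -/
def cahnHoffmanExt (F : Sph n → ℝ) (x : Space n) : Space n :=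
  gradient (radialExt F) x + radialExt F x • x

lemma cahnHoffman_eq (F : Sph n → ℝ) (z : Sph n) : cahnHoffman F z = cahnHoffmanExt F z := by
  rw [cahnHoffman, cahnHoffmanExt, sphGrad, radialExt_coe]

lemma contDiffAt_cahnHoffmanExt (hF : IsAnisotropy F) {x : Space n} (hx : x ≠ 0) :
    ContDiffAt ℝ 1 (cahnHoffmanExt F) x :=
  (contDiffAt_gradient (contDiffAt_radialExt hF hx)).add
    (((contDiffAt_radialExt hF hx).of_le (by norm_num)).smul contDiffAt_id)

lemma sph_ne_zero (z : Sph n) : (z : Space n) ≠ 0 := ne_zero_of_mem_unit_sphere z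

lemma inner_cahnHoffman_self (hF : IsAnisotropy F) (z : Sph n) :
    ⟪cahnHoffman F z, (z : Space n)⟫ = F z := by
  rw [cahnHoffman, inner_add_left, sphGrad, inner_gradient_eq_fderiv,
    fderiv_radialExt_self hF (sph_ne_zero z), real_inner_smul_left, real_inner_self_eq_norm_sq]
  simp

lemma fderiv_cahnHoffmanExt (hF : IsAnisotropy F) {x : Space n} (hx : x ≠ 0) (u : Space n) :
    fderiv ℝ (cahnHoffmanExt F) x u = fderiv ℝ (gradient (radialExt F)) x u
      + (radialExt F x • u + fderiv ℝ (radialExt F) x u • x) := by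
  have h1 := ((contDiffAt_gradient (contDiffAt_radialExt hF hx)).differentiableAt
    (by simp)).hasFDerivAt
  have h2 := ((contDiffAt_radialExt hF hx).differentiableAt (by simp)).hasFDerivAt
  have h3 := (h1.add (h2.smul (hasFDerivAt_id x))).fderiv
  have h4 : fderiv ℝ (cahnHoffmanExt F) x = _ := h3
  rw [h4]
  simp

/-- The remaining term of the derivative is a multiple of `z`, so it drops out against `w`. Thus dΦ
is represented by ∇²F + Fσ on the tangent space. -/
lemma inner_fderiv_cahnHoffmanExt (hF : IsAnisotropy F) (z : Sph n) {u w : Space n}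
    (hw : ⟪(z : Space n), w⟫ = 0) :
    ⟪fderiv ℝ (cahnHoffmanExt F) z u, w⟫ = sphHess F z u w + F z * ⟪u, w⟫ := by
  rw [fderiv_cahnHoffmanExt hF (sph_ne_zero z), inner_add_left, inner_add_left,
    inner_fderiv_gradient (contDiffAt_radialExt hF (sph_ne_zero z)), real_inner_smul_left,
    real_inner_smul_left, hw, radialExt_coe, sphHess]
  ring

lemma sphHess_comm (hF : IsAnisotropy F) (z : Sph n) (u w : Space n) :
    sphHess F z u w = sphHess F z w u :=
  fderiv_fderiv_comm (contDiffAt_radialExt hF (sph_ne_zero z)) u w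

/-- The derivative of the Cahn–Hoffman map takes tangent vectors to tangent vectors. -/
lemma inner_fderiv_cahnHoffmanExt_self (hF : IsAnisotropy F) (z : Sph n) {u : Space n}
    (hu : ⟪(z : Space n), u⟫ = 0) :
    ⟪fderiv ℝ (cahnHoffmanExt F) z u, (z : Space n)⟫ = 0 := by
  have hz := sph_ne_zero z
  have hΦ := ((contDiffAt_cahnHoffmanExt hF hz).differentiableAt (by simp)).hasFDerivAt
  have hR := ((contDiffAt_radialExt hF hz).differentiableAt (by simp)).hasFDerivAt
  have h1 := hΦ.inner ℝ (hasFDerivAt_id (𝕜 := ℝ) (z : Space n))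
  have h2 := hR.mul ((hasFDerivAt_id (𝕜 := ℝ) (z : Space n)).inner ℝ
    (hasFDerivAt_id (𝕜 := ℝ) (z : Space n)))
  -- Differentiate ⟨Φ(x), x⟩ = F(x/|x|) |x|² along `u`: the term ⟨Φ(z), u⟩ is the derivative of F
  -- along `u` and cancels the right-hand side.
  have heq : (fun x => radialExt F x * ⟪id x, id x⟫) =ᶠ[𝓝 (z : Space n)]
      fun x => ⟪cahnHoffmanExt F x, id x⟫ := by
    filter_upwards [isOpen_ne.mem_nhds hz] with x hx
    rw [cahnHoffmanExt, inner_add_left, id, inner_gradient_eq_fderiv, fderiv_radialExt_self hF hx,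
      real_inner_smul_left, zero_add]
  have h3 := congr($(h1.unique (h2.congr_of_eventuallyEq heq.symm)) u)
  have hu' : ⟪u, (z : Space n)⟫ = 0 := by rw [real_inner_comm]; exact hu
  have h4 : ⟪cahnHoffmanExt F z, u⟫ = fderiv ℝ (radialExt F) z u := by
    rw [cahnHoffmanExt, inner_add_left, inner_gradient_eq_fderiv, real_inner_smul_left, hu]
    ring
  have hz1 : ⟪(z : Space n), (z : Space n)⟫ = 1 := by
    rw [real_inner_self_eq_norm_sq]; simp
  simp [hu, hu', h4] at h3
  linarith

end CahnHoffman

/-! ### Products of symmetric operators -/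

section Splits

/-- Write A = C*C. Then C*CB has the characteristic polynomial of CBC*, which is Hermitian and so
has real eigenvalues. -/
lemma splits_charpoly_comp {T : Type*} [NormedAddCommGroup T] [InnerProductSpace ℝ T]
    [FiniteDimensional ℝ T] {A B : T →ₗ[ℝ] T} (hA : A.IsPositive) (hB : B.IsSymmetric) :
    (A ∘ₗ B).charpoly.Splits := by
  let b := stdOrthonormalBasis ℝ T
  have hA' : (A.toMatrix b.toBasis b.toBasis).PosSemidef := LinearMap.posSemidef_toMatrix_iff b |>.2 hA
  have hB' : (B.toMatrix b.toBasis b.toBasis).IsHermitian := LinearMap.isHermitian_toMatrix_iff b |>.2 hB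
  obtain ⟨C, hC⟩ : ∃ C, A.toMatrix b.toBasis b.toBasis = C.conjTranspose * C := by
    open scoped MatrixOrder in
    exact (CStarAlgebra.nonneg_iff_eq_star_mul_self.1 (Matrix.nonneg_iff_posSemidef.2 hA'))
  rw [← LinearMap.charpoly_toMatrix _ b.toBasis, LinearMap.toMatrix_comp _ b.toBasis, hC,
    Matrix.mul_assoc, Matrix.charpoly_mul_comm]
  exact (Matrix.isHermitian_mul_mul_conjTranspose C hB').splits_charpoly

end Splits

/-! ### The unit normal and the anisotropic Weingarten map in a chart -/

section ChartNormal

open Set Topology Module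

/-- Both vectors are unit vectors in the orthogonal complement of the range, which is a line. -/
lemma eq_or_eq_neg_of_orthogonal_range {V F : Type*} [NormedAddCommGroup V] [NormedSpace ℝ V]
    [FiniteDimensional ℝ V] [NormedAddCommGroup F] [InnerProductSpace ℝ F] [FiniteDimensional ℝ F]
    (hd : finrank ℝ F = finrank ℝ V + 1) {L : V →L[ℝ] F} (hL : Function.Injective L) {a b : F}
    (ha : ‖a‖ = 1) (hb : ‖b‖ = 1) (haL : ∀ u, ⟪a, L u⟫ = 0) (hbL : ∀ u, ⟪b, L u⟫ = 0) :
    a = b ∨ a = -b := by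
  have ha0 : b ≠ 0 := fun h => by simp [h] at hb
  let R := LinearMap.range L.toLinearMap
  have hR : finrank ℝ R = finrank ℝ V := LinearMap.finrank_range_of_inj hL
  have hR1 : finrank ℝ Rᗮ = 1 := by
    have := R.finrank_add_finrank_orthogonal
    omega
  have mem : ∀ c : F, (∀ u, ⟪c, L u⟫ = 0) → c ∈ Rᗮ := by
    intro c hc
    rw [Submodule.mem_orthogonal']
    rintro _ ⟨u, rfl⟩
    exact hc u
  obtain ⟨t, ht⟩ := (finrank_eq_one_iff_of_nonzero' (⟨b, mem b hbL⟩ : Rᗮ)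
    (by simpa using ha0)).1 hR1 ⟨a, mem a haL⟩
  have ht' : t • b = a := congrArg Subtype.val ht
  have : |t| = 1 := by
    have := congrArg norm ht'
    rwa [norm_smul, ha, hb, mul_one] at this
  rcases eq_or_eq_neg_of_abs_eq this with h | h
  · left; rw [← ht', h, one_smul]
  · right; rw [← ht', h, neg_one_smul]

variable {n : ℕ} {F : Sph n → ℝ} {S : Set (Space n)} {ν : Space n → Sph n}

namespace SurfaceChart

variable (c : SurfaceChart S)

/-- The parameter domain of the part of the hypersurface that the chart covers. -/
def D : Set (EuclideanSpace ℝ (Fin n)) := c.N ∩ {y | 0 ≤ c.ℓ y}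

lemma D_subset : c.D ⊆ c.N := inter_subset_left

lemma convex_D : Convex ℝ c.D :=
  c.convex_N.inter (convex_halfSpace_ge c.ℓ.toLinearMap.isLinear 0)

lemma uniqueDiffOn_D : UniqueDiffOn ℝ c.D := by
  intro y hy
  refine uniqueDiffWithinAt_convex c.convex_D ?_ (subset_closure hy)
  have ho : IsOpen (c.N ∩ {y | 0 < c.ℓ y}) :=
    c.isOpen_N.inter (isOpen_lt continuous_const c.ℓ.continuous)
  have hcont : ContinuousAt (fun δ : ℝ => y + δ • c.v₀) 0 := by fun_prop
  have h0 : ∀ᶠ δ : ℝ in 𝓝 0, y + δ • c.v₀ ∈ c.N :=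
    hcont.eventually (c.isOpen_N.mem_nhds (by simpa using hy.1))
  obtain ⟨δ, hδN, hδ⟩ := ((h0.filter_mono nhdsWithin_le_nhds).and
    (self_mem_nhdsWithin (a := (0 : ℝ)) (s := Ioi 0))).exists
  have hsub : c.N ∩ {y | 0 < c.ℓ y} ⊆ interior c.D :=
    interior_maximal (inter_subset_inter_right _ fun z (hz : 0 < c.ℓ z) => hz.le) ho
  have : (0 : ℝ) ≤ c.ℓ y := hy.2
  have hδ' : (0 : ℝ) < δ := hδ
  refine ⟨y + δ • c.v₀, hsub ⟨hδN, ?_⟩⟩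
  simp only [mem_ofPred_eq, map_add, map_smul, c.ℓ_v₀, smul_eq_mul]
  linarith

lemma hasFDerivAt_φ {y} (hy : y ∈ c.N) : HasFDerivAt c.φ (fderiv ℝ c.φ y) y :=
  ((c.contDiffOn_φ.contDiffAt (c.isOpen_N.mem_nhds hy)).differentiableAt (by simp)).hasFDerivAt

lemma mapsTo_φ_D : MapsTo c.φ c.D (S ∩ c.U) := by
  rw [c.inter_eq]
  exact mapsTo_image _ _

/-- The derivative of φ carries tangent vectors of the domain to tangent vectors of `S`, and the
former span a dense subspace, also at points with ℓ y = 0. -/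
lemma inner_normal_fderiv (hν : IsUnitNormal S ν) {y} (hy : y ∈ c.D) (u) :
    ⟪(ν (c.φ y) : Space n), fderiv ℝ c.φ y u⟫ = 0 := by
  have h1 : MapsTo (fderiv ℝ c.φ y) (tangentConeAt ℝ c.D y) (tangentConeAt ℝ S (c.φ y)) :=
    fun u hu => tangentConeAt_mono (image_subset_iff.2 fun z hz => (c.mapsTo_φ_D hz).1)
      ((c.hasFDerivAt_φ hy.1).hasFDerivWithinAt.mapsTo_tangent_cone hu)
  have h2 : (innerSL ℝ (ν (c.φ y) : Space n)) ∘L fderiv ℝ c.φ y = 0 :=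
    ContinuousLinearMap.ext_on (c.uniqueDiffOn_D y hy).dense_tangentConeAt fun u hu => by
      simpa using! hν.normal _ (c.mapsTo_φ_D hy).1 _ (h1 hu)
  simpa using! congr($h2 u)

lemma finrank_space : finrank ℝ (Space n) = finrank ℝ (EuclideanSpace ℝ (Fin n)) + 1 := by simp

lemma mem_range_fderiv {y} (hy : y ∈ c.N) {a : Space n} (ha : a ≠ 0)
    (haL : ∀ u, ⟪a, fderiv ℝ c.φ y u⟫ = 0) {v : Space n} (hv : ⟪a, v⟫ = 0) :
    ∃ u, fderiv ℝ c.φ y u = v := by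
  let R := LinearMap.range (fderiv ℝ c.φ y).toLinearMap
  have hR : finrank ℝ R = n := by
    have := LinearMap.finrank_range_of_inj (c.injective_fderiv_φ y hy)
    simpa using! this
  have hle : R ≤ (ℝ ∙ a)ᗮ := by
    rintro _ ⟨u, rfl⟩
    exact Submodule.mem_orthogonal_singleton_iff_inner_right.2 (haL u)
  have heq : R = (ℝ ∙ a)ᗮ := by
    refine Submodule.eq_of_le_of_finrank_eq hle ?_
    rw [hR, Submodule.finrank_orthogonal_span_singleton (n := n) ha]
  have : v ∈ R := by
    rw [heq]
    exact Submodule.mem_orthogonal_singleton_iff_inner_right.2 hv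
  exact this

/-- `N` is a `C¹` unit field on the chart domain that extends the unit normal field `ν`. -/
structure IsNormalExtension (ν : Space n → Sph n) (N : Space n → Space n) : Prop where
  contDiffOn : ContDiffOn ℝ 1 N c.U
  norm_eq : ∀ x ∈ c.U, ‖N x‖ = 1
  eq_coe : ∀ x ∈ S ∩ c.U, N x = ν x
  inner_fderiv_φ : ∀ y ∈ c.N, ∀ u, ⟪N (c.φ y), fderiv ℝ c.φ y u⟫ = 0
  inner_fderiv_comm : ∀ x ∈ c.U, ∀ v w, ⟪N x, v⟫ = 0 → ⟪N x, w⟫ = 0 →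
    ⟪fderiv ℝ N x v, w⟫ = ⟪fderiv ℝ N x w, v⟫

/-- The normalized gradient of the defining function agrees with ν up to a sign, which is constant
because the parameter domain is connected and ν is continuous. In particular ν gains C¹ regularity.
-/
lemma exists_isNormalExtension (hν : IsUnitNormal S ν) : ∃ N, c.IsNormalExtension ν N := by
  have hfat : ∀ x ∈ c.U, ContDiffAt ℝ 2 c.f x := fun x hx =>
    c.contDiffOn_f.contDiffAt (c.isOpen_U.mem_nhds hx)
  have hg0 : ∀ x ∈ c.U, gradient c.f x ≠ 0 := fun x hx h => c.fderiv_f_ne_zero x hx <| by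
    ext v
    rw [← inner_gradient_eq_fderiv, h, inner_zero_left]
    rfl
  have hgrad : ContDiffOn ℝ 1 (gradient c.f) c.U := fun x hx =>
    (contDiffAt_gradient (hfat x hx)).contDiffWithinAt
  have hinv : ContDiffOn ℝ 1 (fun x => ‖gradient c.f x‖⁻¹) c.U :=
    (hgrad.norm ℝ hg0).inv fun x hx => norm_ne_zero_iff.2 (hg0 x hx)
  let N₀ : Space n → Space n := fun x => ‖gradient c.f x‖⁻¹ • gradient c.f x
  have hN₀ : ContDiffOn ℝ 1 N₀ c.U := hinv.smul hgrad
  have hN₀1 : ∀ x ∈ c.U, ‖N₀ x‖ = 1 := fun x hx => by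
    simp [N₀, norm_smul, norm_ne_zero_iff.2 (hg0 x hx)]
  have hperp : ∀ y ∈ c.N, ∀ u, ⟪N₀ (c.φ y), fderiv ℝ c.φ y u⟫ = 0 := by
    intro y hy u
    have h1 := ((hfat _ (c.mapsTo_φ hy)).differentiableAt (by simp)).hasFDerivAt.comp y
      (c.hasFDerivAt_φ hy)
    have h2 : HasFDerivAt (c.f ∘ c.φ) (0 : EuclideanSpace ℝ (Fin n) →L[ℝ] ℝ) y := by
      refine (hasFDerivAt_const (0 : ℝ) y).congr_of_eventuallyEq ?_
      filter_upwards [c.isOpen_N.mem_nhds hy] with z hz using c.f_φ z hz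
    have h3 := congr($(h1.unique h2) u)
    rw [real_inner_smul_left, inner_gradient_eq_fderiv]
    simp at h3
    rw [h3, mul_zero]
  have hdich : ∀ y ∈ c.D, (ν (c.φ y) : Space n) = N₀ (c.φ y) ∨ (ν (c.φ y) : Space n) = -N₀ (c.φ y) :=
    fun y hy => eq_or_eq_neg_of_orthogonal_range finrank_space (c.injective_fderiv_φ y hy.1)
      (by simp) (hN₀1 _ (c.mapsTo_φ hy.1)) (c.inner_normal_fderiv hν hy) (hperp y hy.1)
  have hcont : ContinuousOn (fun y => ⟪(ν (c.φ y) : Space n), N₀ (c.φ y)⟫) c.D := by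
    have hφ : ContinuousOn c.φ c.D := c.contDiffOn_φ.continuousOn.mono c.D_subset
    exact ((continuous_subtype_val.comp_continuousOn hν.continuousOn).comp hφ
      fun y hy => (c.mapsTo_φ_D hy).1).inner
        (hN₀.continuousOn.comp hφ fun y hy => (c.mapsTo_φ_D hy).2)
  have hself : ∀ y ∈ c.D, ⟪N₀ (c.φ y), N₀ (c.φ y)⟫ = 1 := fun y hy => by
    rw [real_inner_self_eq_norm_sq, hN₀1 _ (c.mapsTo_φ hy.1), one_pow]
  have hsq : EqOn ((fun y => ⟪(ν (c.φ y) : Space n), N₀ (c.φ y)⟫) ^ 2) 1 c.D := by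
    intro y hy
    rcases hdich y hy with h | h <;> simp [h, hN₀1 _ (c.mapsTo_φ hy.1)]
  obtain ⟨ε, hε, hνε⟩ : ∃ ε : ℝ, |ε| = 1 ∧ ∀ y ∈ c.D, (ν (c.φ y) : Space n) = ε • N₀ (c.φ y) := by
    rcases c.convex_D.isPreconnected.eq_one_or_eq_neg_one_of_sq_eq hcont hsq with h | h
    · refine ⟨1, by simp, fun y hy => ?_⟩
      rcases hdich y hy with h' | h'
      · simpa using h'
      · have := h hy
        simp only [h', inner_neg_left, hself y hy] at this
        norm_num at this
    · refine ⟨-1, by simp, fun y hy => ?_⟩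
      rcases hdich y hy with h' | h'
      · have := h hy
        simp only [h', hself y hy] at this
        norm_num at this
      · simpa using h'
  refine ⟨fun x => ε • N₀ x, hN₀.const_smul ε, fun x hx => ?_, ?_, fun y hy u => ?_, ?_⟩
  · rw [norm_smul, hN₀1 x hx, Real.norm_eq_abs, hε, one_mul]
  · intro x hx
    rw [c.inter_eq] at hx
    obtain ⟨y, hy, rfl⟩ := hx
    exact (hνε y hy).symm
  · rw [real_inner_smul_left, hperp y hy, mul_zero]
  · intro x hx v w hv hw
    have hε0 : ε ≠ 0 := fun h => by simp [h] at hε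
    -- The derivative of the factor 1/|∇f| multiplies ∇f and disappears against tangential `w`; what
    -- remains is the symmetric second derivative of `f`.
    have key : ∀ v w, ⟪ε • N₀ x, w⟫ = 0 → ⟪fderiv ℝ (fun x => ε • N₀ x) x v, w⟫ =
        ε * (‖gradient c.f x‖⁻¹ * fderiv ℝ (fderiv ℝ c.f) x v w) := by
      intro v w hw
      have h1 := ((hinv.contDiffAt (c.isOpen_U.mem_nhds hx)).differentiableAt (by simp)).hasFDerivAt
      have h2 := ((hgrad.contDiffAt (c.isOpen_U.mem_nhds hx)).differentiableAt
        (by simp)).hasFDerivAt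
      have h3 := ((h1.smul h2).const_smul ε).fderiv
      have h4 : fderiv ℝ (fun x => ε • N₀ x) x = _ := h3
      have hw' : ⟪gradient c.f x, w⟫ = 0 := by
        rw [real_inner_smul_left, real_inner_smul_left] at hw
        have := norm_ne_zero_iff.2 (hg0 x hx)
        simpa [hε0, this] using hw
      rw [h4]
      simp only [smul_apply, add_apply, ContinuousLinearMap.smulRight_apply,
        inner_add_left, real_inner_smul_left, hw', inner_fderiv_gradient (hfat x hx)]
      ring
    rw [key v w hw, key w v hv, fderiv_fderiv_comm (hfat x hx)]

end SurfaceChart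

end ChartNormal

/-! ### The derivative of the anisotropic normal along the hypersurface -/

section Weingarten

open Set Topology Module

variable {n : ℕ} {F : Sph n → ℝ} {S : Set (Space n)} {ν : Space n → Sph n}

lemma mem_tangent_iff {p v : Space n} : v ∈ tangent ν p ↔ ⟪(ν p : Space n), v⟫ = 0 :=
  Submodule.mem_orthogonal_singleton_iff_inner_right

namespace SurfaceChart

variable {c : SurfaceChart S} {N : Space n → Space n}

lemma IsNormalExtension.ne_zero (h : c.IsNormalExtension ν N) {x} (hx : x ∈ c.U) : N x ≠ 0 :=
  fun h0 => by simpa [h0] using h.norm_eq x hx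

lemma IsNormalExtension.hasFDerivAt (h : c.IsNormalExtension ν N) {x} (hx : x ∈ c.U) :
    HasFDerivAt N (fderiv ℝ N x) x :=
  ((h.contDiffOn.contDiffAt (c.isOpen_U.mem_nhds hx)).differentiableAt (by simp)).hasFDerivAt

lemma IsNormalExtension.inner_fderiv_self (h : c.IsNormalExtension ν N) {x} (hx : x ∈ c.U) (v) :
    ⟪N x, fderiv ℝ N x v⟫ = 0 := by
  have h1 := (h.hasFDerivAt hx).inner ℝ (h.hasFDerivAt hx)
  have h2 : HasFDerivAt (fun x => ⟪N x, N x⟫) (0 : Space n →L[ℝ] ℝ) x := by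
    refine (hasFDerivAt_const (1 : ℝ) x).congr_of_eventuallyEq ?_
    filter_upwards [c.isOpen_U.mem_nhds hx] with z hz
    rw [real_inner_self_eq_norm_sq, h.norm_eq z hz, one_pow]
  have h3 := congr($(h1.unique h2) v)
  simp [real_inner_comm] at h3
  linarith

lemma IsNormalExtension.contDiffOn_cahnHoffmanExt (h : c.IsNormalExtension ν N)
    (hF : IsAnisotropy F) : ContDiffOn ℝ 1 (fun x => cahnHoffmanExt F (N x)) c.U := fun x hx =>
  ((contDiffAt_cahnHoffmanExt hF (h.ne_zero hx)).comp x
    (h.contDiffOn.contDiffAt (c.isOpen_U.mem_nhds hx))).contDiffWithinAt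

lemma IsNormalExtension.anisoNormal_eq (h : c.IsNormalExtension ν N) {x} (hx : x ∈ S ∩ c.U) :
    anisoNormal F ν x = cahnHoffmanExt F (N x) := by
  rw [anisoNormal, cahnHoffman_eq, h.eq_coe x hx]

lemma IsNormalExtension.hasFDerivAt_cahnHoffmanExt (h : c.IsNormalExtension ν N)
    (hF : IsAnisotropy F) {x} (hx : x ∈ c.U) :
    HasFDerivAt (fun x => cahnHoffmanExt F (N x))
      (fderiv ℝ (cahnHoffmanExt F) (N x) ∘L fderiv ℝ N x) x :=
  HasFDerivAt.comp x ((contDiffAt_cahnHoffmanExt hF (h.ne_zero hx)).differentiableAt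
    (by simp)).hasFDerivAt (h.hasFDerivAt hx)

/-- Derivatives within the thin set `S` are unique only in tangential directions. The comparison is
therefore made after composing with φ, on a domain where derivatives are unique. -/
lemma IsNormalExtension.fderivWithin_anisoNormal_comp (h : c.IsNormalExtension ν N)
    (hF : IsAnisotropy F) {y} (hy : y ∈ c.D) (u) :
    fderivWithin ℝ (anisoNormal F ν) S (c.φ y) (fderiv ℝ c.φ y u) =
      fderiv ℝ (cahnHoffmanExt F) (N (c.φ y)) (fderiv ℝ N (c.φ y) (fderiv ℝ c.φ y u)) := by
  have hx := c.mapsTo_φ_D hy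
  have h1 := (h.hasFDerivAt_cahnHoffmanExt hF hx.2)
  have h2 : HasFDerivWithinAt (anisoNormal F ν)
      (fderiv ℝ (cahnHoffmanExt F) (N (c.φ y)) ∘L fderiv ℝ N (c.φ y)) S (c.φ y) := by
    refine h1.hasFDerivWithinAt.congr_of_eventuallyEq ?_ (h.anisoNormal_eq hx)
    filter_upwards [self_mem_nhdsWithin, mem_nhdsWithin_of_mem_nhds (c.isOpen_U.mem_nhds hx.2)]
      with z hz hzU using h.anisoNormal_eq ⟨hz, hzU⟩
  have hφ := (c.hasFDerivAt_φ hy.1).hasFDerivWithinAt (s := c.D)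
  have hm : MapsTo c.φ c.D S := fun z hz => (c.mapsTo_φ_D hz).1
  have h3 := h2.differentiableWithinAt.hasFDerivWithinAt.comp y hφ hm
  exact congr($((c.uniqueDiffOn_D y hy).eq h3 (h2.comp y hφ hm)) u)

lemma IsNormalExtension.fderivWithin_anisoNormal (h : c.IsNormalExtension ν N)
    (hF : IsAnisotropy F) {x} (hx : x ∈ S ∩ c.U) {v} (hv : ⟪(ν x : Space n), v⟫ = 0) :
    fderivWithin ℝ (anisoNormal F ν) S x v =
      fderiv ℝ (cahnHoffmanExt F) (ν x) (fderiv ℝ N x v) := by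
  have hx' := hx
  rw [c.inter_eq] at hx'
  obtain ⟨y, hy, rfl⟩ := hx'
  rw [← h.eq_coe _ hx] at hv ⊢
  obtain ⟨u, rfl⟩ := c.mem_range_fderiv hy.1 (h.ne_zero hx.2) (h.inner_fderiv_φ y hy.1) hv
  exact h.fderivWithin_anisoNormal_comp hF hy u

lemma IsNormalExtension.inner_fderivWithin_anisoNormal (h : c.IsNormalExtension ν N)
    (hF : IsAnisotropy F) {x} (hx : x ∈ S ∩ c.U) {v} (hv : ⟪(ν x : Space n), v⟫ = 0) :
    ⟪(ν x : Space n), fderivWithin ℝ (anisoNormal F ν) S x v⟫ = 0 := by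
  rw [h.fderivWithin_anisoNormal hF hx hv, real_inner_comm]
  refine inner_fderiv_cahnHoffmanExt_self hF _ ?_
  rw [← h.eq_coe x hx]
  exact h.inner_fderiv_self hx.2 v

/-- The anisotropic principal curvatures are real. -/
lemma IsNormalExtension.splits_charpoly_weingarten (h : c.IsNormalExtension ν N)
    (hF : IsAnisotropy F) {x} (hx : x ∈ S ∩ c.U) : (weingarten F S ν x).charpoly.Splits := by
  let P := (tangent ν x).orthogonalProjectionOnto
  let A : tangent ν x →ₗ[ℝ] tangent ν x :=
    (P ∘L fderiv ℝ (cahnHoffmanExt F) (ν x) ∘L (tangent ν x).subtypeL).toLinearMap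
  let B : tangent ν x →ₗ[ℝ] tangent ν x :=
    (P ∘L fderiv ℝ N x ∘L (tangent ν x).subtypeL).toLinearMap
  have hmem : ∀ w : tangent ν x, ⟪(ν x : Space n), w⟫ = 0 := fun w => mem_tangent_iff.1 w.2
  have hA : ∀ v w : tangent ν x, ⟪A v, w⟫ = sphHess F (ν x) v w + F (ν x) * ⟪v, w⟫ := fun v w => by
    have : ⟪A v, w⟫ = ⟪fderiv ℝ (cahnHoffmanExt F) (ν x) v, (w : Space n)⟫ :=
      Submodule.inner_orthogonalProjectionOnto_eq_of_mem_right w _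
    rw [this, inner_fderiv_cahnHoffmanExt hF _ (hmem w)]
    rfl
  have hB : ∀ v w : tangent ν x, ⟪B v, w⟫ = ⟪fderiv ℝ N x v, (w : Space n)⟫ := fun v w =>
    Submodule.inner_orthogonalProjectionOnto_eq_of_mem_right w _
  -- The factors are dΦ, which is positive by ellipticity, and the Euclidean shape operator, which
  -- is symmetric.
  have hAB : weingarten F S ν x = A ∘ₗ B := by
    ext v : 1
    have h1 : (B v : Space n) = fderiv ℝ N x v := by
      refine Submodule.starProjection_eq_self_iff.2 (mem_tangent_iff.2 ?_)
      rw [← h.eq_coe x hx]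
      exact h.inner_fderiv_self hx.2 v
    change P (fderivWithin ℝ (anisoNormal F ν) S x v) = P (fderiv ℝ (cahnHoffmanExt F) (ν x) (B v))
    rw [h1, h.fderivWithin_anisoNormal hF hx (hmem v)]
  rw [hAB]
  refine splits_charpoly_comp ⟨fun v w => ?_, fun v => ?_⟩ fun v w => ?_
  · rw [real_inner_comm (A w) v, hA, hA, sphHess_comm hF, real_inner_comm]
  · change 0 ≤ ⟪A v, v⟫
    rw [hA]
    by_cases hv : (v : Space n) = 0
    · simp [sphHess, hv]
    · exact (hF.elliptic (ν x) v (hmem v) hv).le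
  · rw [real_inner_comm (B w) v, hB, hB]
    have := h.eq_coe x hx
    exact h.inner_fderiv_comm x hx.2 _ _ (by rw [this]; exact hmem v) (by rw [this]; exact hmem w)

end SurfaceChart

end Weingarten

/-! ### Determinants of maps that preserve a hyperplane -/

section HyperplaneDet

open Module

variable {X : Type*} [NormedAddCommGroup X] [InnerProductSpace ℝ X]

/-- The orthogonal projection onto the hyperplane orthogonal to the unit vector `ν`. -/
def hyperplaneProj (ν : X) : X →L[ℝ] X :=
  ContinuousLinearMap.id ℝ X - (innerSL ℝ ν).smulRight ν

@[simp] lemma hyperplaneProj_apply (ν v : X) : hyperplaneProj ν v = v - ⟪ν, v⟫ • ν := by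
  simp [hyperplaneProj]

/-- The linear map that takes `ν` to `Z` and agrees with `B` on the orthogonal complement. -/
def frameMap (ν Z : X) (B : X →L[ℝ] X) : X →L[ℝ] X :=
  (innerSL ℝ ν).smulRight Z + B ∘L hyperplaneProj ν

lemma frameMap_apply (ν Z : X) (B : X →L[ℝ] X) (v : X) :
    frameMap ν Z B v = ⟪ν, v⟫ • Z + B (v - ⟪ν, v⟫ • ν) := by
  simp [frameMap]

variable [FiniteDimensional ℝ X]

/-- `M` preserves the hyperplane orthogonal to ν, so it is block triangular; on the one-dimensional
quotient it acts by ⟨ν, Mν⟩. -/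
lemma det_eq_inner_mul_det {ν : X} (hν : ‖ν‖ = 1) (M : X →L[ℝ] X)
    (w : (ℝ ∙ ν)ᗮ →ₗ[ℝ] (ℝ ∙ ν)ᗮ) (hw : ∀ v, (w v : X) = M v) :
    M.det = ⟪ν, M ν⟫ * w.det := by
  have hνν : ⟪ν, ν⟫ = 1 := by rw [real_inner_self_eq_norm_sq, hν, one_pow]
  have hν0 : ν ≠ 0 := fun h => by simp [h] at hν
  have hmem : ∀ v, v ∈ (ℝ ∙ ν)ᗮ ↔ ⟪ν, v⟫ = 0 := fun v =>
    Submodule.mem_orthogonal_singleton_iff_inner_right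
  have he : (ℝ ∙ ν)ᗮ ≤ (ℝ ∙ ν)ᗮ.comap M.toLinearMap := fun v hv => by
    rw [Submodule.mem_comap]
    exact hw ⟨v, hv⟩ ▸ (w ⟨v, hv⟩).2
  have hr : M.toLinearMap.restrict he = w := by
    ext v
    simpa using! (hw v).symm
  have hq : (ℝ ∙ ν)ᗮ.mapQ (ℝ ∙ ν)ᗮ M.toLinearMap he = ⟪ν, M ν⟫ • LinearMap.id := by
    ext v
    change (ℝ ∙ ν)ᗮ.mkQ (M v) = ⟪ν, M ν⟫ • (ℝ ∙ ν)ᗮ.mkQ v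
    rw [← map_smul, ← sub_eq_zero, ← map_sub, Submodule.mkQ_apply, Submodule.Quotient.mk_eq_zero,
      hmem]
    have h1 : v - ⟪ν, v⟫ • ν ∈ (ℝ ∙ ν)ᗮ := by
      rw [hmem, inner_sub_right, real_inner_smul_right, hνν, mul_one, sub_self]
    have h2 := (hmem _).1 (he h1)
    simp only [ContinuousLinearMap.coe_coe, map_sub, map_smul, inner_sub_right,
      real_inner_smul_right] at h2 ⊢
    linarith
  have hdim : finrank ℝ (X ⧸ (ℝ ∙ ν)ᗮ) = 1 := by
    have h1 := (ℝ ∙ ν)ᗮ.finrank_quotient_add_finrank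
    have h2 := (ℝ ∙ ν).finrank_add_finrank_orthogonal
    rw [finrank_span_singleton hν0] at h2
    omega
  have h := LinearMap.det_eq_det_mul_det (ℝ ∙ ν)ᗮ M.toLinearMap he
  rw [hr, hq, LinearMap.det_smul, hdim, LinearMap.det_id, pow_one, mul_one, mul_comm] at h
  exact h

lemma det_frameMap {ν : X} (hν : ‖ν‖ = 1) (Z : X) (B : X →L[ℝ] X)
    (w : (ℝ ∙ ν)ᗮ →ₗ[ℝ] (ℝ ∙ ν)ᗮ) (hw : ∀ v, (w v : X) = B v) (s : ℝ) :
    (frameMap ν Z (s • ContinuousLinearMap.id ℝ X + B)).det =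
      ⟪ν, Z⟫ * (s • LinearMap.id + w).det := by
  rw [det_eq_inner_mul_det hν _ (s • LinearMap.id + w) fun v => ?_]
  · simp [frameMap_apply, hν]
  · have : ⟪ν, (v : X)⟫ = 0 := Submodule.mem_orthogonal_singleton_iff_inner_right.1 v.2
    simp [frameMap_apply, this, hw]

lemma eval_charpoly_eq_det {T : Type*} [AddCommGroup T] [Module ℝ T] [FiniteDimensional ℝ T]
    (w : T →ₗ[ℝ] T) (s : ℝ) : w.charpoly.eval s = (s • LinearMap.id - w).det := by
  rw [LinearMap.eval_charpoly]
  congr 1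

lemma det_smul_id_add {T : Type*} [AddCommGroup T] [Module ℝ T] [FiniteDimensional ℝ T]
    {w : T →ₗ[ℝ] T} (hw : w.charpoly.Splits) (s : ℝ) :
    (s • LinearMap.id + w).det =
      ((w.charpoly.roots.map fun κ => Polynomial.X + Polynomial.C κ).prod).eval s := by
  -- Reduces the determinant to the characteristic polynomial at -s, with one sign for each root.
  have h1 : (s • LinearMap.id + w) = (-1 : ℝ) • ((-s) • LinearMap.id - w) := by
    ext v; simp [add_comm]
  have hcard : finrank ℝ T = w.charpoly.roots.card := by
    rw [← hw.natDegree_eq_card_roots, LinearMap.charpoly_natDegree]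
  have h2 : w.charpoly.eval (-s) = (w.charpoly.roots.map fun κ => -s - κ).prod := by
    conv_lhs => rw [hw.eq_prod_roots_of_monic w.charpoly_monic]
    simp [Polynomial.eval_multiset_prod, Multiset.map_map]
  rw [h1, LinearMap.det_smul, ← eval_charpoly_eq_det, hcard, h2,
    Polynomial.eval_multiset_prod, Multiset.map_map]
  rw [← Multiset.card_map (fun κ => -s - κ), ← Multiset.prod_map_neg, Multiset.map_map]
  congr 1
  refine Multiset.map_congr rfl fun κ _ => ?_
  simp
  ring

/-- The polynomial `∏ (X + κ)`. -/
def shiftPoly (κ : Multiset ℝ) : Polynomial ℝ := (κ.map fun a => Polynomial.X + Polynomial.C a).prod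

lemma natDegree_shiftPoly (κ : Multiset ℝ) : (shiftPoly κ).natDegree = κ.card :=
  by
  rw [shiftPoly, Polynomial.natDegree_multiset_prod_of_monic]
  · simp [Multiset.map_map]
  · simpa using fun a _ => Polynomial.monic_X_add_C a

lemma coeff_shiftPoly {κ : Multiset ℝ} {d k : ℕ} (hd : κ.card = d + k) :
    (shiftPoly κ).coeff d = κ.esymm k := by
  rw [shiftPoly, Multiset.prod_X_add_C_coeff _ (by omega)]
  congr 1
  omega

/-- Adding τ times the projection only replaces s by s + τ, hence the derivative of ∏ (s + κ). -/
lemma detDeriv_frameMap_proj {ν : X} (hν : ‖ν‖ = 1) (Z : X) (B : X →L[ℝ] X)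
    {w : (ℝ ∙ ν)ᗮ →ₗ[ℝ] (ℝ ∙ ν)ᗮ} (hw : ∀ v, (w v : X) = B v) (hs : w.charpoly.Splits) (s : ℝ) :
    detDeriv (frameMap ν Z (s • ContinuousLinearMap.id ℝ X + B)) (hyperplaneProj ν) =
      ⟪ν, Z⟫ * (shiftPoly w.charpoly.roots).derivative.eval s := by
  refine detDeriv_eq (f := fun τ => ⟪ν, Z⟫ * (shiftPoly w.charpoly.roots).eval (s + τ))
    (fun τ => ?_) ?_
  · rw [shiftPoly, ← det_smul_id_add hs, ← det_frameMap hν Z B w hw]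
    congr 1
    ext v
    simp [frameMap_apply]
    module
  · have h : HasDerivAt (fun τ => (shiftPoly w.charpoly.roots).eval τ) _ (s + 0) :=
      (shiftPoly w.charpoly.roots).hasDerivAt (s + 0)
    simpa using! (h.comp_const_add s 0).const_mul ⟪ν, Z⟫

/-- The perturbation only replaces `Z` by Z + τx, and the determinant is affine in ⟨ν, Z⟩. -/
lemma detDeriv_frameMap_smulRight {ν : X} (hν : ‖ν‖ = 1) (Z x : X) (B : X →L[ℝ] X)
    {w : (ℝ ∙ ν)ᗮ →ₗ[ℝ] (ℝ ∙ ν)ᗮ} (hw : ∀ v, (w v : X) = B v) (hs : w.charpoly.Splits) (s : ℝ) :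
    detDeriv (frameMap ν Z (s • ContinuousLinearMap.id ℝ X + B)) ((innerSL ℝ ν).smulRight x) =
      ⟪ν, x⟫ * (shiftPoly w.charpoly.roots).eval s := by
  refine detDeriv_eq (f := fun τ => (⟪ν, Z⟫ + τ * ⟪ν, x⟫) * (shiftPoly w.charpoly.roots).eval s)
    (fun τ => ?_) ?_
  · rw [shiftPoly, ← det_smul_id_add hs, ← real_inner_smul_right, ← inner_add_right,
      ← det_frameMap hν _ B w hw]
    congr 1
    ext v
    simp [frameMap_apply]
    module
  · simpa using ((((hasDerivAt_id (0 : ℝ)).mul_const ⟪ν, x⟫).const_add ⟪ν, Z⟫).mul_const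
      ((shiftPoly w.charpoly.roots).eval s))

end HyperplaneDet

/-! ### Cut-off functions -/

section Cutoff

open Set Topology

variable {V : Type*} [NormedAddCommGroup V] [NormedSpace ℝ V]

lemma contDiff_smul_of_tsupport_subset {F : Type*} [NormedAddCommGroup F] [NormedSpace ℝ F]
    {η : V → ℝ} {g : V → F} {U : Set V} (hη : ContDiff ℝ 1 η) (hU : IsOpen U) (hηU : tsupport η ⊆ U)
    (hg : ContDiffOn ℝ 1 g U) : ContDiff ℝ 1 fun x => η x • g x := by
  refine contDiff_iff_contDiffAt.2 fun x => ?_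
  by_cases hx : x ∈ U
  · exact hη.contDiffAt.smul (hg.contDiffAt (hU.mem_nhds hx))
  · refine (contDiffAt_const (c := (0 : F))).congr_of_eventuallyEq ?_
    filter_upwards [(isClosed_tsupport η).isOpen_compl.mem_nhds fun h => hx (hηU h)] with z hz
    rw [image_eq_zero_of_notMem_tsupport hz, zero_smul]

variable [FiniteDimensional ℝ V]

lemma exists_contDiff_cutoff {K U : Set V} (hK : IsCompact K) (hU : IsOpen U) (hKU : K ⊆ U) :
    ∃ η : V → ℝ, ContDiff ℝ 1 η ∧ HasCompactSupport η ∧ tsupport η ⊆ U ∧ ∀ x ∈ K, η =ᶠ[𝓝 x] 1 := by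
  obtain ⟨L, hL, hKL, hLU⟩ := exists_compact_between hK hU hKU
  obtain ⟨η, h1, h0, -⟩ := exists_contMDiffMap_one_nhds_of_subset_interior (n := 1) 𝓘(ℝ, V)
    hK.isClosed hKL
  have hts : tsupport η ⊆ L := closure_minimal
    (fun x hx => by_contra fun hxL => hx (h0 x hxL)) hL.isClosed
  refine ⟨η, η.contMDiff.contDiff, hL.of_isClosed_subset (isClosed_tsupport _) hts,
    hts.trans hLU, fun x hx => ?_⟩
  exact (Filter.Eventually.filter_mono (nhds_le_nhdsSet hx) h1)

end Cutoff

/-! ### The flux identity in a chart -/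

section ChartFlux

open Set Topology Module MeasureTheory

lemma continuousOn_comp_col {X V F : Type*} [TopologicalSpace X] [NormedAddCommGroup V]
    [NormedSpace ℝ V] [NormedAddCommGroup F] [NormedSpace ℝ F] {a : X → F} {L : X → V →L[ℝ] F}
    {s : Set X} (ha : ContinuousOn a s) (hL : ContinuousOn L s) (e : F →L[ℝ] ℝ × V) :
    ContinuousOn (fun x => e ∘L col (a x) (L x)) s :=
  continuousOn_const.clm_comp (continuous_col.comp_continuousOn (ha.prodMk hL))

lemma continuousOn_det_comp_col {X V F : Type*} [TopologicalSpace X] [NormedAddCommGroup V]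
    [NormedSpace ℝ V] [FiniteDimensional ℝ V] [NormedAddCommGroup F] [NormedSpace ℝ F]
    {a : X → F} {L : X → V →L[ℝ] F}
    {s : Set X} (ha : ContinuousOn a s) (hL : ContinuousOn L s) (e : F →L[ℝ] ℝ × V) :
    ContinuousOn (fun x => (e ∘L col (a x) (L x)).det) s :=
  (contDiff_det (m := 0)).continuous.comp_continuousOn (continuousOn_comp_col ha hL e)

variable {n : ℕ} {F : Sph n → ℝ} {S : Set (Space n)} {ν : Space n → Sph n}

namespace SurfaceChart

variable {c : SurfaceChart S} {N : Space n → Space n}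

lemma continuousOn_fderiv_φ (c : SurfaceChart S) : ContinuousOn (fderiv ℝ c.φ) c.N :=
  c.contDiffOn_φ.continuousOn_fderiv_of_isOpen c.isOpen_N le_rfl

lemma measurableSet_D (c : SurfaceChart S) : MeasurableSet c.D :=
  c.isOpen_N.measurableSet.inter (measurableSet_le measurable_const c.ℓ.measurable)

/-- The orientation of the chart is constant, so that the area density is a constant multiple of
a determinant. -/
lemma IsNormalExtension.exists_normDet_eq (h : c.IsNormalExtension ν N)
    (e : Space n ≃L[ℝ] ℝ × EuclideanSpace ℝ (Fin n)) :
    ∃ k : ℝ, ∀ y ∈ c.N, (fderiv ℝ c.φ y).toLinearMap.normDet =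
      k * ((e : Space n →L[ℝ] ℝ × EuclideanSpace ℝ (Fin n)) ∘L col (N (c.φ y)) (fderiv ℝ c.φ y)).det := by
  obtain ⟨b, hb, hdet⟩ := exists_abs_det_col_eq e
  have habs : ∀ y ∈ c.N, |((e : Space n →L[ℝ] ℝ × EuclideanSpace ℝ (Fin n)) ∘L col (N (c.φ y)) (fderiv ℝ c.φ y)).det| =
      b * (fderiv ℝ c.φ y).toLinearMap.normDet := fun y hy =>
    hdet _ _ (h.norm_eq _ (c.mapsTo_φ hy)) (h.inner_fderiv_φ y hy)
  have hcont : ContinuousOn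
      (fun y => ((e : Space n →L[ℝ] ℝ × EuclideanSpace ℝ (Fin n)) ∘L col (N (c.φ y)) (fderiv ℝ c.φ y)).det) c.N := by
    exact continuousOn_det_comp_col (h.contDiffOn.continuousOn.comp
      c.contDiffOn_φ.continuousOn c.mapsTo_φ) c.continuousOn_fderiv_φ _
  have hne : ∀ y ∈ c.N,
      |((e : Space n →L[ℝ] ℝ × EuclideanSpace ℝ (Fin n)) ∘L col (N (c.φ y)) (fderiv ℝ c.φ y)).det| ≠ 0 := fun y hy => by
    rw [habs y hy]
    refine mul_ne_zero hb.ne' fun h0 => LinearMap.normDet_eq_zero_iff_ker_ne_bot.1 h0 ?_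
    exact LinearMap.ker_eq_bot.2 (c.injective_fderiv_φ y hy)
  rcases c.convex_N.isPreconnected.eq_or_eq_neg_of_sq_eq hcont hcont.abs
    (fun y _ => by simp) (fun {y} hy => hne y hy) with hs | hs
  · refine ⟨b⁻¹, fun y hy => ?_⟩
    have := hs hy
    simp only at this
    rw [this, habs y hy, inv_mul_cancel_left₀ hb.ne']
  · refine ⟨-b⁻¹, fun y hy => ?_⟩
    have := hs hy
    simp only [Pi.neg_apply] at this
    rw [this, habs y hy]
    field_simp

lemma IsNormalExtension.isParametrization (h : c.IsNormalExtension ν N) :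
    IsParametrization c.φ (fderiv ℝ c.φ) c.D where
  measurableSet := c.measurableSet_D
  hasStrictFDerivAt y hy :=
    (c.contDiffOn_φ.contDiffAt (c.isOpen_N.mem_nhds hy.1)).hasStrictFDerivAt (by simp)
  injective y hy := c.injective_fderiv_φ y hy.1
  injOn := c.injOn_φ.mono c.D_subset
  continuousOn_normDet := by
    obtain ⟨k, hk⟩ := h.exists_normDet_eq (splitFirst n)
    refine ContinuousOn.congr ?_ fun y hy => hk y hy.1
    exact continuousOn_const.mul (continuousOn_det_comp_col ((h.contDiffOn.continuousOn.comp
      c.contDiffOn_φ.continuousOn c.mapsTo_φ).mono c.D_subset)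
        (c.continuousOn_fderiv_φ.mono c.D_subset) _)

end SurfaceChart

/-- The map that takes the frame `(ν, ∂φ)` of a parametrization `φ` of `S` to `(Z, ∂Z)`, for
`Z = s x + Φ(ν) + ω₀ V`. -/
def parallelFrame (F : Sph n → ℝ) (ω₀ : ℝ) (V : Space n) (S : Set (Space n)) (ν : Space n → Sph n)
    (s : ℝ) (x : Space n) : Space n →L[ℝ] Space n :=
  frameMap (ν x : Space n) (s • x + (anisoNormal F ν x + ω₀ • V))
    (s • ContinuousLinearMap.id ℝ (Space n) + fderivWithin ℝ (anisoNormal F ν) S x)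

/-- The exterior derivative of `det (χ x, Z, dZ, …, dZ)` with respect to the area measure, as a
function of the values `a = χ(x)` and `d = dχ(x)`. -/
def fluxDensity (F : Sph n → ℝ) (ω₀ : ℝ) (V : Space n) (S : Set (Space n)) (ν : Space n → Sph n)
    (s : ℝ) (x : Space n) (a : ℝ) (d : Space n →L[ℝ] ℝ) : ℝ :=
  detDeriv (parallelFrame F ω₀ V S ν s x)
      ((a • ContinuousLinearMap.id ℝ (Space n) + d.smulRight x) ∘L hyperplaneProj (ν x : Space n))
    - n * detDeriv (parallelFrame F ω₀ V S ν s x)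
      ((innerSL ℝ (ν x : Space n)).smulRight (a • x))

lemma fluxDensity_zero (ω₀ : ℝ) (V : Space n) (s : ℝ) (x : Space n) :
    fluxDensity F ω₀ V S ν s x 0 0 = 0 := by
  have h1 : (ContinuousLinearMap.smulRight (0 : Space n →L[ℝ] ℝ) x) = 0 := by ext; simp
  have h2 : (innerSL ℝ (ν x : Space n)).smulRight ((0 : ℝ) • x) = 0 := by ext; simp
  rw [fluxDensity, h1, h2]
  simp

lemma fluxDensity_add (ω₀ : ℝ) (V : Space n) (s : ℝ) (x : Space n) (a b : ℝ)
    (d d' : Space n →L[ℝ] ℝ) :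
    fluxDensity F ω₀ V S ν s x (a + b) (d + d') =
      fluxDensity F ω₀ V S ν s x a d + fluxDensity F ω₀ V S ν s x b d' := by
  have h1 : ((a + b) • ContinuousLinearMap.id ℝ (Space n) + (d + d').smulRight x) ∘L
      hyperplaneProj (ν x : Space n) =
      (a • ContinuousLinearMap.id ℝ (Space n) + d.smulRight x) ∘L hyperplaneProj (ν x : Space n) +
      (b • ContinuousLinearMap.id ℝ (Space n) + d'.smulRight x) ∘L
        hyperplaneProj (ν x : Space n) := by
    ext1 v
    simp only [ContinuousLinearMap.comp_apply, add_apply, smul_apply,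
      ContinuousLinearMap.smulRight_apply]
    module
  have h2 : (innerSL ℝ (ν x : Space n)).smulRight ((a + b) • x) =
      (innerSL ℝ (ν x : Space n)).smulRight (a • x) +
      (innerSL ℝ (ν x : Space n)).smulRight (b • x) := by
    ext1 v
    simp only [add_apply, ContinuousLinearMap.smulRight_apply]
    module
  rw [fluxDensity, fluxDensity, fluxDensity, h1, h2, map_add, map_add]
  ring

end ChartFlux

/-! ### Stokes' formula on the part of the hypersurface covered by a chart -/

section LocalFlux

open Set Topology Module MeasureTheory

variable {n : ℕ} {F : Sph n → ℝ} {S : Set (Space n)} {ν : Space n → Sph n}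

lemma detDeriv_comp_frame {X E : Type*} [NormedAddCommGroup X] [NormedSpace ℝ X]
    [FiniteDimensional ℝ X] [NormedAddCommGroup E] [NormedSpace ℝ E] [FiniteDimensional ℝ E]
    (e : X ≃L[ℝ] E) (R M : X →L[ℝ] X) (G : E →L[ℝ] X) :
    detDeriv ((e : X →L[ℝ] E) ∘L R ∘L G) ((e : X →L[ℝ] E) ∘L M ∘L G) =
      ((e : X →L[ℝ] E) ∘L G).det * detDeriv R M := by
  rw [← detDeriv_conj e R M, ← detDeriv_comp_right]
  congr 2 <;> ext <;> simp

/-- All three column maps factor through the frame (ν, L). Its determinant splits off and, in a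
chart, is a constant multiple of the area density, leaving a quantity independent of the
parametrization. -/
lemma detDeriv_col_eq_fluxDensity (e : Space n ≃L[ℝ] ℝ × EuclideanSpace ℝ (Fin n)) (ω₀ : ℝ)
    (V : Space n) (s : ℝ) (x : Space n) (a : ℝ) (d : Space n →L[ℝ] ℝ)
    (L : EuclideanSpace ℝ (Fin n) →L[ℝ] Space n) (hL : ∀ u, ⟪(ν x : Space n), L u⟫ = 0) :
    detDeriv ((e : Space n →L[ℝ] ℝ × EuclideanSpace ℝ (Fin n)) ∘L
          col (s • x + (anisoNormal F ν x + ω₀ • V))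
            (s • L + fderivWithin ℝ (anisoNormal F ν) S x ∘L L))
        ((e : Space n →L[ℝ] ℝ × EuclideanSpace ℝ (Fin n)) ∘L
          col 0 (a • L + (d ∘L L).smulRight x))
      - n * detDeriv ((e : Space n →L[ℝ] ℝ × EuclideanSpace ℝ (Fin n)) ∘L
          col (s • x + (anisoNormal F ν x + ω₀ • V))
            (s • L + fderivWithin ℝ (anisoNormal F ν) S x ∘L L))
        ((e : Space n →L[ℝ] ℝ × EuclideanSpace ℝ (Fin n)) ∘L col (a • x) 0)
      = ((e : Space n →L[ℝ] ℝ × EuclideanSpace ℝ (Fin n)) ∘L col (ν x : Space n) L).det *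
        fluxDensity F ω₀ V S ν s x a d := by
  have h1 : col (s • x + (anisoNormal F ν x + ω₀ • V))
      (s • L + fderivWithin ℝ (anisoNormal F ν) S x ∘L L) =
      parallelFrame F ω₀ V S ν s x ∘L col (ν x : Space n) L := by
    refine ContinuousLinearMap.ext fun p => ?_
    simp [parallelFrame, frameMap_apply, inner_add_right, real_inner_smul_right, hL]
  have h2 : col 0 (a • L + (d ∘L L).smulRight x) =
      ((a • ContinuousLinearMap.id ℝ (Space n) + d.smulRight x) ∘L
        hyperplaneProj (ν x : Space n)) ∘L col (ν x : Space n) L := by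
    refine ContinuousLinearMap.ext fun p => ?_
    simp [inner_add_right, real_inner_smul_right, hL]
  have h3 : col (a • x) 0 =
      (innerSL ℝ (ν x : Space n)).smulRight (a • x) ∘L col (ν x : Space n) L := by
    refine ContinuousLinearMap.ext fun p => ?_
    simp [inner_add_right, real_inner_smul_right, hL]
  rw [h1, h2, h3, detDeriv_comp_frame, detDeriv_comp_frame, fluxDensity]
  ring

lemma inner_lastVec (x : Space n) : ⟪x, (lastVec n : Space n)⟫ = x (Fin.last n) := by
  simp [lastVec, EuclideanSpace.inner_single_right]

/-- ⟨Φ(z), z⟩ = F(z) at z = ±E normalizes the last coordinate of `V` to 1 when ω₀ ≠ 0. This is all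
that the argument needs to know about `V`. -/
lemma IsCapillaryVector.mul_last {ω₀ : ℝ} {V : Space n} (hF : IsAnisotropy F)
    (hV : IsCapillaryVector F ω₀ V) : ω₀ * V (Fin.last n) = ω₀ := by
  rcases lt_trichotomy ω₀ 0 with h | h | h
  · rw [← inner_lastVec, hV.of_neg h, real_inner_smul_left, inner_cahnHoffman_self hF,
      inv_mul_cancel₀ (hF.pos _).ne', mul_one]
  · rw [h, zero_mul]
  · have h1 : ⟪cahnHoffman F (-lastVec n), (lastVec n : Space n)⟫ = -F (-lastVec n) := by
      rw [← inner_cahnHoffman_self hF (-lastVec n)]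
      simp
    rw [← inner_lastVec, hV.of_pos h, inner_neg_left, real_inner_smul_left, h1, mul_neg (_ : ℝ)⁻¹,
      neg_neg, inv_mul_cancel₀ (hF.pos _).ne', mul_one]

/-- Here the capillary condition enters: the contribution -ω₀ of Φ(ν) is cancelled by that of ω₀ V.
-/
lemma IsCapillaryHypersurface.last_eq_zero {ω₀ : ℝ} {V : Space n} (hF : IsAnisotropy F)
    (hV : IsCapillaryVector F ω₀ V) (hS : IsCapillaryHypersurface F ω₀ S ν) {x : Space n}
    (hx : x ∈ bdry S) (s : ℝ) :
    (s • x + (anisoNormal F ν x + ω₀ • V)) (Fin.last n) = 0 := by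
  have h1 := hS.capillary x hx
  rw [inner_neg_right, inner_lastVec] at h1
  have h2 := hV.mul_last hF
  simp only [PiLp.add_apply, PiLp.smul_apply, hS.bdry_subset x hx, smul_eq_mul, anisoNormal]
  linarith

/-- The boundary of the half-space is null. -/
lemma volume_zero_level {V : Type*} [NormedAddCommGroup V] [NormedSpace ℝ V]
    [FiniteDimensional ℝ V] [MeasurableSpace V] [BorelSpace V] (μ : Measure V)
    [μ.IsAddHaarMeasure] {ℓ : V →L[ℝ] ℝ} {v : V} (hv : ℓ v = 1) :
    ({y | 0 ≤ ℓ y} : Set V) =ᵐ[μ] {y | 0 < ℓ y} := by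
  have h0 : μ (LinearMap.ker ℓ.toLinearMap : Set V) = 0 := by
    refine Measure.addHaar_submodule μ _ fun h => ?_
    have : v ∈ LinearMap.ker ℓ.toLinearMap := h ▸ Submodule.mem_top
    have h' : ℓ v = 0 := this
    norm_num [hv] at h'
  have h1 : ∀ᵐ y ∂μ, y ∉ (LinearMap.ker ℓ.toLinearMap : Set V) := measure_eq_zero_iff_ae_notMem.1 h0
  filter_upwards [h1] with y hy
  have hy' : ℓ y ≠ 0 := hy
  exact propext ⟨fun h => lt_of_le_of_ne h hy'.symm, fun h => le_of_lt (b := ℓ y) h⟩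

lemma exists_halfSpace_equiv (ℓ : EuclideanSpace ℝ (Fin n) →L[ℝ] ℝ) {v : EuclideanSpace ℝ (Fin n)}
    (hv : ℓ v = 1) :
    ∃ e : Space n ≃L[ℝ] ℝ × EuclideanSpace ℝ (Fin n), ∀ x, ℓ (e x).2 = x (Fin.last n) := by
  obtain ⟨e, -, he⟩ := exists_linearEquiv_of_dual (X := Space n)
    (Y := ℝ × EuclideanSpace ℝ (Fin n)) (by simp [add_comm])
    (EuclideanSpace.proj (𝕜 := ℝ) (Fin.last n)).toLinearMap (v := (lastVec n : Space n))
    (by simp [lastVec]) (ℓ.toLinearMap ∘ₗ LinearMap.snd ℝ ℝ (EuclideanSpace ℝ (Fin n)))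
    (w := (0, v)) (by simpa using hv)
  exact ⟨e.toContinuousLinearEquiv, fun x => by simpa using! he x⟩

/-- Stokes' formula for Z and A = χ x, pulled back to the half-space. The equivalence `e` is chosen
so that ℓ reads off the last coordinate, which turns the two boundary conditions into those required
there. -/
theorem SurfaceChart.IsNormalExtension.integral_fluxDensity {c : SurfaceChart S}
    {N : Space n → Space n} (h : c.IsNormalExtension ν N) {ω₀ : ℝ} {V : Space n}
    (hF : IsAnisotropy F) (hV : IsCapillaryVector F ω₀ V)
    (hS : IsCapillaryHypersurface F ω₀ S ν) {χ : Space n → ℝ} (hχ : ContDiff ℝ 1 χ)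
    (hχc : HasCompactSupport χ) (hχU : tsupport χ ⊆ c.U) (s : ℝ) :
    IntegrableOn (fun x => fluxDensity F ω₀ V S ν s x (χ x) (fderiv ℝ χ x)) S μHE[n] ∧
      ∫ x in S, fluxDensity F ω₀ V S ν s x (χ x) (fderiv ℝ χ x) ∂μHE[n] = 0 := by
  obtain ⟨e, he⟩ := exists_halfSpace_equiv c.ℓ c.ℓ_v₀
  let e' : Space n →L[ℝ] ℝ × EuclideanSpace ℝ (Fin n) := e
  obtain ⟨k, hk⟩ := h.exists_normDet_eq e
  let K : Set (EuclideanSpace ℝ (Fin n)) := c.N ∩ c.φ ⁻¹' tsupport χ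
  have hK : IsCompact K := c.isCompact_preimage _ hχU hχc
  -- The fields are controlled only on the chart domain. Multiplying by η makes them global, and η =
  -- 1 near the support of χ ∘ φ, so the integrand does not change.
  obtain ⟨η, hη, hηc, hηN, hηK⟩ := exists_contDiff_cutoff hK c.isOpen_N inter_subset_left
  let Z₀ : EuclideanSpace ℝ (Fin n) → Space n := fun y =>
    s • c.φ y + (cahnHoffmanExt F (N (c.φ y)) + ω₀ • V)
  let A₀ : EuclideanSpace ℝ (Fin n) → Space n := fun y => χ (c.φ y) • c.φ y
  let Z : EuclideanSpace ℝ (Fin n) → Space n := fun y => η y • Z₀ y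
  let A : EuclideanSpace ℝ (Fin n) → Space n := fun y => η y • A₀ y
  have hZ : ContDiff ℝ 1 Z := contDiff_smul_of_tsupport_subset hη c.isOpen_N hηN
    ((c.contDiffOn_φ.const_smul s).add (((h.contDiffOn_cahnHoffmanExt hF).comp c.contDiffOn_φ
      c.mapsTo_φ).add contDiffOn_const))
  have hA : ContDiff ℝ 1 A := contDiff_smul_of_tsupport_subset hη c.isOpen_N hηN
    ((hχ.comp_contDiffOn c.contDiffOn_φ).smul c.contDiffOn_φ)
  have hbd : ∀ y ∈ c.N, c.ℓ y = 0 → c.φ y ∈ bdry S := c.isBoundaryPoint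
  have hD : ∀ y ∈ c.N, c.ℓ y = 0 → y ∈ c.D := fun y hy h0 => ⟨hy, h0.ge⟩
  have hZ₀ : ∀ y ∈ c.D, Z₀ y = s • c.φ y + (anisoNormal F ν (c.φ y) + ω₀ • V) := fun y hy => by
    rw [h.anisoNormal_eq (c.mapsTo_φ_D hy)]
  have hη0 : ∀ y ∉ c.N, η y = 0 := fun y hy => image_eq_zero_of_notMem_tsupport fun h => hy (hηN h)
  have hZb : ∀ y, c.ℓ y = 0 → c.ℓ (e (Z y)).2 = 0 := fun y hy => by
    rw [he]
    by_cases hyN : y ∈ c.N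
    · simp only [Z, hZ₀ y (hD y hyN hy)]
      rw [PiLp.smul_apply, hS.last_eq_zero hF hV (hbd y hyN hy), smul_zero]
    · simp [Z, hη0 y hyN]
  have hAb : ∀ y, c.ℓ y = 0 → c.ℓ (e (A y)).2 = 0 := fun y hy => by
    rw [he]
    by_cases hyN : y ∈ c.N
    · simp [A, A₀, hS.bdry_subset _ (hbd y hyN hy)]
    · simp [A, hη0 y hyN]
  let I : EuclideanSpace ℝ (Fin n) → ℝ := fun y =>
    detDeriv (e' ∘L col (Z y) (fderiv ℝ Z y)) (e' ∘L col 0 (fderiv ℝ A y))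
      - n * detDeriv (e' ∘L col (Z y) (fderiv ℝ Z y)) (e' ∘L col (A y) 0)
  have hint : ∫ y in {y | 0 < c.ℓ y}, I y = 0 := by
    have := integral_detDeriv_halfSpace volume c.ℓ_v₀ e hZ hA hηc.smul_right hηc.smul_right hZb hAb
    rwa [finrank_euclideanSpace_fin] at this
  have hI0 : ∀ y, A =ᶠ[𝓝 y] 0 → I y = 0 := fun y hy => by
    have h1 : col (A y) (0 : EuclideanSpace ℝ (Fin n) →L[ℝ] Space n) = 0 := by
      exact ContinuousLinearMap.ext fun p => by simp [hy.eq_of_nhds]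
    have h2 : col 0 (fderiv ℝ A y) = 0 := by
      exact ContinuousLinearMap.ext fun p => by simp [hy.fderiv_eq]
    simp only [I, h1, h2, ContinuousLinearMap.comp_zero, map_zero, mul_zero, sub_zero]
  have hIts : ∀ y ∉ tsupport η, I y = 0 := fun y hy => hI0 y <| by
    filter_upwards [(isClosed_tsupport η).isOpen_compl.mem_nhds hy] with z hz
    simp [A, image_eq_zero_of_notMem_tsupport hz]
  have hIc : Continuous I := by
    have hcol : ∀ {a : EuclideanSpace ℝ (Fin n) → Space n}
        {L : EuclideanSpace ℝ (Fin n) → EuclideanSpace ℝ (Fin n) →L[ℝ] Space n},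
        Continuous a → Continuous L → Continuous fun y => e' ∘L col (a y) (L y) := fun ha hL =>
      continuous_const.clm_comp (continuous_col.comp (ha.prodMk hL))
    have hZ' := hcol hZ.continuous (hZ.continuous_fderiv (by simp))
    exact (continuous_detDeriv.comp (hZ'.prodMk (hcol continuous_const
      (hA.continuous_fderiv (by simp))))).sub (continuous_const.mul
        (continuous_detDeriv.comp (hZ'.prodMk (hcol hA.continuous continuous_const))))
  have hIint : Integrable I := hIc.integrable_of_hasCompactSupport
    (HasCompactSupport.intro hηc fun y hy => hIts y hy)
  have key : ∀ y ∈ c.D, I y = (e' ∘L col (ν (c.φ y) : Space n) (fderiv ℝ c.φ y)).det *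
      fluxDensity F ω₀ V S ν s (c.φ y) (χ (c.φ y)) (fderiv ℝ χ (c.φ y)) := by
    intro y hy
    by_cases hyK : y ∈ K
    · have hη1 := hηK y hyK
      have hφ := c.hasFDerivAt_φ hy.1
      have hZe : Z =ᶠ[𝓝 y] Z₀ := by
        filter_upwards [hη1] with z hz
        simp [Z, hz]
      have hAe : A =ᶠ[𝓝 y] A₀ := by
        filter_upwards [hη1] with z hz
        simp [A, hz]
      have hZd : fderiv ℝ Z y = s • fderiv ℝ c.φ y +
          fderivWithin ℝ (anisoNormal F ν) S (c.φ y) ∘L fderiv ℝ c.φ y := by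
        rw [hZe.fderiv_eq]
        have h1 : HasFDerivAt Z₀ _ y := (hφ.const_smul s).add
          (((h.hasFDerivAt_cahnHoffmanExt hF (c.mapsTo_φ hy.1)).comp y hφ).add_const (ω₀ • V))
        rw [h1.fderiv]
        ext1 u
        simp [h.fderivWithin_anisoNormal_comp hF hy u]
      have hAd : fderiv ℝ A y = χ (c.φ y) • fderiv ℝ c.φ y +
          (fderiv ℝ χ (c.φ y) ∘L fderiv ℝ c.φ y).smulRight (c.φ y) := by
        rw [hAe.fderiv_eq]
        have h1 : HasFDerivAt A₀ _ y :=
          (((hχ.differentiable (by simp)) (c.φ y)).hasFDerivAt.comp y hφ).smul hφ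
        exact h1.fderiv
      rw [← detDeriv_col_eq_fluxDensity e ω₀ V s (c.φ y) _ _ _
        (c.inner_normal_fderiv hS.unitNormal hy), ← hZ₀ y hy, ← hZd, ← hAd,
        ← hZe.eq_of_nhds]
      have : χ (c.φ y) • c.φ y = A y := hAe.eq_of_nhds.symm
      rw [this]
    · have hts : c.φ y ∉ tsupport χ := fun h => hyK ⟨hy.1, h⟩
      have hχ0 : χ =ᶠ[𝓝 (c.φ y)] 0 := by
        filter_upwards [(isClosed_tsupport χ).isOpen_compl.mem_nhds hts] with z hz
          using image_eq_zero_of_notMem_tsupport hz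
      rw [hI0 y ?_, hχ0.eq_of_nhds, hχ0.fderiv_eq]
      · have : fderiv ℝ (0 : Space n → ℝ) (c.φ y) = 0 := by simp
        rw [this, Pi.zero_apply, fluxDensity_zero, mul_zero]
      · filter_upwards [(c.hasFDerivAt_φ hy.1).continuousAt.eventually hχ0] with z hz
        simp [A, A₀, hz]
  have hcongr : ∀ y ∈ c.D, (fderiv ℝ c.φ y).toLinearMap.normDet *
      fluxDensity F ω₀ V S ν s (c.φ y) (χ (c.φ y)) (fderiv ℝ χ (c.φ y)) = k * I y := by
    intro y hy
    rw [hk y hy.1, key y hy, h.eq_coe _ (c.mapsTo_φ_D hy)]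
    ring
  have hp := h.isParametrization
  have hdim : finrank ℝ (EuclideanSpace ℝ (Fin n)) = n := by simp
  have himg : c.φ '' c.D = S ∩ c.U := c.inter_eq.symm
  have hSm : MeasurableSet S := hS.hypersurface.isCompact.isClosed.measurableSet
  have hzero : ∀ x ∈ S \ (S ∩ c.U),
      fluxDensity F ω₀ V S ν s x (χ x) (fderiv ℝ χ x) = 0 := by
    intro x hx
    have hts : x ∉ tsupport χ := fun h => hx.2 ⟨hx.1, hχU h⟩
    have hχ0 : χ =ᶠ[𝓝 x] 0 := by
      filter_upwards [(isClosed_tsupport χ).isOpen_compl.mem_nhds hts] with z hz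
        using image_eq_zero_of_notMem_tsupport hz
    have : fderiv ℝ (0 : Space n → ℝ) x = 0 := by simp
    rw [hχ0.eq_of_nhds, hχ0.fderiv_eq, this, Pi.zero_apply, fluxDensity_zero]
  constructor
  · refine IntegrableOn.of_forall_sdiff_eq_zero (s := S ∩ c.U) ?_ hSm hzero
    rw [← himg, integrableOn_image_iff_normDet hdim hp]
    exact ((hIint.const_mul k).integrableOn).congr_fun (fun y hy => (hcongr y hy).symm)
      c.measurableSet_D
  · rw [setIntegral_eq_of_subset_of_forall_sdiff_eq_zero hSm inter_subset_left hzero, ← himg,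
      integral_image_eq_integral_normDet hdim hp,
      setIntegral_congr_fun c.measurableSet_D hcongr, integral_const_mul]
    -- The support of η lies in the chart domain, so integrating over the whole closed half-space
    -- adds nothing.
    have h1 : ∫ y in c.D, I y = ∫ y in {y | 0 ≤ c.ℓ y}, I y := by
      refine (setIntegral_eq_of_subset_of_forall_sdiff_eq_zero
        (measurableSet_le measurable_const c.ℓ.measurable) inter_subset_right fun y hy => ?_).symm
      refine hIts y fun hyt => hy.2 ⟨hηN hyt, hy.1⟩
    rw [h1, setIntegral_congr_set (volume_zero_level volume c.ℓ_v₀), hint, mul_zero]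

end LocalFlux

/-! ### The Minkowski formulas -/

section Minkowski

open Set Topology Module MeasureTheory

/-- The sum must be 1 on a neighbourhood of `K`, not just on `K`, so that the ambient differentials
of the χ_i add up to zero at points of `K`. -/
lemma exists_contDiff_partition {V : Type*} [NormedAddCommGroup V] [NormedSpace ℝ V]
    [FiniteDimensional ℝ V] {K : Set V} (hK : IsCompact K) {ι : Type*} [Fintype ι] {U : ι → Set V}
    (hU : ∀ i, IsOpen (U i)) (hKU : K ⊆ ⋃ i, U i) :
    ∃ χ : ι → V → ℝ, (∀ i, ContDiff ℝ 1 (χ i)) ∧ (∀ i, HasCompactSupport (χ i)) ∧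
      (∀ i, tsupport (χ i) ⊆ U i) ∧ ∀ x ∈ K, (fun z => ∑ i, χ i z) =ᶠ[𝓝 x] 1 := by
  obtain ⟨L, hL, hKL, hLU⟩ := exists_compact_between hK (isOpen_iUnion hU) hKU
  obtain ⟨f, hf⟩ := SmoothPartitionOfUnity.exists_isSubordinate 𝓘(ℝ, V) hL.isClosed U hU hLU
  obtain ⟨η, hη, hηc, -, hηK⟩ := exists_contDiff_cutoff hK isOpen_univ (subset_univ K)
  refine ⟨fun i z => η z * f i z, fun i => hη.mul ((f i).contMDiff.contDiff.of_le (by simp)),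
    fun i => hηc.mul_right, fun i => (tsupport_mul_subset_right).trans (hf i), fun x hx => ?_⟩
  filter_upwards [hηK x hx, isOpen_interior.mem_nhds (hKL hx)] with z hz hzL
  have h1 := f.sum_eq_one (interior_subset hzL)
  rw [finsum_eq_sum_of_fintype] at h1
  simp [hz, h1]

variable {n : ℕ} {F : Sph n → ℝ} {S : Set (Space n)} {ν : Space n → Sph n} {ω₀ : ℝ} {V : Space n}

lemma fluxDensity_sum {ι : Type*} (t : Finset ι) (s : ℝ) (x : Space n) (a : ι → ℝ)
    (d : ι → Space n →L[ℝ] ℝ) :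
    fluxDensity F ω₀ V S ν s x (∑ i ∈ t, a i) (∑ i ∈ t, d i) =
      ∑ i ∈ t, fluxDensity F ω₀ V S ν s x (a i) (d i) := by
  classical
  induction t using Finset.induction_on with
  | empty => simp [fluxDensity_zero]
  | insert i t hi ih => rw [Finset.sum_insert hi, Finset.sum_insert hi, Finset.sum_insert hi,
      fluxDensity_add, ih]

lemma IsCompactHypersurface.exists_isNormalExtension (hn : 1 ≤ n) (hS : IsCompactHypersurface S)
    (hν : IsUnitNormal S ν) {x : Space n} (hx : x ∈ S) :
    ∃ (c : SurfaceChart S) (N : Space n → Space n), x ∈ c.U ∧ c.IsNormalExtension ν N := by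
  obtain ⟨c, hc⟩ := exists_surfaceChart hn (hS.locally_regular x hx)
  obtain ⟨N, hN⟩ := c.exists_isNormalExtension hν
  exact ⟨c, N, hc, hN⟩

/-- The generating function of the Minkowski formulas: its coefficient of degree `n - r` is, up to a
factor, the integrand of the `r`-th formula. -/
def minkowskiPoly (F : Sph n → ℝ) (ω₀ : ℝ) (V : Space n) (S : Set (Space n)) (ν : Space n → Sph n)
    (x : Space n) : Polynomial ℝ :=
  (Polynomial.C ⟪x, (ν x : Space n)⟫ * Polynomial.X +
      Polynomial.C (F (ν x) + ω₀ * ⟪(ν x : Space n), V⟫)) *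
      (shiftPoly (principalCurvatures F S ν x)).derivative
    - Polynomial.C (n * ⟪x, (ν x : Space n)⟫) * shiftPoly (principalCurvatures F S ν x)

lemma finrank_tangent (x : Space n) : finrank ℝ (tangent ν x) = n :=
  Submodule.finrank_orthogonal_span_singleton (n := n) (sph_ne_zero (ν x))

lemma natDegree_minkowskiPoly_le (x : Space n) :
    (minkowskiPoly F ω₀ V S ν x).natDegree ≤ n + 1 := by
  have hQ : (shiftPoly (principalCurvatures F S ν x)).natDegree ≤ n := by
    rw [natDegree_shiftPoly, principalCurvatures]
    refine (Polynomial.card_roots' _).trans ?_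
    rw [LinearMap.charpoly_natDegree, finrank_tangent]
  have hQ' := (Polynomial.natDegree_derivative_le (shiftPoly (principalCurvatures F S ν x)))
  refine (Polynomial.natDegree_sub_le _ _).trans (max_le ?_ ?_)
  · refine Polynomial.natDegree_mul_le.trans ?_
    have := Polynomial.natDegree_linear_le (a := ⟪x, (ν x : Space n)⟫)
      (b := F (ν x) + ω₀ * ⟪(ν x : Space n), V⟫)
    omega
  · exact (Polynomial.natDegree_C_mul_le _ _).trans (by omega)

/-- The multiset of real roots is complete because the characteristic polynomial splits; otherwise
its symmetric functions would not be the coefficients. -/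
lemma card_principalCurvatures (hF : IsAnisotropy F) (hn : 1 ≤ n) (hS : IsCompactHypersurface S)
    (hν : IsUnitNormal S ν) {x : Space n} (hx : x ∈ S) : (principalCurvatures F S ν x).card = n := by
  obtain ⟨c, N, hxU, h⟩ := hS.exists_isNormalExtension hn hν hx
  rw [principalCurvatures, ← (h.splits_charpoly_weingarten hF ⟨hx, hxU⟩).natDegree_eq_card_roots,
    LinearMap.charpoly_natDegree, finrank_tangent]

/-- In degree n - r, s P' and -nP contribute (n - r)σ_r - nσ_r = -rσ_r, and P' contributes (n - r +
1)σ_{r-1}; the binomial identity (n - r + 1) binom(n, r-1) = r binom(n, r) gives the common factor.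
-/
lemma coeff_minkowskiPoly (hF : IsAnisotropy F) (hn : 1 ≤ n) (hS : IsCompactHypersurface S)
    (hν : IsUnitNormal S ν) {x : Space n} (hx : x ∈ S) {r : ℕ} (hr : r ∈ Finset.Icc 1 n) :
    (minkowskiPoly F ω₀ V S ν x).coeff (n - r) = (r * n.choose r : ℝ) *
      (meanCurvature F S ν (r - 1) x * (F (ν x) + ω₀ * ⟪(ν x : Space n), V⟫)
          - meanCurvature F S ν r x * ⟪x, (ν x : Space n)⟫) := by
  obtain ⟨hr1, hrn⟩ := Finset.mem_Icc.1 hr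
  have hcard := card_principalCurvatures hF hn hS hν hx
  obtain ⟨k, rfl⟩ : ∃ k, r = k + 1 := ⟨r - 1, by omega⟩
  obtain ⟨m, rfl⟩ : ∃ m, n = m + (k + 1) := ⟨n - (k + 1), by omega⟩
  have h1 : (shiftPoly (principalCurvatures F S ν x)).coeff m =
      (principalCurvatures F S ν x).esymm (k + 1) := coeff_shiftPoly hcard
  have h2 : (shiftPoly (principalCurvatures F S ν x)).coeff (m + 1) =
      (principalCurvatures F S ν x).esymm k := coeff_shiftPoly (by omega)
  have h3 : (Polynomial.X * (shiftPoly (principalCurvatures F S ν x)).derivative).coeff m =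
      m * (shiftPoly (principalCurvatures F S ν x)).coeff m := by
    cases m with
    | zero => simp
    | succ m => rw [Polynomial.coeff_X_mul, Polynomial.coeff_derivative]; push_cast; ring
  have hchoose : ((m + (k + 1)).choose (k + 1) : ℝ) * (k + 1) = (m + (k + 1)).choose k * (m + 1) := by
    have := Nat.choose_succ_right_eq (m + (k + 1)) k
    rw [show m + (k + 1) - k = m + 1 by omega] at this
    exact_mod_cast this
  have hc1 : ((m + (k + 1)).choose (k + 1) : ℝ) ≠ 0 :=
    Nat.cast_ne_zero.2 (Nat.choose_pos (by omega)).ne'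
  have hc2 : ((m + (k + 1)).choose k : ℝ) ≠ 0 :=
    Nat.cast_ne_zero.2 (Nat.choose_pos (by omega)).ne'
  rw [Nat.add_sub_cancel, minkowskiPoly, add_mul, mul_assoc, Polynomial.coeff_sub,
    Polynomial.coeff_add, Polynomial.coeff_C_mul, Polynomial.coeff_C_mul, Polynomial.coeff_C_mul,
    h3, Polynomial.coeff_derivative, h1, h2, meanCurvature, meanCurvature, Nat.add_sub_cancel,
    mul_sub]
  have e1 : ((k + 1 : ℕ) : ℝ) * (m + (k + 1)).choose (k + 1) *
      ((principalCurvatures F S ν x).esymm k / (m + (k + 1)).choose k *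
        (F (ν x) + ω₀ * ⟪(ν x : Space (m + (k + 1))), V⟫)) =
      (m + 1) * (principalCurvatures F S ν x).esymm k *
        (F (ν x) + ω₀ * ⟪(ν x : Space (m + (k + 1))), V⟫) := by
    rw [show ((k + 1 : ℕ) : ℝ) * (m + (k + 1)).choose (k + 1) =
      (m + (k + 1)).choose k * (m + 1) by rw [← hchoose]; push_cast; ring]
    field_simp
  have e2 : ((k + 1 : ℕ) : ℝ) * (m + (k + 1)).choose (k + 1) *
      ((principalCurvatures F S ν x).esymm (k + 1) / (m + (k + 1)).choose (k + 1) *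
        ⟪x, (ν x : Space (m + (k + 1)))⟫) =
      (k + 1) * (principalCurvatures F S ν x).esymm (k + 1) * ⟪x, (ν x : Space (m + (k + 1)))⟫ := by
    push_cast
    field_simp
  rw [e1, e2]
  push_cast
  ring

lemma fluxDensity_one_zero (hF : IsAnisotropy F) (hn : 1 ≤ n) (hS : IsCompactHypersurface S)
    (hν : IsUnitNormal S ν) {x : Space n} (hx : x ∈ S) (s : ℝ) :
    fluxDensity F ω₀ V S ν s x 1 0 = (minkowskiPoly F ω₀ V S ν x).eval s := by
  obtain ⟨c, N, hxU, h⟩ := hS.exists_isNormalExtension hn hν hx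
  have hw : ∀ v : tangent ν x, (weingarten F S ν x v : Space n) =
      fderivWithin ℝ (anisoNormal F ν) S x v := fun v =>
    Submodule.starProjection_eq_self_iff.2 (mem_tangent_iff.2
      (h.inner_fderivWithin_anisoNormal hF ⟨hx, hxU⟩ (mem_tangent_iff.1 v.2)))
  have hs := h.splits_charpoly_weingarten hF ⟨hx, hxU⟩
  have hν1 : ‖(ν x : Space n)‖ = 1 := by simp
  have h1 : ((1 : ℝ) • ContinuousLinearMap.id ℝ (Space n) + (0 : Space n →L[ℝ] ℝ).smulRight x) ∘L
      hyperplaneProj (ν x : Space n) = hyperplaneProj (ν x : Space n) := by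
    refine ContinuousLinearMap.ext fun v => ?_
    simp
  have h2 : ⟪(ν x : Space n), anisoNormal F ν x⟫ = F (ν x) := by
    rw [real_inner_comm]
    exact inner_cahnHoffman_self hF _
  rw [fluxDensity, h1, one_smul, parallelFrame, detDeriv_frameMap_proj hν1 _ _ hw hs,
    detDeriv_frameMap_smulRight hν1 _ _ _ hw hs, minkowskiPoly, inner_add_right, inner_add_right,
    real_inner_smul_right, real_inner_smul_right, h2, real_inner_comm]
  simp only [Polynomial.eval_sub, Polynomial.eval_mul, Polynomial.eval_add, Polynomial.eval_C,
    Polynomial.eval_X, principalCurvatures]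
  ring

/-- The flux density is additive in the pair (χ, dχ), and on `S` the partition of unity sums to the
pair (1, 0). -/
theorem integral_eval_minkowskiPoly (hn : 1 ≤ n) (hF : IsAnisotropy F)
    (hV : IsCapillaryVector F ω₀ V) (hS : IsCapillaryHypersurface F ω₀ S ν) (s : ℝ) :
    IntegrableOn (fun x => (minkowskiPoly F ω₀ V S ν x).eval s) S μHE[n] ∧
      ∫ x in S, (minkowskiPoly F ω₀ V S ν x).eval s ∂μHE[n] = 0 := by
  have hK := hS.hypersurface.isCompact
  choose c N hxU h using fun x : S =>
    hS.hypersurface.exists_isNormalExtension hn hS.unitNormal x.2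
  obtain ⟨t, ht⟩ := hK.elim_finite_subcover (fun x : S => (c x).U) (fun x => (c x).isOpen_U)
    fun x hx => mem_iUnion.2 ⟨⟨x, hx⟩, hxU ⟨x, hx⟩⟩
  obtain ⟨χ, hχ, hχc, hχU, hχ1⟩ := exists_contDiff_partition hK
    (U := fun i : t => (c i).U) (fun i => (c i).isOpen_U) fun x hx => by
      obtain ⟨i, hi, hxi⟩ := mem_iUnion₂.1 (ht hx)
      exact mem_iUnion.2 ⟨⟨i, hi⟩, hxi⟩
  have hloc := fun i : t => (h i).integral_fluxDensity hF hV hS (hχ i) (hχc i) (hχU i) s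
  have hsum : EqOn (fun x => ∑ i, fluxDensity F ω₀ V S ν s x (χ i x) (fderiv ℝ (χ i) x))
      (fun x => (minkowskiPoly F ω₀ V S ν x).eval s) S := by
    intro x hx
    have h1 : ∑ i, χ i x = 1 := (hχ1 x hx).eq_of_nhds
    have h2 : ∑ i, fderiv ℝ (χ i) x = 0 := by
      have h3 := HasFDerivAt.fun_sum (u := Finset.univ) fun i _ =>
        ((hχ i).differentiable (by simp) x).hasFDerivAt
      rw [← h3.fderiv, (hχ1 x hx).fderiv_eq]
      simp
    simp only
    rw [← fluxDensity_sum, h1, h2, fluxDensity_one_zero hF hn hS.hypersurface hS.unitNormal hx]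
  have hSm : MeasurableSet S := hK.isClosed.measurableSet
  have hint := integrable_finsetSum Finset.univ fun i _ => (hloc i).1
  refine ⟨IntegrableOn.congr_fun hint hsum hSm, ?_⟩
  rw [← setIntegral_congr_fun hSm hsum, integral_finsetSum _ fun i _ => (hloc i).1]
  exact Finset.sum_eq_zero fun i _ => (hloc i).2

end Minkowski

end AnisotropicCapillary

end

open AnisotropicCapillary in
theorem theorem1p3 (n : ℕ) (hn : 1 ≤ n)
    (F : Sph n → ℝ) (hF : IsAnisotropy F)
    (ω₀ : ℝ) (hω₀ : ω₀ ∈ Set.Ioo (-F (lastVec n)) (F (-lastVec n)))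
    (V : Space n) (hV : IsCapillaryVector F ω₀ V)
    (S : Set (Space n)) (ν : Space n → Sph n) (hS : IsCapillaryHypersurface F ω₀ S ν) :
    (∀ r ∈ Finset.Icc 1 n,
      MeasureTheory.IntegrableOn
        (fun x => meanCurvature F S ν (r - 1) x * (F (ν x) + ω₀ * ⟪(ν x : Space n), V⟫)
          - meanCurvature F S ν r x * ⟪x, (ν x : Space n)⟫) S μHE[n] ∧
      ∫ x in S, (meanCurvature F S ν (r - 1) x * (F (ν x) + ω₀ * ⟪(ν x : Space n), V⟫)
          - meanCurvature F S ν r x * ⟪x, (ν x : Space n)⟫) ∂μHE[n] = 0) ∧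
    ∫ x in S, ((F (ν x) + ω₀ * ⟪(ν x : Space n), V⟫)
        - meanCurvature F S ν 1 x * ⟪x, (ν x : Space n)⟫) ∂μHE[n] = 0 := by
  have hSm : MeasurableSet S := hS.hypersurface.isCompact.isClosed.measurableSet
  have hI := fun s => integral_eval_minkowskiPoly hn hF hV hS s
  have main : ∀ r ∈ Finset.Icc 1 n, MeasureTheory.IntegrableOn
        (fun x => meanCurvature F S ν (r - 1) x * (F (ν x) + ω₀ * ⟪(ν x : Space n), V⟫)
          - meanCurvature F S ν r x * ⟪x, (ν x : Space n)⟫) S μHE[n] ∧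
      ∫ x in S, (meanCurvature F S ν (r - 1) x * (F (ν x) + ω₀ * ⟪(ν x : Space n), V⟫)
          - meanCurvature F S ν r x * ⟪x, (ν x : Space n)⟫) ∂μHE[n] = 0 := by
    intro r hr
    have hr' := Finset.mem_Icc.1 hr
    have hc : (r * n.choose r : ℝ) ≠ 0 := by
      have h1 : n.choose r ≠ 0 := (Nat.choose_pos hr'.2).ne'
      have h2 : r ≠ 0 := by omega
      exact mul_ne_zero (Nat.cast_ne_zero.2 h2) (Nat.cast_ne_zero.2 h1)
    have heq : Set.EqOn (fun x => (minkowskiPoly F ω₀ V S ν x).coeff (n - r))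
        (fun x => (r * n.choose r : ℝ) *
          (meanCurvature F S ν (r - 1) x * (F (ν x) + ω₀ * ⟪(ν x : Space n), V⟫)
            - meanCurvature F S ν r x * ⟪x, (ν x : Space n)⟫)) S := fun x hx =>
      coeff_minkowskiPoly hF hn hS.hypersurface hS.unitNormal hx hr
    have h1 := integrable_coeff_of_integrable_eval (fun x => natDegree_minkowskiPoly_le x)
      Set.infinite_univ (fun s _ => (hI s).1) (n - r)
    have h2 := integral_coeff_eq_zero_of_eval (fun x => natDegree_minkowskiPoly_le x)
      Set.infinite_univ (fun s _ => (hI s).1) (fun s _ => (hI s).2) (n - r)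
    rw [MeasureTheory.setIntegral_congr_fun hSm heq, MeasureTheory.integral_const_mul] at h2
    refine ⟨?_, (mul_eq_zero.1 h2).resolve_left hc⟩
    -- The factor is nonzero because 1 ≤ r ≤ n, so integrability passes from the coefficient to the
    -- integrand.
    have h3 := (MeasureTheory.IntegrableOn.congr_fun h1 heq hSm).const_mul (r * n.choose r : ℝ)⁻¹
    simp only [inv_mul_cancel_left₀ hc] at h3
    exact h3
  refine ⟨main, ?_⟩
  -- The case r = 1, where H_0 = 1 as the empty symmetric function divided by binom(n, 0).
  rw [← (main 1 (by simpa using hn)).2]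
  refine MeasureTheory.setIntegral_congr_fun hSm fun x _ => ?_
  simp [meanCurvature, Multiset.esymm]
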